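/- **Type-and-term structures.** Let $\mathbb H$ be the category generated by the graph with vertices $n$ and $n_t$ and edges $n\to n+1$ and $n\to n_t$ ($n\geq 1$). Let $[\mathbb H^{\mathrm{op}},\mathbf{Set}]$ be its category of presheaves; write $\partial$ for the maps $X(n+1)\to X(n)$ and $X(n_t)\to X(n)$. **Theories.** Expressions over an alphabet are built from variables and from $w(e_1,\dots,e_m)$ with $w$ in the alphabet. A judgement (up to renaming of variables) has one of the forms $\Gamma\vdash T\ \mathsf{type}$, $\Gamma\vdash t:T$, $\Gamma\vdash T=T'\ \mathsf{type}$, $\Gamma\vdash t=t':T$, with a context $\Gamma=(x_1:T_1,\dots,x_{n-1}:T_{n-1})$; its degree is $n$. Its boundary is the list, respectively, $(\Gamma'\vdash T_{n-1}\ \mathsf{type})$ with $\Gamma=(\Gamma',x_{n-1}:T_{n-1})$ (empty if $\Gamma$ is empty); $(\Gamma\vdash T\ \mathsf{type})$; $(\Gamma\vdash T\ \mathsf{type},\ \Gamma\vdash T'\ \mathsf{type})$; $(\Gamma\vdash t:T,\ \Gamma\vdash t':T)$. The deduction rules are: reflexivity, symmetry and transitivity of type equality and of term equality; conversion of $\Gamma\vdash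 t:T_1$ and $\Gamma\vdash t=t':T_1$ along $\Gamma\vdash T_1=T_2\ \mathsf{type}$; context conversion (from $\Gamma\vdash T_1=T_2\ \mathsf{type}$ and $\Gamma,x:T_1,\Delta\vdash\mathcal J$ derive $\Gamma,x:T_2,\Delta\vdash\mathcal J$); weakening (from $\Gamma\vdash T\ \mathsf{type}$ and $\Gamma,\Delta\vdash\mathcal J$ derive $\Gamma,y:T,\Delta\vdash\mathcal J$); and projection (from $\Gamma\vdash T\ \mathsf{type}$ derive $\Gamma,y:T\vdash y:T$), with $y$ fresh. A $\{w,p\}$-GAT consists of sets of type-constants and term-constants and a set of basic judgements over their union, such that each type-constant $A$ has exactly one basic judgement $\Gamma\vdash A(x_1,\dots,x_{n-1})\ \mathsf{type}$, each term-constant $f$ has exactly one basic judgement $\Gamma\vdash f(x_1,\dots,x_{n-1}):T$, all other basic judgements are equality judgements, and every basic judgement is derived; the derived judgements form the smallest collection closed under the rules that contains a basic judgement whenever it contains all of its boundary. Write $(x_1:S_1,\dots\vdash S_n\ \mathsf{type})\equiv(x_1:T_1,\dots\vdash T_n\ \mathsf{type})$ if $x_1:S_1,\dots,x_{i-1}:S_{i-1}\vdash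 S_i=T_i\ \mathsf{type}$ is derived for all $i\le n$, and $(\Gamma\vdash s:S)\equiv(\Delta\vdash t:T)$ if the boundaries are congruent and $\Gamma\vdash s=t:S$ is derived. An interpretation is a map between the sets of derived judgements that preserves the form of judgements, boundaries, and instances of the rules; two interpretations are identified if their values at every derived type or term judgement are congruent. This gives the category $\{w,p\}\text{-}\mathbf{GAT}$. The forgetful functor $V:\{w,p\}\text{-}\mathbf{GAT}\to[\mathbb H^{\mathrm{op}},\mathbf{Set}]$ sends $\mathbb T$ to the presheaf with $V\mathbb T(n)$ and $V\mathbb T(n_t)$ the sets of $\equiv$-classes of derived type, respectively term, judgements of degree $n$, and with the boundary maps. **Shapes.** A min-heap of size $n$ is a function $\varphi:\{0,\dots,n\}\to\{0,\dots,n\}$ with $\varphi(0)=0$ and $\varphi(i)<i$ for $i\geq1$; $\mathrm{Hp}(n)$ is the set of these. The depth of $i\ge 1$ is $|\{\varphi(i),\varphi^2(i),\dots\}|$. Let $[\varphi]$ be the presheaf whose type-elements of degree $m$ are the $i\in\{1,\dots,n\}$ of depth $m$, with $\partial i=\varphi(i)$, and with no term-elements, and let $[\varphi]_t$ be $[\varphi]$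 with one term-element adjoined over $n$ (for $n\geq1$). **Proposition.** The functor $V$ has a left adjoint. Let $G\dashv V$ be any left adjoint, and let $P=VG$ be the induced weakening-and-projection monad. Then: 1. $P$ is strongly cartesian: it preserves pullbacks, all naturality squares of its unit and of its multiplication are pullbacks, and it is local right adjoint, i.e. for every $X$ the functor $P/X:[\mathbb H^{\mathrm{op}},\mathbf{Set}]/X\to[\mathbb H^{\mathrm{op}},\mathbf{Set}]/PX$ is a right adjoint. 2. For every $n\geq1$ there is a bijection, natural in $X$, $$PX(n_t)\;\cong\;\sum_{\varphi\in\mathrm{Hp}(n)}\mathrm{Hom}([\varphi]_t,X)\;+\sum_{\varphi\in\mathrm{Hp}(n-1),\;1\leq i\leq n-1}\mathrm{Hom}([\varphi],X),$$ under which the second summand corresponds exactly to the projection terms: the elements indexed by $(\varphi,i)$ are classes of judgements of the form $x_1:T_1,\dots,x_{n-1}:T_{n-1}\vdash x_i:T$ (and of no such judgement with another variable $x_j$ in place of $x_i$), while no element of the first summand is the class of such a judgement for any $i$. -/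

import Mathlib

open CategoryTheory Opposite

universe u

/-! ### Local right adjoint functors and strongly cartesian monads -/

/-- A functor is local right adjoint if all the functors it induces on slice categories
are right adjoints. -/
def IsLocalRightAdjoint {C D : Type*} [Category C] [Category D] (F : C ⥤ D) : Prop :=
  ∀ X : C, (Over.post (X := X) F).IsRightAdjoint

/-- A monad is cartesian if it preserves pullbacks and all naturality squares of its unit and
of its multiplication are pullbacks. -/
structure IsCartesianMonad {C : Type*} [Category C] (T : Monad C) : Prop where
  preservesPullbacks :
    Limits.PreservesLimitsOfShape Limits.WalkingCospan T.toFunctor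
  unit_cartesian : NatTrans.Equifibered T.η
  mul_cartesian : NatTrans.Equifibered T.μ

/-- A monad is strongly cartesian if it is cartesian and local right adjoint. -/
structure IsStronglyCartesianMonad {C : Type*} [Category C] (T : Monad C) : Prop where
  isCartesian : IsCartesianMonad T
  isLocalRightAdjoint : IsLocalRightAdjoint T.toFunctor

/-! ### Type-and-term structures -/

/-- Vertices of the graph generating the category `ℍ`. The degree is one more than the index
(which is the length of a context): `ty k` is the vertex `k + 1`, and `tm k` is the vertex
`(k + 1)_t`. -/
inductive HVertex : Type
  | ty (k : ℕ)
  | tm (k : ℕ)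

/-- Edges of the graph generating `ℍ`. -/
inductive HEdge : HVertex → HVertex → Type
  | next (k : ℕ) : HEdge (.ty k) (.ty (k + 1))
  | term (k : ℕ) : HEdge (.ty k) (.tm k)

instance : Quiver HVertex := ⟨HEdge⟩

/-- The category `ℍ` generated by the graph. -/
abbrev HCat : Type := Paths HVertex

/-- Type-and-term structures: presheaves on `ℍ`. -/
abbrev TTStr : Type (u + 1) := HCatᵒᵖ ⥤ Type u

namespace TTStr

/-- The object of `ℍ` at a vertex. -/
abbrev vertex (x : HVertex) : HCat := (Paths.of HVertex).obj x

/-- The presheaf given by sets at the vertices and boundary maps along the edges. -/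
def ofEdges (F : HVertex → Type u) (b : ∀ {x y : HVertex}, HEdge x y → F y → F x) :
    TTStr.{u} :=
  (Paths.lift (C := (Type u)ᵒᵖ)
    { obj := fun x => op (F x)
      map := fun e => (↾(b e)).op }).leftOp

theorem ofEdges_map_of (F : HVertex → Type u) (b : ∀ {x y : HVertex}, HEdge x y → F y → F x)
    {x y : HVertex} (e : x ⟶ y) (a : F y) :
    ((ofEdges F b).map ((Paths.of HVertex).map e).op : F y → F x) a = b e a := rfl

/-- The map of such presheaves given by maps at the vertices that commute with the boundary
maps. -/
def ofEdgesMap {F F' : HVertex → Type u} {b : ∀ {x y : HVertex}, HEdge x y → F y → F x}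
    {b' : ∀ {x y : HVertex}, HEdge x y → F' y → F' x} (f : ∀ x, F x → F' x)
    (hf : ∀ {x y : HVertex} (e : HEdge x y) (a : F y), f x (b e a) = b' e (f y a)) :
    ofEdges F b ⟶ ofEdges F' b' where
  app x := ↾(f x.unop)
  naturality := by
    have key : ∀ {y x : HCat} (q : y ⟶ x),
        (ofEdges F b).map q.op ≫ ↾(f y) = ↾(f x) ≫ (ofEdges F' b').map q.op := by
      intro y x q
      induction q using Paths.induction with
      | id => rfl
      | comp p q ih =>
        ext a
        have h1 := ConcreteCategory.congr_hom ih (b q a)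
        have h2 := hf q a
        refine h1.trans ?_
        exact congrArg ((ofEdges F' b').map p.op) h2
    intro x y p
    exact key p.unop

end TTStr

/-! ### Min-heaps -/

/-- Min-heaps of size `n`: functions `φ : [0,n] → [0,n]` with `φ 0 = 0` and `φ i < i` for all
`i ≠ 0`. -/
@[ext]
structure MinHeap (n : ℕ) where
  parent : Fin (n + 1) → Fin (n + 1)
  parent_zero : parent 0 = 0
  parent_lt : ∀ i, i ≠ 0 → parent i < i

namespace MinHeap

variable {n : ℕ} (φ : MinHeap n)

/-- The depth of a node: the number of elements of `{φ i, φ² i, …}`, for `i ≠ 0`. -/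
def depth (i : Fin (n + 1)) : ℕ :=
  if h : i = 0 then 0 else depth (φ.parent i) + 1
termination_by i.val
decreasing_by exact φ.parent_lt i h

theorem depth_parent {i : Fin (n + 1)} {k : ℕ} (h : φ.depth i = k + 1) :
    φ.depth (φ.parent i) = k := by
  rw [depth] at h
  split_ifs at h
  omega

/-- The elements at a vertex of the presheaf of shape `φ` with one term-element adjoined over
each node of `S`. As the root `0` has depth `0`, it does not occur. -/
def Node (S : Set (Fin (n + 1))) : HVertex → Type u
  | .ty k => ULift {i : Fin (n + 1) // φ.depth i = k + 1}
  | .tm k => ULift {i : Fin (n + 1) // φ.depth i = k + 1 ∧ i ∈ S}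

/-- The boundary maps: `i ↦ φ i` on type-elements, and a term-element over `i` goes to `i`. -/
def nodeBoundary (S : Set (Fin (n + 1))) :
    ∀ {x y : HVertex}, HEdge x y → Node.{u} φ S y → Node.{u} φ S x
  | _, _, .next _, i => ⟨⟨φ.parent i.down.1, φ.depth_parent i.down.2⟩⟩
  | _, _, .term _, i => ⟨⟨i.down.1, i.down.2.1⟩⟩

/-- The presheaf `[φ]`, with type-elements of degree `m` the nodes of depth `m`, and no
term-elements. -/
def shape : TTStr.{u} := TTStr.ofEdges (φ.Node ∅) (φ.nodeBoundary ∅)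

/-- The presheaf `[φ]_t`: the presheaf `[φ]` with one term-element adjoined over the last
node. -/
def shapeTerm : TTStr.{u} :=
  TTStr.ofEdges (φ.Node {Fin.last n}) (φ.nodeBoundary {Fin.last n})

end MinHeap

/-! ### Syntax

Variables are named by their position in the context (de Bruijn levels): in a context of length
`n`, the variables are `var 0, …, var (n - 1)`, the oldest one being `var 0`. Thus judgements are
taken up to renaming of variables. Contexts are lists with the NEWEST type in front: the context
`Γ, x : T` is `T :: Γ`, and `Γ, x : T, Δ` is `Δ ++ T :: Γ`. -/

/-- Expressions over an alphabet. -/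
inductive RawExpr (W : Type u) : Type u
  | var (i : ℕ) : RawExpr W
  | app (w : W) (n : ℕ) (args : Fin n → RawExpr W) : RawExpr W

/-- Renaming of variables. -/
def RawExpr.rename {W : Type u} (f : ℕ → ℕ) : RawExpr W → RawExpr W
  | .var i => .var (f i)
  | .app w n args => .app w n fun j => (args j).rename f

/-- The renaming that makes room for a new variable at position `k`. -/
def shiftAt (k i : ℕ) : ℕ := if i < k then i else i + 1

/-- The part of a judgement to the right of the turnstile: `T type`, `t : T`, `T = T' type` or
`t = t' : T`. -/
inductive JBody (W : Type u) : Type u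
  | type (T : RawExpr W)
  | term (t T : RawExpr W)
  | typeEq (T T' : RawExpr W)
  | termEq (t t' T : RawExpr W)

/-- The four forms of judgement. -/
inductive JForm : Type
  | type
  | term
  | typeEq
  | termEq

namespace JBody

variable {W : Type u}

def form : JBody W → JForm
  | .type _ => .type
  | .term _ _ => .term
  | .typeEq _ _ => .typeEq
  | .termEq _ _ _ => .termEq

def rename (f : ℕ → ℕ) : JBody W → JBody W
  | .type T => .type (T.rename f)
  | .term t T => .term (t.rename f) (T.rename f)
  | .typeEq T T' => .typeEq (T.rename f) (T'.rename f)
  | .termEq t t' T => .termEq (t.rename f) (t'.rename f) (T.rename f)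

end JBody

/-- Judgements over an alphabet. -/
@[ext]
structure Judgement (W : Type u) where
  ctx : List (RawExpr W)
  body : JBody W

namespace Judgement

variable {W : Type u}

/-- The boundary of a judgement. -/
def boundary (J : Judgement W) : List (Judgement W) :=
  match J.body with
  | .type _ =>
    match J.ctx with
    | [] => []
    | T :: Γ => [⟨Γ, .type T⟩]
  | .term _ T => [⟨J.ctx, .type T⟩]
  | .typeEq T T' => [⟨J.ctx, .type T⟩, ⟨J.ctx, .type T'⟩]
  | .termEq t t' T => [⟨J.ctx, .term t T⟩, ⟨J.ctx, .term t' T⟩]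

/-- `J` is a type judgement or a term judgement, of the degree indicated by the vertex. -/
def HasShape : HVertex → Judgement W → Prop
  | .ty k, J => J.body.form = .type ∧ J.ctx.length = k
  | .tm k, J => J.body.form = .term ∧ J.ctx.length = k

end Judgement

/-- Names of the deduction rules. -/
inductive RuleName : Type
  | termRefl | termSymm | termTrans
  | typeRefl | typeSymm | typeTrans
  | conv | convEq | ctxConv
  | weakening | projection

/-- `RuleInst r Js J`: the judgement `J` follows from the list of premisses `Js` by an instance of
the deduction rule `r`. For each `r` this is (the graph of) a partial function of `Js`.
In the projection rule, the new variable has the weakened type `T`. -/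
inductive RuleInst {W : Type u} : RuleName → List (Judgement W) → Judgement W → Prop
  | termRefl (Γ t T) : RuleInst .termRefl [⟨Γ, .term t T⟩] ⟨Γ, .termEq t t T⟩
  | termSymm (Γ t₁ t₂ T) :
      RuleInst .termSymm [⟨Γ, .termEq t₁ t₂ T⟩] ⟨Γ, .termEq t₂ t₁ T⟩
  | termTrans (Γ t₁ t₂ t₃ T) :
      RuleInst .termTrans [⟨Γ, .termEq t₁ t₂ T⟩, ⟨Γ, .termEq t₂ t₃ T⟩] ⟨Γ, .termEq t₁ t₃ T⟩
  | typeRefl (Γ T) : RuleInst .typeRefl [⟨Γ, .type T⟩] ⟨Γ, .typeEq T T⟩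
  | typeSymm (Γ T₁ T₂) : RuleInst .typeSymm [⟨Γ, .typeEq T₁ T₂⟩] ⟨Γ, .typeEq T₂ T₁⟩
  | typeTrans (Γ T₁ T₂ T₃) :
      RuleInst .typeTrans [⟨Γ, .typeEq T₁ T₂⟩, ⟨Γ, .typeEq T₂ T₃⟩] ⟨Γ, .typeEq T₁ T₃⟩
  | conv (Γ t T₁ T₂) :
      RuleInst .conv [⟨Γ, .typeEq T₁ T₂⟩, ⟨Γ, .term t T₁⟩] ⟨Γ, .term t T₂⟩
  | convEq (Γ t₁ t₂ T₁ T₂) :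
      RuleInst .convEq [⟨Γ, .typeEq T₁ T₂⟩, ⟨Γ, .termEq t₁ t₂ T₁⟩] ⟨Γ, .termEq t₁ t₂ T₂⟩
  | ctxConv (Γ Δ T₁ T₂ B) :
      RuleInst .ctxConv [⟨Γ, .typeEq T₁ T₂⟩, ⟨Δ ++ T₁ :: Γ, B⟩] ⟨Δ ++ T₂ :: Γ, B⟩
  | weakening (Γ Δ T B) :
      RuleInst .weakening [⟨Γ, .type T⟩, ⟨Δ ++ Γ, B⟩]
        ⟨Δ.map (RawExpr.rename (shiftAt Γ.length)) ++ T :: Γ, B.rename (shiftAt Γ.length)⟩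
  | projection (Γ T) :
      RuleInst .projection [⟨Γ, .type T⟩]
        ⟨T :: Γ, .term (.var Γ.length) (T.rename (shiftAt Γ.length))⟩

theorem RuleInst.ctxConv_body {W : Type u} {K K₁ K₂ : Judgement W}
    (h : RuleInst .ctxConv [K, K₁] K₂) : K₂.body = K₁.body := by
  cases h
  rfl

theorem RuleInst.conv_body {W : Type u} {K K₁ K₂ : Judgement W}
    (h : RuleInst .conv [K, K₁] K₂) {t t' A A' : RawExpr W} (h₁ : K₁.body = .term t A)
    (h₂ : K₂.body = .term t' A') : t = t' := by
  cases h
  cases h₁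
  cases h₂
  rfl

/-- The derived judgements: the smallest collection that is closed under the deduction rules and
contains a basic judgement whenever it contains each judgement in its boundary. -/
inductive Derivable {W : Type u} (basic : Set (Judgement W)) : Judgement W → Prop
  | basic (J : Judgement W) : J ∈ basic → (∀ K ∈ J.boundary, Derivable basic K) →
      Derivable basic J
  | rule (r : RuleName) (Js : List (Judgement W)) (J : Judgement W) : RuleInst r Js J →
      (∀ K ∈ Js, Derivable basic K) → Derivable basic J

theorem Derivable.rule₁ {W : Type u} {basic : Set (Judgement W)} {r : RuleName}
    {J₁ J : Judgement W} (h : RuleInst r [J₁] J) (h₁ : Derivable basic J₁) :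
    Derivable basic J :=
  .rule r _ J h (by simpa using h₁)

theorem Derivable.rule₂ {W : Type u} {basic : Set (Judgement W)} {r : RuleName}
    {J₁ J₂ J : Judgement W} (h : RuleInst r [J₁, J₂] J) (h₁ : Derivable basic J₁)
    (h₂ : Derivable basic J₂) : Derivable basic J :=
  .rule r _ J h (by simp [h₁, h₂])

/-- The boundary of a derived judgement consists of derived judgements. -/
theorem Derivable.of_mem_boundary {W : Type u} {basic : Set (Judgement W)} {J : Judgement W}
    (h : Derivable basic J) : ∀ K ∈ J.boundary, Derivable basic K := by
  induction h with
  | basic J _ h _ => exact h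
  | rule r Js J hr h ih =>
    cases hr with
    | termRefl Γ t T => simpa [Judgement.boundary] using h
    | termSymm Γ t₁ t₂ T =>
      simp only [Judgement.boundary, List.mem_cons, List.not_mem_nil, or_false, forall_eq_or_imp,
        forall_eq] at ih ⊢
      exact ⟨ih.2, ih.1⟩
    | termTrans Γ t₁ t₂ t₃ T =>
      simp only [Judgement.boundary, List.mem_cons, List.not_mem_nil, or_false, forall_eq_or_imp,
        forall_eq] at ih ⊢
      exact ⟨ih.1.1, ih.2.2⟩
    | typeRefl Γ T => simpa [Judgement.boundary] using h
    | typeSymm Γ T₁ T₂ =>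
      simp only [Judgement.boundary, List.mem_cons, List.not_mem_nil, or_false, forall_eq_or_imp,
        forall_eq] at ih ⊢
      exact ⟨ih.2, ih.1⟩
    | typeTrans Γ T₁ T₂ T₃ =>
      simp only [Judgement.boundary, List.mem_cons, List.not_mem_nil, or_false, forall_eq_or_imp,
        forall_eq] at ih ⊢
      exact ⟨ih.1.1, ih.2.2⟩
    | conv Γ t T₁ T₂ =>
      simp only [Judgement.boundary, List.mem_cons, List.not_mem_nil, or_false, forall_eq_or_imp,
        forall_eq] at ih ⊢
      exact ih.1.2
    | convEq Γ t₁ t₂ T₁ T₂ =>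
      simp only [Judgement.boundary, List.mem_cons, List.not_mem_nil, or_false, forall_eq_or_imp,
        forall_eq] at ih h ⊢
      exact ⟨.rule₂ (.conv ..) h.1 ih.2.1, .rule₂ (.conv ..) h.1 ih.2.2⟩
    | ctxConv Γ Δ T₁ T₂ B =>
      simp only [List.mem_cons, List.not_mem_nil, or_false, forall_eq_or_imp,
        forall_eq] at ih h
      have h0 := ih.1
      have ih := ih.2
      have key : ∀ Δ B, Derivable basic ⟨Δ ++ T₁ :: Γ, B⟩ → Derivable basic ⟨Δ ++ T₂ :: Γ, B⟩ :=
        fun Δ B hB => .rule₂ (.ctxConv ..) h.1 hB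
      rcases B with T | ⟨t, T⟩ | ⟨T, T'⟩ | ⟨t, t', T⟩
      · rcases Δ with _ | ⟨S, Δ⟩
        · simp only [Judgement.boundary, List.mem_cons, List.not_mem_nil, or_false,
            forall_eq_or_imp, forall_eq, List.nil_append] at h0 ⊢
          exact h0.2
        · simp only [Judgement.boundary, List.mem_cons, List.not_mem_nil, or_false,
            forall_eq, List.cons_append] at ih ⊢
          exact key _ _ ih
      all_goals
        simp only [Judgement.boundary, List.mem_cons, List.not_mem_nil, or_false,
          forall_eq_or_imp, forall_eq] at ih ⊢
      · exact key _ _ ih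
      · exact ⟨key _ _ ih.1, key _ _ ih.2⟩
      · exact ⟨key _ _ ih.1, key _ _ ih.2⟩
    | weakening Γ Δ T B =>
      simp only [List.mem_cons, List.not_mem_nil, or_false, forall_eq_or_imp,
        forall_eq] at ih h
      have ih := ih.2
      have key : ∀ Δ B, Derivable basic ⟨Δ ++ Γ, B⟩ → Derivable basic
          ⟨Δ.map (RawExpr.rename (shiftAt Γ.length)) ++ T :: Γ,
            B.rename (shiftAt Γ.length)⟩ :=
        fun Δ B hB => .rule₂ (.weakening ..) h.1 hB
      rcases B with T' | ⟨t, T'⟩ | ⟨T', T''⟩ | ⟨t, t', T'⟩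
      · rcases Δ with _ | ⟨S, Δ⟩
        · simp only [Judgement.boundary, List.mem_cons, List.not_mem_nil, or_false,
            forall_eq, List.map_nil, List.nil_append, JBody.rename]
          exact h.1
        · simp only [Judgement.boundary, List.mem_cons, List.not_mem_nil, or_false,
            forall_eq, List.cons_append, List.map_cons, JBody.rename] at ih ⊢
          exact key _ _ ih
      all_goals
        simp only [Judgement.boundary, List.mem_cons, List.not_mem_nil, or_false,
          forall_eq_or_imp, forall_eq, JBody.rename] at ih ⊢
      · exact key _ _ ih
      · exact ⟨key _ _ ih.1, key _ _ ih.2⟩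
      · exact ⟨key _ _ ih.1, key _ _ ih.2⟩
    | projection Γ T =>
      simp only [Judgement.boundary, List.mem_cons, List.not_mem_nil, or_false,
          forall_eq] at h ⊢
      exact .rule₂ (.weakening Γ [] T (.type T)) h h

/-! ### Theories -/

namespace Judgement

variable {Ω Ψ : Type u}

/-- `J` is of the form `x₁ : T₁, …, xₙ₋₁ : Tₙ₋₁ ⊢ A(x₁, …, xₙ₋₁) type`. -/
def IntroducesType (A : Ω) (J : Judgement (Ω ⊕ Ψ)) : Prop :=
  J.body = .type (.app (.inl A) J.ctx.length fun i => .var i)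

/-- `J` is of the form `x₁ : T₁, …, xₙ₋₁ : Tₙ₋₁ ⊢ f(x₁, …, xₙ₋₁) : T`. -/
def IntroducesTerm (f : Ψ) (J : Judgement (Ω ⊕ Ψ)) : Prop :=
  ∃ T, J.body = .term (.app (.inr f) J.ctx.length fun i => .var i) T

end Judgement

/-- Generalised algebraic theories with weakening and projection (but without substitution). -/
structure WPGat : Type (u + 1) where
  TypeConst : Type u
  TermConst : Type u
  basic : Set (Judgement (TypeConst ⊕ TermConst))
  existsUnique_type : ∀ A : TypeConst, ∃! J, J ∈ basic ∧ J.IntroducesType A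
  existsUnique_term : ∀ f : TermConst, ∃! J, J ∈ basic ∧ J.IntroducesTerm f
  basic_cases : ∀ J ∈ basic, (∃ A, J.IntroducesType A) ∨ (∃ f, J.IntroducesTerm f) ∨
    J.body.form = .typeEq ∨ J.body.form = .termEq
  basic_derivable : ∀ J ∈ basic, Derivable basic J

namespace WPGat

/-- The alphabet of a theory. -/
abbrev Alphabet (T : WPGat.{u}) : Type u := T.TypeConst ⊕ T.TermConst

/-- The derived judgements of a theory. -/
abbrev Derived (T : WPGat.{u}) : Type u :=
  {J : Judgement T.Alphabet // Derivable T.basic J}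

/-- The boundary of a derived judgement. -/
def boundary (T : WPGat.{u}) (J : T.Derived) : List T.Derived :=
  J.1.boundary.attachWith _ J.2.of_mem_boundary

/-- Congruence of contexts: `S₁, …, Sᵢ₋₁ ⊢ Sᵢ = Tᵢ type` is derivable for all `i`. -/
inductive CtxCong (T : WPGat.{u}) : List (RawExpr T.Alphabet) → List (RawExpr T.Alphabet) → Prop
  | nil : CtxCong T [] []
  | cons (Γ Δ A B) : CtxCong T Γ Δ → Derivable T.basic ⟨Γ, .typeEq A B⟩ →
      CtxCong T (A :: Γ) (B :: Δ)

/-- The congruence on type judgements and on term judgements. -/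
inductive Cong (T : WPGat.{u}) : Judgement T.Alphabet → Judgement T.Alphabet → Prop
  | type (Γ Δ A B) : T.CtxCong (A :: Γ) (B :: Δ) → Cong T ⟨Γ, .type A⟩ ⟨Δ, .type B⟩
  | term (Γ Δ a b A B) : T.CtxCong (A :: Γ) (B :: Δ) → Derivable T.basic ⟨Γ, .termEq a b A⟩ →
      Cong T ⟨Γ, .term a A⟩ ⟨Δ, .term b B⟩

/-- Interpretations: maps on derived judgements that preserve the form of judgements,
boundaries, and the instances of each deduction rule. -/
@[ext]
structure Interp (T U : WPGat.{u}) : Type u where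
  toFun : T.Derived → U.Derived
  form_eq : ∀ J, (toFun J).1.body.form = J.1.body.form
  boundary_eq : ∀ J, U.boundary (toFun J) = (T.boundary J).map toFun
  rule_inst : ∀ (r : RuleName) (Js : List T.Derived) (J : T.Derived),
    RuleInst r (Js.map Subtype.val) J.1 →
      RuleInst r (Js.map fun K => (toFun K).1) (toFun J).1

namespace Interp

/-- The identity interpretation. -/
def id (T : WPGat.{u}) : Interp T T where
  toFun J := J
  form_eq _ := rfl
  boundary_eq J := by simp
  rule_inst _ _ _ h := h

/-- Composition of interpretations. -/
def comp {T U V : WPGat.{u}} (φ : Interp T U) (ψ : Interp U V) : Interp T V where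
  toFun J := ψ.toFun (φ.toFun J)
  form_eq J := (ψ.form_eq _).trans (φ.form_eq J)
  boundary_eq J := by
    rw [ψ.boundary_eq, φ.boundary_eq, List.map_map]
    rfl
  rule_inst r Js J h := by
    have h1 := ψ.rule_inst r (Js.map φ.toFun) (φ.toFun J)
      (by rw [List.map_map]; exact φ.rule_inst r Js J h)
    rw [List.map_map] at h1
    exact h1

end Interp

/-! #### Facts about congruence -/

section Facts

variable {T U : WPGat.{u}}

theorem CtxCong.length_eq {Γ Δ} (h : T.CtxCong Γ Δ) : Γ.length = Δ.length := by
  induction h with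
  | nil => rfl
  | cons _ _ _ _ _ _ ih => simp [ih]

theorem CtxCong.derivable_right {Γ Δ} (h : T.CtxCong Γ Δ) :
    ∀ Θ B, Derivable T.basic ⟨Θ ++ Γ, B⟩ → Derivable T.basic ⟨Θ ++ Δ, B⟩ := by
  induction h with
  | nil => exact fun _ _ h => h
  | cons Γ Δ A A' _ d ih =>
    intro Θ B h
    have h1 : Derivable T.basic ⟨Θ ++ A' :: Γ, B⟩ := .rule₂ (.ctxConv ..) d h
    simpa using ih (Θ ++ [A']) B (by simpa using h1)

theorem CtxCong.derivable_left {Γ Δ} (h : T.CtxCong Γ Δ) :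
    ∀ Θ B, Derivable T.basic ⟨Θ ++ Δ, B⟩ → Derivable T.basic ⟨Θ ++ Γ, B⟩ := by
  induction h with
  | nil => exact fun _ _ h => h
  | cons Γ Δ A A' _ d ih =>
    intro Θ B h
    have h1 : Derivable T.basic ⟨Θ ++ A' :: Γ, B⟩ := by
      simpa using ih (Θ ++ [A']) B (by simpa using h)
    exact .rule₂ (.ctxConv ..) (.rule₁ (.typeSymm ..) d) h1

theorem CtxCong.symm {Γ Δ} (h : T.CtxCong Γ Δ) : T.CtxCong Δ Γ := by
  induction h with
  | nil => exact .nil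
  | cons Γ Δ A A' h d ih =>
    exact .cons _ _ _ _ ih (h.derivable_right [] _ (.rule₁ (.typeSymm ..) d))

theorem CtxCong.trans {Γ Δ Θ} (h : T.CtxCong Γ Δ) (h' : T.CtxCong Δ Θ) : T.CtxCong Γ Θ := by
  induction h generalizing Θ with
  | nil => exact h'
  | cons Γ Δ A A' h d ih =>
    cases h' with
    | cons _ Θ _ A'' h' d' =>
      exact .cons _ _ _ _ (ih h') (.rule₂ (.typeTrans ..) d (h.derivable_left [] _ d'))

theorem CtxCong.of_derivable : ∀ {Γ A}, Derivable T.basic ⟨Γ, .type A⟩ →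
    T.CtxCong (A :: Γ) (A :: Γ)
  | [], _, h => .cons _ _ _ _ .nil (.rule₁ (.typeRefl ..) h)
  | _ :: _, _, h => .cons _ _ _ _
      (of_derivable (h.of_mem_boundary _ (by simp [Judgement.boundary])))
      (.rule₁ (.typeRefl ..) h)

theorem Cong.symm {J K : Judgement T.Alphabet} (h : T.Cong J K) : T.Cong K J := by
  cases h with
  | type Γ Δ A B h => exact .type _ _ _ _ h.symm
  | term Γ Δ a b A B h d =>
    refine .term _ _ _ _ _ _ h.symm ?_
    cases h with
    | cons _ _ _ _ h d' =>
      exact h.derivable_right [] _ (.rule₂ (.convEq ..) d' (.rule₁ (.termSymm ..) d))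

theorem Cong.trans {J K L : Judgement T.Alphabet} (h : T.Cong J K) (h' : T.Cong K L) :
    T.Cong J L := by
  cases h with
  | type Γ Δ A B h =>
    cases h' with
    | type _ _ _ _ h' => exact .type _ _ _ _ (h.trans h')
  | term Γ Δ a b A B h d =>
    cases h' with
    | term _ Θ _ c _ C h' d' =>
      refine .term _ _ _ _ _ _ (h.trans h') ?_
      cases h with
      | cons _ _ _ _ h e =>
        exact .rule₂ (.termTrans ..) d (.rule₂ (.convEq ..) (.rule₁ (.typeSymm ..) e)
          (h.derivable_left [] _ d'))

theorem Cong.refl {x : HVertex} {J : Judgement T.Alphabet} (h : Derivable T.basic J)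
    (hJ : J.HasShape x) : T.Cong J J := by
  obtain ⟨Γ, B⟩ := J
  cases x <;> obtain ⟨hf, -⟩ := hJ <;> cases B <;> cases hf
  · exact .type _ _ _ _ (.of_derivable h)
  · exact .term _ _ _ _ _ _
      (.of_derivable (h.of_mem_boundary _ (by simp [Judgement.boundary])))
      (.rule₁ (.termRefl ..) h)

theorem map_val_boundary (J : T.Derived) : (T.boundary J).map Subtype.val = J.1.boundary := by
  simp [boundary]

theorem boundary_eq_of {J : T.Derived} {l : List T.Derived}
    (h : J.1.boundary = l.map Subtype.val) : T.boundary J = l := by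
  rw [← map_val_boundary] at h
  exact List.map_injective_iff.mpr Subtype.val_injective h

theorem Interp.val_boundary_eq (φ : Interp T U) {J : T.Derived} {l : List T.Derived}
    (h : J.1.boundary = l.map Subtype.val) :
    (φ.toFun J).1.boundary = l.map fun K => (φ.toFun K).1 := by
  rw [← map_val_boundary, φ.boundary_eq, boundary_eq_of h, List.map_map]
  rfl

theorem Interp.type_form (φ : Interp T U) {Γ A} (h : Derivable T.basic ⟨Γ, .type A⟩) :
    ∃ Γ' A', (φ.toFun ⟨_, h⟩).1 = ⟨Γ', .type A'⟩ := by
  have h1 := φ.form_eq ⟨_, h⟩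
  generalize (φ.toFun ⟨_, h⟩).1 = K at h1
  obtain ⟨Γ', B⟩ := K
  cases B <;> cases h1
  exact ⟨_, _, rfl⟩

theorem Interp.term_form (φ : Interp T U) {Γ a A} (h : Derivable T.basic ⟨Γ, .term a A⟩)
    (h' : Derivable T.basic ⟨Γ, .type A⟩) :
    ∃ Γ' a' A', (φ.toFun ⟨_, h⟩).1 = ⟨Γ', .term a' A'⟩ ∧
      (φ.toFun ⟨_, h'⟩).1 = ⟨Γ', .type A'⟩ := by
  have h1 := φ.form_eq ⟨_, h⟩
  have h2 := φ.val_boundary_eq (J := ⟨_, h⟩) (l := [⟨_, h'⟩]) rfl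
  generalize (φ.toFun ⟨_, h⟩).1 = K at h1 h2
  obtain ⟨Γ', B⟩ := K
  cases B <;> cases h1
  simp only [Judgement.boundary, List.map_cons, List.map_nil, List.cons.injEq, and_true] at h2
  exact ⟨_, _, _, rfl, h2.symm⟩

theorem Interp.type_form_nil (φ : Interp T U) {A} (h : Derivable T.basic ⟨[], .type A⟩) :
    ∃ A', (φ.toFun ⟨_, h⟩).1 = ⟨[], .type A'⟩ := by
  obtain ⟨Γ', A', e⟩ := φ.type_form h
  have h2 := φ.val_boundary_eq (J := ⟨_, h⟩) (l := []) rfl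
  rw [e] at h2 ⊢
  cases Γ' with
  | nil => exact ⟨_, rfl⟩
  | cons => simp [Judgement.boundary] at h2

theorem Interp.type_form_cons (φ : Interp T U) {Γ A B}
    (h : Derivable T.basic ⟨A :: Γ, .type B⟩) (h' : Derivable T.basic ⟨Γ, .type A⟩) :
    ∃ Γ' A' B', (φ.toFun ⟨_, h⟩).1 = ⟨A' :: Γ', .type B'⟩ ∧
      (φ.toFun ⟨_, h'⟩).1 = ⟨Γ', .type A'⟩ := by
  obtain ⟨Γ', A', e⟩ := φ.type_form h
  have h2 := φ.val_boundary_eq (J := ⟨_, h⟩) (l := [⟨_, h'⟩]) rfl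
  rw [e] at h2 ⊢
  cases Γ' with
  | nil => simp [Judgement.boundary] at h2
  | cons A' Γ' =>
    simp only [Judgement.boundary, List.map_cons, List.map_nil, List.cons.injEq, and_true] at h2
    exact ⟨_, _, _, rfl, h2.symm⟩

theorem Interp.length_ctx_type (φ : Interp T U) : ∀ {Γ A}
    (h : Derivable T.basic ⟨Γ, .type A⟩), (φ.toFun ⟨_, h⟩).1.ctx.length = Γ.length
  | [], _, h => by
    obtain ⟨A', e⟩ := φ.type_form_nil h
    rw [e]
    rfl
  | A :: Γ, _, h => by
    have h' : Derivable T.basic ⟨Γ, .type A⟩ :=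
      h.of_mem_boundary _ (by simp [Judgement.boundary])
    have ih := φ.length_ctx_type h'
    obtain ⟨Γ', A', B', e, e'⟩ := φ.type_form_cons h h'
    rw [e'] at ih
    rw [e]
    simpa using ih

theorem Interp.hasShape (φ : Interp T U) {x : HVertex} (J : T.Derived)
    (hJ : J.1.HasShape x) : (φ.toFun J).1.HasShape x := by
  obtain ⟨⟨Γ, B⟩, h⟩ := J
  cases x <;> obtain ⟨hf, hl⟩ := hJ <;> cases B <;> cases hf
  · exact ⟨φ.form_eq _, (φ.length_ctx_type h).trans hl⟩
  · refine ⟨φ.form_eq _, ?_⟩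
    have h' := h.of_mem_boundary _ (by simp only [Judgement.boundary]; exact .head _)
    have h1 := φ.length_ctx_type h'
    obtain ⟨Γ', a', A', e, e'⟩ := φ.term_form h h'
    rw [e'] at h1
    rw [e]
    exact h1.trans hl

theorem Interp.body_eq_of_ctxCong (φ : Interp T U) {Γ Δ} (h : T.CtxCong Γ Δ) :
    ∀ Θ B (d : Derivable T.basic ⟨Θ ++ Δ, B⟩), ∃ d' : Derivable T.basic ⟨Θ ++ Γ, B⟩,
      (φ.toFun ⟨_, d'⟩).1.body = (φ.toFun ⟨_, d⟩).1.body := by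
  induction h with
  | nil => exact fun _ _ d => ⟨d, rfl⟩
  | cons Γ Δ A A' _ e ih =>
    intro Θ B d
    have e' : Derivable T.basic ⟨Γ, .typeEq A' A⟩ := .rule₁ (.typeSymm ..) e
    obtain ⟨d₁, h₁⟩ : ∃ d₁ : Derivable T.basic ⟨Θ ++ A' :: Γ, B⟩,
        (φ.toFun ⟨_, d₁⟩).1.body = (φ.toFun ⟨_, d⟩).1.body := by
      simpa using ih (Θ ++ [A']) B (by simpa using d)
    have r := RuleInst.ctxConv Γ Θ A' A B
    have d₂ := Derivable.rule₂ r e' d₁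
    refine ⟨d₂, ?_⟩
    have r' := φ.rule_inst _ [⟨_, e'⟩, ⟨_, d₁⟩] ⟨_, d₂⟩ r
    exact r'.ctxConv_body.trans h₁

theorem Interp.body_eq_of_ctxCong' (φ : Interp T U) {Γ Δ} (h : T.CtxCong Γ Δ) (B)
    (d : Derivable T.basic ⟨Δ, B⟩) : ∃ d' : Derivable T.basic ⟨Γ, B⟩,
      (φ.toFun ⟨_, d'⟩).1.body = (φ.toFun ⟨_, d⟩).1.body :=
  φ.body_eq_of_ctxCong h [] B d

theorem Interp.typeEq_form (φ : Interp T U) {Γ A B} (h : Derivable T.basic ⟨Γ, .typeEq A B⟩)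
    (hA : Derivable T.basic ⟨Γ, .type A⟩) (hB : Derivable T.basic ⟨Γ, .type B⟩) :
    ∃ Γ' A' B', Derivable U.basic ⟨Γ', .typeEq A' B'⟩ ∧
      (φ.toFun ⟨_, h⟩).1 = ⟨Γ', .typeEq A' B'⟩ ∧
      (φ.toFun ⟨_, hA⟩).1 = ⟨Γ', .type A'⟩ ∧ (φ.toFun ⟨_, hB⟩).1 = ⟨Γ', .type B'⟩ := by
  have h1 := φ.form_eq ⟨_, h⟩
  have h2 := φ.val_boundary_eq (J := ⟨_, h⟩) (l := [⟨_, hA⟩, ⟨_, hB⟩]) rfl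
  have h3 := (φ.toFun ⟨_, h⟩).2
  generalize (φ.toFun ⟨_, h⟩).1 = K at h1 h2 h3
  obtain ⟨Γ', B⟩ := K
  cases B <;> cases h1
  simp only [Judgement.boundary, List.map_cons, List.map_nil, List.cons.injEq, and_true] at h2
  exact ⟨_, _, _, h3, rfl, h2.1.symm, h2.2.symm⟩

theorem Interp.termEq_form (φ : Interp T U) {Γ a b A}
    (h : Derivable T.basic ⟨Γ, .termEq a b A⟩)
    (ha : Derivable T.basic ⟨Γ, .term a A⟩) (hb : Derivable T.basic ⟨Γ, .term b A⟩) :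
    ∃ Γ' a' b' A', Derivable U.basic ⟨Γ', .termEq a' b' A'⟩ ∧
      (φ.toFun ⟨_, ha⟩).1 = ⟨Γ', .term a' A'⟩ ∧ (φ.toFun ⟨_, hb⟩).1 = ⟨Γ', .term b' A'⟩ := by
  have h1 := φ.form_eq ⟨_, h⟩
  have h2 := φ.val_boundary_eq (J := ⟨_, h⟩) (l := [⟨_, ha⟩, ⟨_, hb⟩]) rfl
  have h3 := (φ.toFun ⟨_, h⟩).2
  generalize (φ.toFun ⟨_, h⟩).1 = K at h1 h2 h3
  obtain ⟨Γ', B⟩ := K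
  cases B <;> cases h1
  simp only [Judgement.boundary, List.map_cons, List.map_nil, List.cons.injEq, and_true] at h2
  exact ⟨_, _, _, _, h3, h2.1.symm, h2.2.symm⟩

theorem Interp.ctxCong (φ : Interp T U) : ∀ {Γ Δ A B} (hA : Derivable T.basic ⟨Γ, .type A⟩)
    (hB : Derivable T.basic ⟨Δ, .type B⟩), T.CtxCong (A :: Γ) (B :: Δ) →
    ∃ Γ' Δ' A' B', (φ.toFun ⟨_, hA⟩).1 = ⟨Γ', .type A'⟩ ∧
      (φ.toFun ⟨_, hB⟩).1 = ⟨Δ', .type B'⟩ ∧ U.CtxCong (A' :: Γ') (B' :: Δ') := by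
  intro Γ Δ A B hA hB h
  cases h with
  | cons _ _ _ _ h d =>
    obtain ⟨hB', eB⟩ := φ.body_eq_of_ctxCong' h _ hB
    obtain ⟨Γ', A', R, d', -, eA, eR⟩ := φ.typeEq_form d hA hB'
    obtain ⟨Δ', B', eB'⟩ := φ.type_form hB
    have hR : R = B' := by
      have := eB
      rw [eB'] at this
      have h2 := congrArg Judgement.body eR
      rw [this] at h2
      simpa using h2.symm
    subst hR
    refine ⟨_, _, _, _, eA, eB', .cons _ _ _ _ ?_ d'⟩
    cases h with
    | nil =>
      obtain ⟨_, e1⟩ := φ.type_form_nil hA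
      obtain ⟨_, e2⟩ := φ.type_form_nil hB
      rw [eA] at e1
      rw [eB'] at e2
      cases e1
      cases e2
      exact .nil
    | cons Γ Δ A₁ B₁ h d₁ =>
      have hA₁ : Derivable T.basic ⟨Γ, .type A₁⟩ :=
        hA.of_mem_boundary _ (by simp [Judgement.boundary])
      have hB₁ : Derivable T.basic ⟨Δ, .type B₁⟩ :=
        hB.of_mem_boundary _ (by simp [Judgement.boundary])
      obtain ⟨_, _, _, _, e1, e2, c⟩ := φ.ctxCong hA₁ hB₁ (.cons _ _ _ _ h d₁)
      obtain ⟨_, _, _, e3, e4⟩ := φ.type_form_cons hA hA₁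
      obtain ⟨_, _, _, e5, e6⟩ := φ.type_form_cons hB hB₁
      rw [eA] at e3
      rw [eB'] at e5
      rw [e1] at e4
      rw [e2] at e6
      cases e3
      cases e4
      cases e5
      cases e6
      exact c
termination_by Γ => Γ.length

/-- Interpretations preserve the congruence. -/
theorem Interp.cong (φ : Interp T U) {J K : T.Derived} (h : T.Cong J.1 K.1) :
    U.Cong (φ.toFun J).1 (φ.toFun K).1 := by
  obtain ⟨J, hJ⟩ := J
  obtain ⟨K, hK⟩ := K
  cases h with
  | type Γ Δ A B h =>
    obtain ⟨_, _, _, _, e1, e2, c⟩ := φ.ctxCong hJ hK h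
    rw [e1, e2]
    exact .type _ _ _ _ c
  | term Γ Δ a b A B h d =>
    have hA : Derivable T.basic ⟨Γ, .type A⟩ :=
      hJ.of_mem_boundary _ (by simp [Judgement.boundary])
    have hB : Derivable T.basic ⟨Δ, .type B⟩ :=
      hK.of_mem_boundary _ (by simp [Judgement.boundary])
    obtain ⟨Γ', Δ', A', B', e1, e2, c⟩ := φ.ctxCong hA hB h
    obtain ⟨_, a', _, e3, e4⟩ := φ.term_form hJ hA
    obtain ⟨_, b', _, e5, e6⟩ := φ.term_form hK hB
    rw [e1] at e4
    rw [e2] at e6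
    cases e4
    cases e6
    rw [e3, e5]
    refine .term _ _ _ _ _ _ c ?_
    cases h with
    | cons _ _ _ _ h f =>
      obtain ⟨hb, e7⟩ := φ.body_eq_of_ctxCong' h _ hK
      have f' : Derivable T.basic ⟨Γ, .typeEq B A⟩ := .rule₁ (.typeSymm ..) f
      have r := RuleInst.conv Γ b B A
      have hb' := Derivable.rule₂ r f' hb
      have r' := φ.rule_inst _ [⟨_, f'⟩, ⟨_, hb⟩] ⟨_, hb'⟩ r
      obtain ⟨_, _, _, _, d', e8, e9⟩ := φ.termEq_form d hJ hb'
      rw [e3] at e8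
      cases e8
      have e10 := r'.conv_body (e7.trans (congrArg Judgement.body e5))
        (congrArg Judgement.body e9)
      exact e10 ▸ d'

end Facts

/-! #### The category of theories and the forgetful functor -/

/-- Two interpretations are equivalent if they have congruent values at each derived type
judgement and at each derived term judgement. -/
instance Interp.setoid (T U : WPGat.{u}) : Setoid (Interp T U) where
  r φ φ' := ∀ (x : HVertex) (J : T.Derived), J.1.HasShape x →
    U.Cong (φ.toFun J).1 (φ'.toFun J).1
  iseqv :=
    { refl := fun φ _ J hJ => .refl (φ.toFun J).2 (φ.hasShape J hJ)
      symm := fun h x J hJ => (h x J hJ).symm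
      trans := fun h h' x J hJ => (h x J hJ).trans (h' x J hJ) }

/-- The category of theories, with equivalence classes of interpretations as morphisms. -/
instance : Category.{u} WPGat.{u} where
  Hom T U := Quotient (Interp.setoid T U)
  id T := Quotient.mk _ (Interp.id T)
  comp {T U V} := Quotient.map₂ Interp.comp fun φ _ h ψ ψ' h' x J hJ =>
    (ψ.cong (h x J hJ)).trans (h' x _ (Interp.hasShape _ J hJ))
  id_comp f := by
    induction f using Quotient.inductionOn
    rfl
  comp_id f := by
    induction f using Quotient.inductionOn
    rfl
  assoc f g h := by
    induction f using Quotient.inductionOn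
    induction g using Quotient.inductionOn
    induction h using Quotient.inductionOn
    rfl

/-- The derived type judgements or term judgements of a given degree. -/
abbrev Elem (T : WPGat.{u}) (x : HVertex) : Type u := {J : T.Derived // J.1.HasShape x}

instance elemSetoid (T : WPGat.{u}) (x : HVertex) : Setoid (T.Elem x) where
  r J K := T.Cong J.1.1 K.1.1
  iseqv :=
    { refl := fun J => .refl J.1.2 J.2
      symm := fun h => h.symm
      trans := fun h h' => h.trans h' }

/-- Congruence classes of derived type judgements or term judgements of a given degree. -/
abbrev ElemClass (T : WPGat.{u}) (x : HVertex) : Type u := Quotient (T.elemSetoid x)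

/-- For a term judgement, and for a type judgement of degree at least `2`, the boundary consists
of a single type judgement, of the expected degree. -/
theorem exists_boundary (T : WPGat.{u}) {x y : HVertex} (e : HEdge x y) (J : T.Elem y) :
    ∃ K : T.Elem x, T.boundary J.1 = [K.1] := by
  obtain ⟨⟨⟨Γ, B⟩, hJ⟩, hs⟩ := J
  cases e <;> obtain ⟨hf, hl⟩ := hs <;> cases B <;> cases hf
  · cases Γ with
    | nil => simp at hl
    | cons A Γ =>
      exact ⟨⟨⟨⟨Γ, .type A⟩, hJ.of_mem_boundary _ (by simp [Judgement.boundary])⟩,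
        rfl, by simpa using hl⟩, rfl⟩
  · exact ⟨⟨⟨⟨Γ, .type _⟩, hJ.of_mem_boundary _
      (by simp only [Judgement.boundary]; exact .head _)⟩, rfl, hl⟩, rfl⟩

/-- The unique member of the boundary. -/
noncomputable def elemBoundary (T : WPGat.{u}) {x y : HVertex} (e : HEdge x y) (J : T.Elem y) :
    T.Elem x :=
  (T.exists_boundary e J).choose

theorem boundary_elem (T : WPGat.{u}) {x y : HVertex} (e : HEdge x y) (J : T.Elem y) :
    T.boundary J.1 = [(T.elemBoundary e J).1] :=
  (T.exists_boundary e J).choose_spec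

theorem elemBoundary_cong (T : WPGat.{u}) {x y : HVertex} (e : HEdge x y) {J K : T.Elem y}
    (h : J ≈ K) : T.elemBoundary e J ≈ T.elemBoundary e K := by
  have hJ := congrArg (List.map Subtype.val) (T.boundary_elem e J)
  have hK := congrArg (List.map Subtype.val) (T.boundary_elem e K)
  rw [map_val_boundary] at hJ hK
  change T.Cong _ _ at h
  change T.Cong _ _
  generalize T.elemBoundary e J = J' at *
  generalize T.elemBoundary e K = K' at *
  obtain ⟨⟨J, hJ0⟩, hJs⟩ := J
  obtain ⟨⟨K, hK0⟩, hKs⟩ := K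
  obtain ⟨⟨J', _⟩, _⟩ := J'
  obtain ⟨⟨K', _⟩, _⟩ := K'
  cases h with
  | type Γ Δ A B h =>
    cases h with
    | cons _ _ _ _ h _ =>
      cases h with
      | nil => simp [Judgement.boundary] at hJ
      | cons Γ Δ A B h d =>
        simp only [Judgement.boundary, List.map_cons, List.map_nil, List.cons.injEq,
          and_true] at hJ hK
        subst hJ hK
        exact .type _ _ _ _ (.cons _ _ _ _ h d)
  | term Γ Δ a b A B h d =>
    simp only [Judgement.boundary, List.map_cons, List.map_nil, List.cons.injEq,
      and_true] at hJ hK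
    subst hJ hK
    exact .type _ _ _ _ h

/-- The boundary maps on congruence classes. -/
noncomputable def classBoundary (T : WPGat.{u}) {x y : HVertex} (e : HEdge x y) :
    T.ElemClass y → T.ElemClass x :=
  Quotient.map (T.elemBoundary e) fun _ _ => T.elemBoundary_cong e

/-- The action of an interpretation on congruence classes. -/
def Interp.classMap {T U : WPGat.{u}} (φ : Interp T U) (x : HVertex) :
    T.ElemClass x → U.ElemClass x :=
  Quotient.map (fun J => ⟨φ.toFun J.1, φ.hasShape J.1 J.2⟩) fun _ _ h => φ.cong h

theorem Interp.classMap_boundary {T U : WPGat.{u}} (φ : Interp T U) {x y : HVertex}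
    (e : HEdge x y) (a : T.ElemClass y) :
    φ.classMap x (T.classBoundary e a) = U.classBoundary e (φ.classMap y a) := by
  induction a using Quotient.inductionOn with
  | h J =>
    refine congrArg (Quotient.mk (U.elemSetoid x)) (Subtype.ext ?_)
    have h1 := U.boundary_elem e ⟨φ.toFun J.1, φ.hasShape J.1 J.2⟩
    rw [φ.boundary_eq, T.boundary_elem e J] at h1
    simpa using h1

/-- The type-and-term structure of congruence classes of derived type judgements and term
judgements of a theory. -/
noncomputable def toTTStr (T : WPGat.{u}) : TTStr.{u} :=
  TTStr.ofEdges T.ElemClass T.classBoundary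

/-- The forgetful functor from theories to type-and-term structures. -/
noncomputable def forgetful : WPGat.{u} ⥤ TTStr.{u} where
  obj T := T.toTTStr
  map {T U} f := Quotient.lift (s := Interp.setoid T U)
    (fun φ => TTStr.ofEdgesMap φ.classMap φ.classMap_boundary)
    (fun φ φ' h => by
      have h1 : φ.classMap = φ'.classMap := by
        funext x a
        induction a using Quotient.inductionOn with
        | h J => exact Quotient.sound (h x J.1 J.2)
      refine NatTrans.ext (funext fun x => ?_)
      exact congrArg (fun g : ∀ x, T.ElemClass x → U.ElemClass x => ↾(g x.unop)) h1) f
  map_id T := by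
    ext x a
    induction a using Quotient.inductionOn
    rfl
  map_comp {T U V} f g := by
    induction f using Quotient.inductionOn
    induction g using Quotient.inductionOn
    ext x a
    induction a using Quotient.inductionOn
    rfl

/-- A term-element is the projection onto the `i`-th variable if it is the class of a judgement
`x₁ : T₁, …, xₙ₋₁ : Tₙ₋₁ ⊢ xᵢ : T`. -/
def IsProjection (T : WPGat.{u}) {k : ℕ} (i : Fin k)
    (a : (forgetful.obj T).obj (op (TTStr.vertex (.tm k)))) : Prop :=
  ∃ (J : T.Elem (.tm k)) (A : RawExpr T.Alphabet),
    J.1.1.body = .term (.var i) A ∧ a = Quotient.mk (T.elemSetoid (.tm k)) J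

end WPGat

/-- The coproduct, over the min-heaps `φ` of size `k + 1`, of the functors `Hom([φ]_t, -)`. -/
abbrev HeapTerms (k : ℕ) (X : TTStr.{u}) : Type u :=
  Σ φ : MinHeap (k + 1), (φ.shapeTerm ⟶ X)

/-- The coproduct, over the min-heaps `φ` of size `k` and `i ∈ {1, …, k}`, of the functors
`Hom([φ], -)`. -/
abbrev HeapProjections (k : ℕ) (X : TTStr.{u}) : Type u :=
  Σ p : MinHeap k × Fin k, (p.1.shape ⟶ X)

/-! The free theory `TTStr.free X` has one constant for each element of `X`, introduced in the
context formed by its iterated boundaries, and no equality axioms. Its derived judgements can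
therefore be listed. Every derived equality is trivial (`free_wf`), so conversion does nothing and
congruent judgements are equal (`free_cong`). A type has the form `x(j₀, …, jₖ₋₁)`, where the
variables `j` carry the types prescribed by the boundaries of `x`. The whole tuple `j` is determined
by its last variable, because the type of that variable is again of this form (`Branch.of_last`).
Conversely, all such types and terms are derived, by weakening the generating judgements
(`free_derivable_of_branch`).

Hence a context is a min-heap with labels in `X`: each variable points to the last argument of its
type, or to the root if there is none. A term is either a term-constant, whose arguments are those
of its type, or a variable. This gives the formula for terms (`heapElem_bijective`), and likewise
for types, so that `P` is at each vertex a coproduct of representable functors. Any such functor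
preserves pullbacks and is local right adjoint (`Familial`).

For the adjunction, a map from `X` to the structure of a theory is lifted to representatives whose
boundaries match strictly (`exists_realization`). Replacing the constants by the expressions of
these representatives gives an interpretation, and it is unique up to congruence by induction on
derivations (`interp_equiv`).

Relabelling changes only symbols and renaming changes only variables, so their naturality squares
are pullbacks of sets of expressions. For the unit this shows that a judgement relabelled to a
generator is a generator. For the multiplication, which flattens judgements about judgements by
substitution, compatible pairs are lifted entry by entry along the context (`exists_flat_type`,
`eq_of_flat_type`).

Any other left adjoint is isomorphic to this one, and interpretations preserve variables, so all
conclusions transfer. -/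

/-! ### Operations on expressions -/

namespace RawExpr

variable {W W' : Type u}

theorem rename_id (e : RawExpr W) : e.rename id = e := by
  induction e with
  | var i => rfl
  | app w n args ih => simp [rename, ih]

theorem rename_rename (f g : ℕ → ℕ) (e : RawExpr W) :
    (e.rename f).rename g = e.rename (g ∘ f) := by
  induction e with
  | var i => rfl
  | app w n args ih => simp [rename, ih]

/-- All variables of the expression are among the first `n` ones. -/
def Scoped (n : ℕ) : RawExpr W → Prop
  | .var i => i < n
  | .app _ _ args => ∀ j, (args j).Scoped n

theorem Scoped.rename {n m : ℕ} {f : ℕ → ℕ} (hf : ∀ i < n, f i < m) {e : RawExpr W}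
    (he : e.Scoped n) : (e.rename f).Scoped m := by
  induction e with
  | var i => exact hf i he
  | app w n args ih => exact fun j => ih j (he j)

theorem rename_congr {n : ℕ} {f g : ℕ → ℕ} (h : ∀ i < n, f i = g i) {e : RawExpr W}
    (he : e.Scoped n) : e.rename f = e.rename g := by
  induction e with
  | var i => exact congrArg var (h i he)
  | app w n args ih =>
    simp only [RawExpr.rename]
    exact congrArg _ (funext fun j => ih j (he j))

theorem rename_eq_self {n : ℕ} {f : ℕ → ℕ} (h : ∀ i < n, f i = i) {e : RawExpr W}
    (he : e.Scoped n) : e.rename f = e :=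
  (rename_congr (g := id) h he).trans (rename_id e)

/-- Simultaneous substitution. -/
def subst (s : ℕ → RawExpr W) : RawExpr W → RawExpr W
  | .var i => s i
  | .app w n args => .app w n fun j => (args j).subst s

theorem subst_eq_rename (f : ℕ → ℕ) (e : RawExpr W) :
    e.subst (fun i => .var (f i)) = e.rename f := by
  induction e with
  | var i => rfl
  | app w n args ih => simp [rename, subst, ih]

theorem rename_subst (f : ℕ → ℕ) (s : ℕ → RawExpr W) (e : RawExpr W) :
    (e.subst s).rename f = e.subst fun i => (s i).rename f := by
  induction e with
  | var i => rfl
  | app w n args ih => simp [rename, subst, ih]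

theorem subst_congr {n : ℕ} {s t : ℕ → RawExpr W} (h : ∀ i < n, s i = t i) {e : RawExpr W}
    (he : e.Scoped n) : e.subst s = e.subst t := by
  induction e with
  | var i => exact h i he
  | app w n args ih =>
    simp only [subst]
    exact congrArg _ (funext fun j => ih j (he j))

/-- Relabelling of the symbols. -/
def mapSym (g : W → W') : RawExpr W → RawExpr W'
  | .var i => .var i
  | .app w n args => .app (g w) n fun j => (args j).mapSym g

/-- The naturality squares of renaming, with respect to relabellings, are pullbacks:
injectivity. -/
theorem eq_of_mapSym_eq_of_rename_eq {g : W → W'} {f : ℕ → ℕ} {e e' : RawExpr W}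
    (h : e.mapSym g = e'.mapSym g) (h' : e.rename f = e'.rename f) : e = e' := by
  induction e generalizing e' with
  | var i =>
    cases e' with
    | var i' => simpa [mapSym] using h
    | app => simp [mapSym] at h
  | app w n args ih =>
    cases e' with
    | var i' => simp [mapSym] at h
    | app w' n' args' =>
      simp only [mapSym, app.injEq] at h
      simp only [rename, app.injEq] at h'
      obtain ⟨-, rfl, h⟩ := h
      obtain ⟨rfl, -, h'⟩ := h'
      simp only [heq_eq_eq] at h h'
      exact congrArg _ (funext fun j => ih j (congrFun h j) (congrFun h' j))

/-- The naturality squares of renaming, with respect to relabellings, are pullbacks: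
existence. -/
theorem exists_of_mapSym_eq_rename {g : W → W'} {f : ℕ → ℕ} {a : RawExpr W} {b : RawExpr W'}
    (h : a.mapSym g = b.rename f) : ∃ e : RawExpr W, e.rename f = a ∧ e.mapSym g = b := by
  induction b generalizing a with
  | var i =>
    cases a with
    | var i' => exact ⟨.var i, by simpa [mapSym, rename] using h.symm, rfl⟩
    | app => simp [mapSym, rename] at h
  | app w n args ih =>
    cases a with
    | var i' => simp [mapSym, rename] at h
    | app w' n' args' =>
      simp only [mapSym, rename, app.injEq] at h
      obtain ⟨rfl, rfl, h⟩ := h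
      simp only [heq_eq_eq] at h
      choose e he he' using fun j => ih j (congrFun h j)
      exact ⟨.app w' n' e, by simp [rename, he], by simp [mapSym, he']⟩

/-- The translation that replaces symbols by expressions. -/
def translate (s : W → RawExpr W') : RawExpr W → RawExpr W'
  | .var i => .var i
  | .app w n args =>
    (s w).subst fun i => if h : i < n then (args ⟨i, h⟩).translate s else .var i

/-- Each symbol of the expression has the prescribed number of arguments. -/
def HasArity (ar : W → ℕ) : RawExpr W → Prop
  | .var _ => True
  | .app w n args => n = ar w ∧ ∀ j, (args j).HasArity ar

theorem HasArity.rename {ar : W → ℕ} {e : RawExpr W} (he : e.HasArity ar) (f : ℕ → ℕ) :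
    (e.rename f).HasArity ar := by
  induction e with
  | var i => trivial
  | app w n args ih => exact ⟨he.1, fun j => ih j (he.2 j)⟩

/-- In `translate`, the values substituted beyond the given arguments are left as unrenamed
variables. The arity and scoping conditions guarantee that these default values are never read. -/
theorem translate_rename {s : W → RawExpr W'} {ar : W → ℕ} (hs : ∀ w, (s w).Scoped (ar w))
    {e : RawExpr W} (he : e.HasArity ar) (f : ℕ → ℕ) :
    (e.rename f).translate s = (e.translate s).rename f := by
  induction e with
  | var i => rfl
  | app w n args ih =>
    obtain ⟨rfl, he⟩ := he
    simp only [RawExpr.rename, translate, rename_subst]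
    refine subst_congr (fun i hi => ?_) (hs w)
    simp [hi, ih _ (he _)]

end RawExpr

/-! ### Operations on judgements -/

namespace JBody

variable {W W' : Type u}

/-- Apply a function to all expressions. -/
def map (F : RawExpr W → RawExpr W') : JBody W → JBody W'
  | .type T => .type (F T)
  | .term t T => .term (F t) (F T)
  | .typeEq T T' => .typeEq (F T) (F T')
  | .termEq t t' T => .termEq (F t) (F t') (F T)

/-- All expressions have the property. -/
def All (Q : RawExpr W → Prop) : JBody W → Prop
  | .type T => Q T
  | .term t T => Q t ∧ Q T
  | .typeEq T T' => Q T ∧ Q T'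
  | .termEq t t' T => Q t ∧ Q t' ∧ Q T

/-- The first expression. -/
def head : JBody W → RawExpr W
  | .type T => T
  | .term t _ => t
  | .typeEq T _ => T
  | .termEq t _ _ => t

theorem form_map (F : RawExpr W → RawExpr W') (B : JBody W) : (B.map F).form = B.form := by
  cases B <;> rfl

theorem All.mono {Q Q' : RawExpr W → Prop} (h : ∀ e, Q e → Q' e) {B : JBody W}
    (hB : B.All Q) : B.All Q' := by
  cases B with
  | type T => exact h _ hB
  | term t T => exact ⟨h _ hB.1, h _ hB.2⟩
  | typeEq T T' => exact ⟨h _ hB.1, h _ hB.2⟩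
  | termEq t t' T => exact ⟨h _ hB.1, h _ hB.2.1, h _ hB.2.2⟩

theorem All.rename {Q Q' : RawExpr W → Prop} {f : ℕ → ℕ} (h : ∀ e, Q e → Q' (e.rename f))
    {B : JBody W} (hB : B.All Q) : (B.rename f).All Q' := by
  cases B with
  | type T => exact h _ hB
  | term t T => exact ⟨h _ hB.1, h _ hB.2⟩
  | typeEq T T' => exact ⟨h _ hB.1, h _ hB.2⟩
  | termEq t t' T => exact ⟨h _ hB.1, h _ hB.2.1, h _ hB.2.2⟩

theorem All.head {Q : RawExpr W → Prop} {B : JBody W} (hB : B.All Q) : Q B.head := by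
  cases B with
  | type T => exact hB
  | term t T => exact hB.1
  | typeEq T T' => exact hB.1
  | termEq t t' T => exact hB.1

theorem map_congr {F F' : RawExpr W → RawExpr W'} {B : JBody W}
    (h : B.All fun e => F e = F' e) : B.map F = B.map F' := by
  cases B <;> simp_all [map, All]

theorem map_rename {F : RawExpr W → RawExpr W'} {f : ℕ → ℕ} {B : JBody W}
    (h : B.All fun e => F (e.rename f) = (F e).rename f) :
    (B.rename f).map F = (B.map F).rename f := by
  cases B <;> simp_all [map, rename, All]

theorem rename_rename (f g : ℕ → ℕ) (B : JBody W) :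
    (B.rename f).rename g = B.rename (g ∘ f) := by
  cases B <;> simp [rename, RawExpr.rename_rename]

theorem rename_eq_self {f : ℕ → ℕ} {B : JBody W} (h : B.All fun e => e.rename f = e) :
    B.rename f = B := by
  cases B <;> simp_all [rename, All]

end JBody

namespace Judgement

variable {W W' : Type u}

/-- Apply a function to all expressions. -/
def map (F : RawExpr W → RawExpr W') (J : Judgement W) : Judgement W' :=
  ⟨J.ctx.map F, J.body.map F⟩

/-- All expressions have the property. -/
def All (Q : RawExpr W → Prop) (J : Judgement W) : Prop :=
  (∀ e ∈ J.ctx, Q e) ∧ J.body.All Q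

theorem boundary_map (F : RawExpr W → RawExpr W') (J : Judgement W) :
    (J.map F).boundary = J.boundary.map (map F) := by
  obtain ⟨Γ, B⟩ := J
  cases B with
  | type T => cases Γ <;> rfl
  | term t T => rfl
  | typeEq T T' => rfl
  | termEq t t' T => rfl

theorem HasShape.map {F : RawExpr W → RawExpr W'} {x : HVertex} {J : Judgement W}
    (h : J.HasShape x) : (J.map F).HasShape x := by
  cases x <;> exact ⟨(JBody.form_map _ _).trans h.1, by simpa [Judgement.map] using h.2⟩

theorem map_congr {F F' : RawExpr W → RawExpr W'} {J : Judgement W}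
    (h : J.All fun e => F e = F' e) : J.map F = J.map F' := by
  obtain ⟨h1, h2⟩ := h
  simp only [map, JBody.map_congr h2, mk.injEq, and_true]
  exact List.map_congr_left h1

theorem All.mono {Q Q' : RawExpr W → Prop} (h : ∀ e, Q e → Q' e) {J : Judgement W}
    (hJ : J.All Q) : J.All Q' :=
  ⟨fun e he => h e (hJ.1 e he), hJ.2.mono h⟩

/-- The types of the context, and the body, contain only variables that have been declared. -/
def CtxScoped : List (RawExpr W) → Prop
  | [] => True
  | A :: Γ => A.Scoped Γ.length ∧ CtxScoped Γ

/-- The judgement contains only variables that have been declared. -/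
def Scoped (J : Judgement W) : Prop :=
  CtxScoped J.ctx ∧ J.body.All (RawExpr.Scoped J.ctx.length)

end Judgement

/-! ### Invariants of derivations. -/

theorem shiftAt_lt {k n : ℕ} {i : ℕ} (hi : i < n) : shiftAt k i < n + 1 := by
  unfold shiftAt
  split_ifs <;> omega

theorem shiftAt_of_lt {k i : ℕ} (hi : i < k) : shiftAt k i = i := if_pos hi

/-- Only weakening and projection rename anything, and only projection introduces a variable. The
other rules copy expressions, so they survive any operation. `Q` restricts the commutation with
renaming to the expressions that occur in the premisses. -/
theorem RuleInst.map {W W' : Type u} {F : RawExpr W → RawExpr W'} {Q : RawExpr W → Prop}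
    (hv : ∀ i, F (.var i) = .var i)
    (hF : ∀ e, Q e → ∀ f, F (e.rename f) = (F e).rename f) {r : RuleName}
    {Js : List (Judgement W)} {J : Judgement W} (h : RuleInst r Js J)
    (hQ : ∀ K ∈ Js, K.All Q) : RuleInst r (Js.map (.map F)) (J.map F) := by
  cases h with
  | ctxConv Γ Δ T₁ T₂ B =>
    simp only [List.map_cons, List.map_nil, Judgement.map, List.map_append]
    exact .ctxConv ..
  | weakening Γ Δ T B =>
    have h1 : (⟨Δ ++ Γ, B⟩ : Judgement W).All Q := hQ _ (by simp)
    have h2 := RuleInst.weakening (Γ.map F) (Δ.map F) (F T) (B.map F)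
    rw [← JBody.map_rename (h1.2.mono fun e he => hF e he _), List.length_map] at h2
    have h3 : (Δ.map F).map (RawExpr.rename (shiftAt Γ.length)) =
        (Δ.map (RawExpr.rename (shiftAt Γ.length))).map F := by
      simp only [List.map_map]
      exact List.map_congr_left fun e he => (hF e (h1.1 e (by simp [he])) _).symm
    rw [h3] at h2
    simpa only [Judgement.map, JBody.map, List.map_cons, List.map_nil, List.map_append] using h2
  | projection Γ T =>
    have h1 : (⟨Γ, .type T⟩ : Judgement W).All Q := hQ _ (by simp)
    have h2 := RuleInst.projection (Γ.map F) (F T)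
    rw [List.length_map, ← hF T h1.2] at h2
    simpa only [Judgement.map, List.map_cons, List.map_nil, JBody.map, hv] using h2
  | _ => constructor

/-- Beyond the basic judgements, the rules create only variables and renamings of expressions
already present. -/
theorem Derivable.all {W : Type u} {basic : Set (Judgement W)} {Q : RawExpr W → Prop}
    (hv : ∀ i, Q (.var i)) (hQ : ∀ e, Q e → ∀ f, Q (e.rename f))
    (hb : ∀ J ∈ basic, J.All Q) {J : Judgement W} (h : Derivable basic J) : J.All Q := by
  induction h with
  | basic J hJ _ _ => exact hb J hJ
  | rule r Js J hr _ ih =>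
    cases hr with
    | weakening Γ Δ T B =>
      simp only [List.mem_cons, List.not_mem_nil, or_false, forall_eq_or_imp, forall_eq,
        Judgement.All, List.mem_append, List.mem_map] at ih ⊢
      refine ⟨?_, ih.2.2.rename fun e he => hQ e he _⟩
      rintro e (⟨e, he, rfl⟩ | rfl | he)
      · exact hQ _ (ih.2.1 e (.inl he)) _
      · exact ih.1.2
      · exact ih.1.1 e he
    | projection Γ T =>
      simp only [List.mem_cons, List.not_mem_nil, or_false, forall_eq_or_imp, forall_eq,
        Judgement.All, JBody.All] at ih ⊢
      exact ⟨⟨ih.2, ih.1⟩, hv _, hQ _ ih.2 _⟩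
    | _ =>
      simp only [List.mem_cons, List.not_mem_nil, or_false, forall_eq_or_imp, forall_eq,
        Judgement.All, JBody.All, List.mem_append] at ih ⊢
      grind

theorem Judgement.CtxScoped.conv {W : Type u} {T₁ T₂ : RawExpr W} {Γ : List (RawExpr W)}
    (h₂ : T₂.Scoped Γ.length) :
    ∀ {Δ : List (RawExpr W)}, CtxScoped (Δ ++ T₁ :: Γ) → CtxScoped (Δ ++ T₂ :: Γ)
  | [], h => ⟨h₂, h.2⟩
  | A :: Δ, h => ⟨by simpa using h.1, conv h₂ h.2⟩

theorem Judgement.CtxScoped.weaken {W : Type u} {T : RawExpr W} {Γ : List (RawExpr W)}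
    (hT : T.Scoped Γ.length) : ∀ {Δ : List (RawExpr W)}, CtxScoped (Δ ++ Γ) →
      CtxScoped (Δ.map (RawExpr.rename (shiftAt Γ.length)) ++ T :: Γ)
  | [], h => ⟨hT, h⟩
  | A :: Δ, h => by
    refine ⟨?_, weaken hT h.2⟩
    have := RawExpr.Scoped.rename (f := shiftAt Γ.length) (fun i hi => shiftAt_lt hi) h.1
    simpa [Nat.add_assoc, Nat.add_comm, Nat.add_left_comm] using this

/-- Basic judgements carry no scoping condition of their own. The expression introduced by a
constant uses exactly the variables of the context, and everything else in a basic judgement already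
occurs in its boundary, which is derived earlier. -/
theorem WPGat.scoped {T : WPGat.{u}} {J : Judgement T.Alphabet} (h : Derivable T.basic J) :
    J.Scoped := by
  induction h with
  | basic J hJ hd ih =>
    obtain ⟨Γ, B⟩ := J
    have hc := T.basic_cases _ hJ
    cases B with
    | type A =>
      refine ⟨?_, ?_⟩
      · cases Γ with
        | nil => trivial
        | cons A Γ =>
          have := ih ⟨Γ, .type A⟩ (by simp [Judgement.boundary])
          exact ⟨this.2, this.1⟩
      · rcases hc with ⟨A, h⟩ | ⟨A, _, h⟩ | h | h <;> simp [JBody.form, Judgement.IntroducesType] at h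
        subst h
        exact fun i => i.2
    | term t A =>
      have := ih ⟨Γ, .type A⟩ (by simp [Judgement.boundary])
      refine ⟨this.1, ?_, this.2⟩
      rcases hc with ⟨A, h⟩ | ⟨A, _, h⟩ | h | h <;> simp [JBody.form, Judgement.IntroducesType] at h
      rw [h.1]
      exact fun i => i.2
    | typeEq A B =>
      have h1 := ih ⟨Γ, .type A⟩ (by simp [Judgement.boundary])
      have h2 := ih ⟨Γ, .type B⟩ (by simp [Judgement.boundary])
      exact ⟨h1.1, h1.2, h2.2⟩
    | termEq a b A =>
      have h1 := ih ⟨Γ, .term a A⟩ (by simp [Judgement.boundary])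
      have h2 := ih ⟨Γ, .term b A⟩ (by simp [Judgement.boundary])
      exact ⟨h1.1, h1.2.1, h2.2⟩
  | rule r Js J hr _ ih =>
    cases hr with
    | weakening Γ Δ T B =>
      simp only [List.mem_cons, List.not_mem_nil, or_false, forall_eq_or_imp, forall_eq] at ih
      refine ⟨ih.2.1.weaken ih.1.2, ?_⟩
      have := ih.2.2.rename (f := shiftAt Γ.length)
        (fun e he => RawExpr.Scoped.rename (fun i hi => shiftAt_lt hi) he)
      simpa [Nat.add_assoc, Nat.add_comm, Nat.add_left_comm] using this
    | projection Γ T =>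
      simp only [List.mem_cons, List.not_mem_nil, or_false, forall_eq] at ih
      exact ⟨⟨ih.2, ih.1⟩, Nat.lt_succ_self _,
        RawExpr.Scoped.rename (fun i hi => shiftAt_lt hi) ih.2⟩
    | ctxConv Γ Δ T₁ T₂ B =>
      simp only [List.mem_cons, List.not_mem_nil, or_false, forall_eq_or_imp, forall_eq] at ih
      exact ⟨ih.2.1.conv ih.1.2.2, by simpa using ih.2.2⟩
    | _ =>
      simp only [List.mem_cons, List.not_mem_nil, or_false, forall_eq_or_imp, forall_eq,
        Judgement.Scoped, JBody.All] at ih ⊢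
      grind

/-! ### Congruence and the deduction rules -/

namespace WPGat

section Congruence

variable {T U : WPGat.{u}}

theorem boundary_val (T : WPGat.{u}) {x y : HVertex} (e : HEdge x y) (J : T.Elem y) :
    J.1.1.boundary = [(T.elemBoundary e J).1.1] := by
  rw [← map_val_boundary, T.boundary_elem e J]
  rfl

/-- `elemBoundary` is obtained by choice; since the boundary has a single member, that choice can be
computed. -/
theorem elemBoundary_eq {x y : HVertex} {e : HEdge x y} {J : T.Elem y} {K : T.Elem x}
    (h : J.1.1.boundary = [K.1.1]) : T.elemBoundary e J = K := by
  rw [T.boundary_val e J] at h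
  exact Subtype.ext (Subtype.ext (by simpa using h))

/-- A representative of the boundary of a class is the boundary of a representative. -/
theorem exists_representative {x y : HVertex} (e : HEdge x y) (K : T.Elem x)
    (c : T.ElemClass y) (h : Quotient.mk _ K = T.classBoundary e c) :
    ∃ J : T.Elem y, Quotient.mk _ J = c ∧ T.elemBoundary e J = K := by
  induction c using Quotient.inductionOn with
  | h J =>
    have hb := T.boundary_val e J
    have hc : T.Cong K.1.1 (T.elemBoundary e J).1.1 := Quotient.exact h
    generalize T.elemBoundary e J = L at hb hc
    obtain ⟨⟨⟨Δ, B⟩, hJ⟩, hs⟩ := J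
    obtain ⟨⟨K, hK⟩, hKs⟩ := K
    obtain ⟨⟨L, hL⟩, hLs⟩ := L
    cases e <;> obtain ⟨hf, hl⟩ := hs <;> cases B <;> cases hf
    · cases Δ with
      | nil => simp at hl
      | cons B Δ =>
        simp only [Judgement.boundary, List.cons.injEq, and_true] at hb
        subst hb
        cases hc with
        | type Γ _ A _ hc =>
          -- Context conversion moves the body unchanged into the prescribed context.
          have hJ' := hc.derivable_left [] _ hJ
          refine ⟨⟨⟨_, hJ'⟩, rfl, hc.length_eq.trans hl⟩, ?_, elemBoundary_eq rfl⟩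
          exact Quotient.sound (.type _ _ _ _ (.cons _ _ _ _ hc (.rule₁ (.typeRefl ..) hJ')))
    · simp only [Judgement.boundary, List.cons.injEq, and_true] at hb
      subst hb
      cases hc with
      | type Γ _ A _ hc =>
        cases hc with
        | cons _ _ _ _ hc hAB =>
          -- The term also has to be converted to the prescribed type, along the reversed equality.
          have hJ' := Derivable.rule₂ (.conv ..) (.rule₁ (.typeSymm ..) hAB)
            (hc.derivable_left [] _ hJ)
          refine ⟨⟨⟨_, hJ'⟩, rfl, hc.length_eq.trans hl⟩, ?_, elemBoundary_eq rfl⟩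
          exact Quotient.sound (.term _ _ _ _ _ _ (.cons _ _ _ _ hc hAB)
            (.rule₁ (.termRefl ..) hJ'))

/-- The part below the insertion is covered by `h`; each later equality of types is weakened.
Extensions of different lengths are excluded by counting. -/
theorem CtxCong.weaken {A A' : RawExpr T.Alphabet} {Γ Γ' : List (RawExpr T.Alphabet)}
    (hA : Derivable T.basic ⟨Γ, .type A⟩) (h : T.CtxCong (A :: Γ) (A' :: Γ')) :
    ∀ {Δ Δ' : List (RawExpr T.Alphabet)}, T.CtxCong (Δ ++ Γ) (Δ' ++ Γ') →
      T.CtxCong (Δ.map (RawExpr.rename (shiftAt Γ.length)) ++ A :: Γ)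
        (Δ'.map (RawExpr.rename (shiftAt Γ'.length)) ++ A' :: Γ')
  | [], [], _ => h
  | B :: Δ, [], h' => by
    have h1 := h.length_eq
    have h2 := h'.length_eq
    simp at h1 h2
    omega
  | [], B :: Δ, h' => by
    have h1 := h.length_eq
    have h2 := h'.length_eq
    simp at h1 h2
    omega
  | B :: Δ, B' :: Δ', h' => by
    have h1 : Γ.length = Γ'.length := by simpa using h.length_eq
    cases h' with
    | cons _ _ _ _ h' d =>
      refine .cons _ _ _ _ (weaken hA h h') ?_
      rw [← h1]
      exact .rule₂ (.weakening Γ Δ A (.typeEq B B')) hA d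

/-- With `Cong.projection`, this is the inductive step in comparing two interpretations: applying
the rule to congruent premisses gives congruent conclusions. -/
theorem Cong.weakening {K₁ K₂ J K₁' K₂' J' : Judgement T.Alphabet}
    (h : RuleInst .weakening [K₁, K₂] J) (h' : RuleInst .weakening [K₁', K₂'] J')
    (hK₁ : Derivable T.basic K₁) (h₁ : T.Cong K₁ K₁') (h₂ : T.Cong K₂ K₂') : T.Cong J J' := by
  cases h with
  | weakening Γ Δ A B =>
    cases h' with
    | weakening Γ' Δ' A' B' =>
      cases h₁ with
      | type _ _ _ _ h₁ =>
        have hl : Γ.length = Γ'.length := by simpa using h₁.length_eq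
        -- The context is an append, which case analysis on the congruence cannot unify until it is
        -- a variable.
        generalize hX : Δ ++ Γ = X at h₂
        generalize hX' : Δ' ++ Γ' = X' at h₂
        cases h₂ with
        | type _ _ C C' h₂ =>
          subst hX hX'
          -- The type of the body is treated as one more entry of the context.
          exact .type _ _ _ _ (h₁.weaken (Δ := C :: Δ) (Δ' := C' :: Δ') hK₁ h₂)
        | term _ _ t t' C C' h₂ d =>
          subst hX hX'
          refine .term _ _ _ _ _ _ (h₁.weaken (Δ := C :: Δ) (Δ' := C' :: Δ') hK₁ h₂) ?_
          rw [← hl]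
          exact .rule₂ (.weakening Γ Δ A (.termEq t t' C)) hK₁ d

theorem Cong.projection {K J K' J' : Judgement T.Alphabet}
    (h : RuleInst .projection [K] J) (h' : RuleInst .projection [K'] J')
    (hK : Derivable T.basic K) (h₁ : T.Cong K K') : T.Cong J J' := by
  cases h with
  | projection Γ A =>
    cases h' with
    | projection Γ' A' =>
      cases h₁ with
      | type _ _ _ _ h₁ =>
        have hl : Γ.length = Γ'.length := by simpa using h₁.length_eq
        refine .term _ _ _ _ _ _ (h₁.weaken (Δ := [A]) (Δ' := [A']) hK h₁) ?_
        rw [← hl]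
        exact .rule₁ (.termRefl ..) (.rule₁ (.projection ..) hK)

theorem _root_.RuleInst.conv_term {W : Type u} {K K₁ J : Judgement W}
    (h : RuleInst .conv [K, K₁] J) {t A : RawExpr W} (h₁ : K₁.body = .term t A) :
    ∃ A', J.body = .term t A' := by
  cases h
  cases h₁
  exact ⟨_, rfl⟩

theorem _root_.RuleInst.weakening_var {W : Type u} {K K₁ J : Judgement W}
    (h : RuleInst .weakening [K, K₁] J) {i : ℕ} {A : RawExpr W}
    (h₁ : K₁.body = .term (.var i) A) :
    ∃ A', J.body = .term (.var (shiftAt K.ctx.length i)) A' := by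
  cases h
  cases h₁
  exact ⟨_, rfl⟩

theorem _root_.RuleInst.projection_var {W : Type u} {K J : Judgement W}
    (h : RuleInst .projection [K] J) : ∃ A', J.body = .term (.var K.ctx.length) A' := by
  cases h
  exact ⟨_, rfl⟩

/-- Interpretations preserve judgements whose term is a variable. -/
theorem Interp.body_var (φ : Interp T U) {J : Judgement T.Alphabet}
    (h : Derivable T.basic J) {i : ℕ} {A : RawExpr T.Alphabet} (hJ : J.body = .term (.var i) A) :
    ∃ A', (φ.toFun ⟨J, h⟩).1.body = .term (.var i) A' := by
  induction h generalizing i A with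
  | basic J hb _ _ =>
    -- The term of a basic term judgement is an applied constant, never a variable.
    rcases T.basic_cases _ hb with ⟨A, h⟩ | ⟨A, _, h⟩ | h | h <;>
      simp [hJ, JBody.form, Judgement.IntroducesType] at h
  | rule r Js J hr hd ih =>
    have hr' := φ.rule_inst r (Js.attachWith _ hd) ⟨J, .rule r Js J hr hd⟩ (by simpa using hr)
    cases hr <;> simp only [JBody.term.injEq, reduceCtorEq] at hJ
    · rename_i Γ t T₁ T₂
      obtain ⟨A', hA'⟩ := ih ⟨Γ, .term t T₁⟩ (by simp) (by rw [hJ.1])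
      exact hr'.conv_term hA'
    · rename_i Γ Δ T₁ T₂ B
      obtain ⟨A', hA'⟩ := ih ⟨Δ ++ T₁ :: Γ, B⟩ (by simp) hJ
      exact ⟨A', hr'.ctxConv_body.trans hA'⟩
    · rename_i Γ Δ S B
      cases B <;> simp only [JBody.rename, JBody.term.injEq, reduceCtorEq] at hJ
      rename_i t B
      cases t <;> simp only [RawExpr.rename, RawExpr.var.injEq, reduceCtorEq, false_and] at hJ
      rename_i i'
      obtain ⟨A', hA'⟩ := ih ⟨Δ ++ Γ, .term (.var i') B⟩ (by simp) rfl
      obtain ⟨A'', hA''⟩ := hr'.weakening_var hA'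
      -- An interpretation preserves the length of contexts, so the new variable is inserted at the
      -- same position on both sides.
      rw [φ.length_ctx_type, hJ.1] at hA''
      exact ⟨A'', hA''⟩
    · rename_i Γ S
      obtain ⟨A', hA'⟩ := hr'.projection_var
      rw [φ.length_ctx_type] at hA'
      simp only [RawExpr.var.injEq] at hJ
      exact ⟨A', hA'.trans (by rw [hJ.1])⟩

end Congruence

end WPGat

/-! ### Looking up types in a context -/

/-- The type of the `i`-th variable of a context. -/
def ctxGet {α : Type*} (Γ : List α) (i : ℕ) : Option α := Γ.reverse[i]?

section CtxGet

variable {α β : Type*}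

theorem ctxGet_nil (i : ℕ) : ctxGet ([] : List α) i = none := by simp [ctxGet]

theorem ctxGet_cons_length (a : α) (Γ : List α) : ctxGet (a :: Γ) Γ.length = some a := by
  simp [ctxGet]

theorem ctxGet_cons_of_lt {a : α} {Γ : List α} {i : ℕ} (h : i < Γ.length) :
    ctxGet (a :: Γ) i = ctxGet Γ i := by
  simp [ctxGet, List.getElem?_append, h]

theorem ctxGet_map (f : α → β) (Γ : List α) (i : ℕ) :
    ctxGet (Γ.map f) i = (ctxGet Γ i).map f := by
  simp [ctxGet, ← List.map_reverse]

theorem lt_of_ctxGet {Γ : List α} {i : ℕ} {a : α} (h : ctxGet Γ i = some a) :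
    i < Γ.length := by
  rw [ctxGet, List.getElem?_eq_some_iff] at h
  simpa using h.1

theorem exists_ctxGet {Γ : List α} {i : ℕ} (h : i < Γ.length) : ∃ a, ctxGet Γ i = some a :=
  ⟨_, List.getElem?_eq_getElem (by simpa using h)⟩

theorem ctxGet_cons {a b : α} {Γ : List α} {i : ℕ} (h : ctxGet Γ i = some b) :
    ctxGet (a :: Γ) i = some b :=
  (ctxGet_cons_of_lt (lt_of_ctxGet h)).trans h

theorem ctxGet_cons_iff {a b : α} {Γ : List α} {i : ℕ} :
    ctxGet (a :: Γ) i = some b ↔ ctxGet Γ i = some b ∨ i = Γ.length ∧ a = b := by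
  constructor
  · intro h
    have h1 := lt_of_ctxGet h
    rcases Nat.lt_succ_iff_lt_or_eq.mp h1 with h2 | rfl
    · exact .inl ((ctxGet_cons_of_lt h2).symm.trans h)
    · exact .inr ⟨rfl, by simpa [ctxGet_cons_length] using h⟩
  · rintro (h | ⟨rfl, rfl⟩)
    · exact ctxGet_cons h
    · exact ctxGet_cons_length _ _

theorem ctxGet_ext {Γ Δ : List α} (hl : Γ.length = Δ.length)
    (h : ∀ i < Γ.length, ctxGet Γ i = ctxGet Δ i) : Γ = Δ := by
  rw [← List.reverse_inj]
  refine List.ext_getElem? fun i => ?_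
  by_cases hi : i < Γ.length
  · exact h i hi
  · simp [← hl, not_lt.mp hi]

theorem ctxGet_scoped {W : Type u} : ∀ {Γ : List (RawExpr W)} {i : ℕ} {a : RawExpr W},
    Judgement.CtxScoped Γ → ctxGet Γ i = some a → a.Scoped i
  | [], i, a, _, h => by simp [ctxGet_nil] at h
  | A :: Γ, i, a, hΓ, h => by
    rcases ctxGet_cons_iff.mp h with h | ⟨rfl, rfl⟩
    · exact ctxGet_scoped hΓ.2 h
    · exact hΓ.1

/-- Looking up a type in a weakened context. -/
theorem ctxGet_weaken {W : Type u} {Γ : List (RawExpr W)} {T : RawExpr W} :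
    ∀ {Δ : List (RawExpr W)} {i : ℕ} {a : RawExpr W}, Judgement.CtxScoped (Δ ++ Γ) →
      ctxGet (Δ ++ Γ) i = some a →
      ctxGet (Δ.map (RawExpr.rename (shiftAt Γ.length)) ++ T :: Γ) (shiftAt Γ.length i) =
        some (a.rename (shiftAt Γ.length))
  | [], i, a, hΓ, h => by
    rw [List.nil_append] at hΓ h
    have hi := lt_of_ctxGet h
    have ha := ctxGet_scoped hΓ h
    rw [shiftAt_of_lt hi]
    rw [RawExpr.rename_eq_self (fun j hj => shiftAt_of_lt (hj.trans hi)) ha]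
    exact ctxGet_cons h
  | A :: Δ, i, a, hΓ, h => by
    rcases ctxGet_cons_iff.mp h with h | ⟨rfl, rfl⟩
    · exact ctxGet_cons (ctxGet_weaken hΓ.2 h)
    · rw [List.map_cons, List.cons_append, ctxGet_cons_iff]
      refine .inr ⟨?_, rfl⟩
      simp [shiftAt]
      omega

end CtxGet

/-! ### The free theory on a type-and-term structure -/

namespace TTStr

/-- The elements at a vertex. -/
abbrev El (X : TTStr.{u}) (v : HVertex) : Type u := X.obj (op (vertex v))

/-- The boundary map along an edge. -/
def bd (X : TTStr.{u}) {x y : HVertex} (e : HEdge x y) : X.El y → X.El x :=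
  X.map ((Paths.of HVertex).map e).op

/-- The map of elements at a vertex. -/
def onEl {X Y : TTStr.{u}} (f : X ⟶ Y) (v : HVertex) : X.El v → Y.El v :=
  f.app (op (vertex v))

theorem onEl_bd {X Y : TTStr.{u}} (f : X ⟶ Y) {x y : HVertex} (e : HEdge x y) (a : X.El y) :
    onEl f x (X.bd e a) = Y.bd e (onEl f y a) :=
  ConcreteCategory.congr_hom (f.naturality ((Paths.of HVertex).map e).op) a

theorem hom_ext {X Y : TTStr.{u}} {f g : X ⟶ Y} (h : ∀ v a, onEl f v a = onEl g v a) :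
    f = g := by
  ext v a
  exact h v.unop a

/-- A map of type-and-term structures is given by maps at the vertices that commute with the
boundary maps. -/
def homMk {X Y : TTStr.{u}} (f : ∀ v, X.El v → Y.El v)
    (hf : ∀ {x y : HVertex} (e : HEdge x y) (a : X.El y), f x (X.bd e a) = Y.bd e (f y a)) :
    X ⟶ Y where
  app x := ↾(f x.unop)
  naturality := by
    have key : ∀ {y x : HCat} (q : y ⟶ x), X.map q.op ≫ ↾(f y) = ↾(f x) ≫ Y.map q.op := by
      intro y x q
      induction q using Paths.induction with
      | id =>
        ext a
        exact (congrArg (f _) (ConcreteCategory.congr_hom (X.map_id _) a)).trans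
          (ConcreteCategory.congr_hom (Y.map_id _) _).symm
      | comp p q ih =>
        ext a
        exact (congrArg (f _) (ConcreteCategory.congr_hom (X.map_comp _ _) a)).trans
          ((ConcreteCategory.congr_hom ih (X.bd q a)).trans
            ((congrArg (Y.map p.op) (hf q a)).trans
              (ConcreteCategory.congr_hom (Y.map_comp _ _) _).symm))
    intro x y p
    exact key p.unop

variable (X : TTStr.{u})

/-- The alphabet of the free theory. -/
abbrev Sym : Type u := (Σ k, X.El (.ty k)) ⊕ (Σ k, X.El (.tm k))

variable {X}

/-- The type expression with the given type-element as its symbol. -/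
def tyExpr (k : ℕ) (x : X.El (.ty k)) (j : Fin k → ℕ) : RawExpr X.Sym :=
  .app (.inl ⟨k, x⟩) k fun i => .var (j i)

/-- The term expression with the given term-element as its symbol. -/
def tmExpr (k : ℕ) (x : X.El (.tm k)) (j : Fin k → ℕ) : RawExpr X.Sym :=
  .app (.inr ⟨k, x⟩) k fun i => .var (j i)

theorem tyExpr_inj {k k' : ℕ} {x : X.El (.ty k)} {x' : X.El (.ty k')} {j j'}
    (h : tyExpr k x j = tyExpr k' x' j') : ∃ h : k = k', h ▸ x = x' ∧ h ▸ j = j' := by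
  simp only [tyExpr, RawExpr.app.injEq, Sum.inl.injEq, Sigma.mk.injEq] at h
  obtain ⟨⟨rfl, h⟩, -, h'⟩ := h
  exact ⟨rfl, eq_of_heq h, funext fun i => RawExpr.var.inj (congrFun (eq_of_heq h') i)⟩

theorem tmExpr_inj {k k' : ℕ} {x : X.El (.tm k)} {x' : X.El (.tm k')} {j j'}
    (h : tmExpr k x j = tmExpr k' x' j') : ∃ h : k = k', h ▸ x = x' ∧ h ▸ j = j' := by
  simp only [tmExpr, RawExpr.app.injEq, Sum.inr.injEq, Sigma.mk.injEq] at h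
  obtain ⟨⟨rfl, h⟩, -, h'⟩ := h
  exact ⟨rfl, eq_of_heq h, funext fun i => RawExpr.var.inj (congrFun (eq_of_heq h') i)⟩

theorem tyExpr_rename (k : ℕ) (x : X.El (.ty k)) (j : Fin k → ℕ) (f : ℕ → ℕ) :
    (tyExpr k x j).rename f = tyExpr k x (f ∘ j) := rfl

theorem tmExpr_rename (k : ℕ) (x : X.El (.tm k)) (j : Fin k → ℕ) (f : ℕ → ℕ) :
    (tmExpr k x j).rename f = tmExpr k x (f ∘ j) := rfl

/-- The context of the generating type judgement of a type-element. -/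
def genCtx : (k : ℕ) → X.El (.ty k) → List (RawExpr X.Sym)
  | 0, _ => []
  | k + 1, x => tyExpr k (X.bd (.next k) x) Fin.val :: genCtx k (X.bd (.next k) x)

theorem length_genCtx : ∀ (k : ℕ) (x : X.El (.ty k)), (genCtx k x).length = k
  | 0, _ => rfl
  | k + 1, _ => congrArg (· + 1) (length_genCtx k _)

/-- The generating judgement of a type-element or a term-element. -/
def gen : (v : HVertex) → X.El v → Judgement X.Sym
  | .ty k, x => ⟨genCtx k x, .type (tyExpr k x Fin.val)⟩
  | .tm k, x => ⟨genCtx k (X.bd (.term k) x),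
      .term (tmExpr k x Fin.val) (tyExpr k (X.bd (.term k) x) Fin.val)⟩

theorem gen_hasShape : ∀ (v : HVertex) (x : X.El v), (gen v x).HasShape v
  | .ty k, x => ⟨rfl, length_genCtx k x⟩
  | .tm k, _ => ⟨rfl, length_genCtx k _⟩

theorem gen_boundary {v w : HVertex} (e : HEdge v w) (x : X.El w) :
    (gen w x).boundary = [gen v (X.bd e x)] := by
  cases e <;> rfl

theorem gen_derivable_ty {basic : Set (Judgement X.Sym)} (h : ∀ v x, gen v x ∈ basic) :
    ∀ (k : ℕ) (x : X.El (.ty k)), Derivable basic (gen (.ty k) x)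
  | 0, x => .basic _ (h _ x) (by simp [gen, genCtx, Judgement.boundary])
  | k + 1, x => .basic _ (h _ x) (by
      rw [gen_boundary (.next k) x]
      simpa using gen_derivable_ty h k _)

theorem gen_derivable {basic : Set (Judgement X.Sym)} (h : ∀ v x, gen v x ∈ basic) :
    ∀ (v : HVertex) (x : X.El v), Derivable basic (gen v x)
  | .ty k, x => gen_derivable_ty h k x
  | .tm k, x => .basic _ (h _ x) (by
      rw [gen_boundary (.term k) x]
      simpa using gen_derivable_ty h k _)

theorem gen_introducesType (k : ℕ) (x : X.El (.ty k)) :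
    Judgement.IntroducesType (⟨k, x⟩ : Σ k, X.El (.ty k)) (gen (.ty k) x) := by
  change JBody.type _ = JBody.type (.app (W := X.Sym) (.inl ⟨k, x⟩) (genCtx k x).length fun i => .var i)
  rw [length_genCtx]
  rfl

theorem gen_introducesTerm (k : ℕ) (x : X.El (.tm k)) :
    Judgement.IntroducesTerm (⟨k, x⟩ : Σ k, X.El (.tm k)) (gen (.tm k) x) := by
  refine ⟨tyExpr k (X.bd (.term k) x) Fin.val, ?_⟩
  change JBody.term _ _ = JBody.term (.app (W := X.Sym) (.inr ⟨k, x⟩) (genCtx k _).length fun i => .var i) _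
  rw [length_genCtx]
  rfl

variable (X) in
/-- The basic judgements of the free theory. -/
def freeBasic : Set (Judgement X.Sym) := {J | ∃ v x, J = gen v x}

variable (X) in
/-- The free theory on a type-and-term structure. -/
@[reducible]
def free : WPGat.{u} where
  TypeConst := Σ k, X.El (.ty k)
  TermConst := Σ k, X.El (.tm k)
  basic := X.freeBasic
  existsUnique_type := by
    rintro ⟨k, x⟩
    refine ⟨gen (.ty k) x, ⟨⟨_, x, rfl⟩, gen_introducesType k x⟩, ?_⟩
    rintro _ ⟨⟨v, y, rfl⟩, h⟩
    cases v with
    | ty l =>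
      have h2 := (gen_introducesType l y).symm.trans h
      simp only [JBody.type.injEq, RawExpr.app.injEq, Sum.inl.injEq, Sigma.mk.injEq] at h2
      obtain ⟨⟨rfl, h2⟩, -⟩ := h2
      rw [eq_of_heq h2]
    | tm l => simp [Judgement.IntroducesType, gen] at h
  existsUnique_term := by
    rintro ⟨k, x⟩
    refine ⟨gen (.tm k) x, ⟨⟨_, x, rfl⟩, gen_introducesTerm k x⟩, ?_⟩
    rintro _ ⟨⟨v, y, rfl⟩, A, h⟩
    cases v with
    | tm l =>
      obtain ⟨B, h3⟩ := gen_introducesTerm l y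
      have h2 := h3.symm.trans h
      simp only [JBody.term.injEq, RawExpr.app.injEq, Sum.inr.injEq, Sigma.mk.injEq] at h2
      obtain ⟨⟨⟨rfl, h2⟩, -⟩, -⟩ := h2
      rw [eq_of_heq h2]
    | ty l => simp [gen] at h
  basic_cases := by
    rintro _ ⟨v, x, rfl⟩
    cases v with
    | ty k => exact .inl ⟨_, gen_introducesType k x⟩
    | tm k => exact .inr (.inl ⟨_, gen_introducesTerm k x⟩)
  basic_derivable := by
    rintro _ ⟨v, x, rfl⟩
    exact gen_derivable (basic := X.freeBasic) (fun v x => ⟨v, x, rfl⟩) v x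

theorem free_gen (v : HVertex) (x : X.El v) : Derivable X.freeBasic (gen v x) :=
  gen_derivable (basic := X.freeBasic) (fun v x => ⟨v, x, rfl⟩) v x

/-! ### The derived judgements of the free theory -/

/-- In the context `Γ`, the variables `j 0, …, j (k - 1)` have the types prescribed by the
iterated boundaries of `x`. -/
def Branch (Γ : List (RawExpr X.Sym)) : (k : ℕ) → X.El (.ty k) → (Fin k → ℕ) → Prop
  | 0, _, _ => True
  | k + 1, x, j =>
    ctxGet Γ (j (Fin.last k)) = some (tyExpr k (X.bd (.next k) x) (j ∘ Fin.castSucc)) ∧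
      Branch Γ k (X.bd (.next k) x) (j ∘ Fin.castSucc)

/-- A well-formed type. -/
def IsType (Γ : List (RawExpr X.Sym)) (A : RawExpr X.Sym) : Prop :=
  ∃ k x j, A = tyExpr k x j ∧ Branch Γ k x j

/-- A well-formed context. -/
def IsContext : List (RawExpr X.Sym) → Prop
  | [] => True
  | A :: Γ => IsType Γ A ∧ IsContext Γ

/-- A well-formed term of a well-formed type. -/
def IsTerm (Γ : List (RawExpr X.Sym)) (t A : RawExpr X.Sym) : Prop :=
  (∃ i, t = .var i ∧ ctxGet Γ i = some A) ∨
    ∃ k x j, t = tmExpr k x j ∧ A = tyExpr k (X.bd (.term k) x) j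

/-- A well-formed body of a judgement: the equalities are the trivial ones. -/
def IsBody (Γ : List (RawExpr X.Sym)) : JBody X.Sym → Prop
  | .type A => IsType Γ A
  | .term t A => IsType Γ A ∧ IsTerm Γ t A
  | .typeEq A B => IsType Γ A ∧ A = B
  | .termEq t t' A => IsType Γ A ∧ IsTerm Γ t A ∧ t = t'

section Branch

variable {Γ Γ' : List (RawExpr X.Sym)}

theorem Branch.map {f : ℕ → ℕ}
    (hf : ∀ i a, ctxGet Γ i = some a → ctxGet Γ' (f i) = some (a.rename f)) :
    ∀ {k : ℕ} {x : X.El (.ty k)} {j : Fin k → ℕ}, Branch Γ k x j → Branch Γ' k x (f ∘ j)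
  | 0, _, _, _ => trivial
  | _ + 1, _, _, h => ⟨hf _ _ h.1, map hf h.2⟩

theorem Branch.cons (A : RawExpr X.Sym) {k : ℕ} {x : X.El (.ty k)} {j : Fin k → ℕ}
    (h : Branch Γ k x j) : Branch (A :: Γ) k x j :=
  h.map (f := id) fun i a hi => by rw [RawExpr.rename_id]; exact ctxGet_cons hi

theorem IsType.cons (A : RawExpr X.Sym) {B : RawExpr X.Sym} (h : IsType Γ B) :
    IsType (A :: Γ) B := by
  obtain ⟨k, x, j, h, h'⟩ := h
  exact ⟨k, x, j, h, h'.cons A⟩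

theorem IsType.branch {k : ℕ} {x : X.El (.ty k)} {j : Fin k → ℕ}
    (h : IsType Γ (tyExpr k x j)) : Branch Γ k x j := by
  obtain ⟨k', x', j', h, h'⟩ := h
  obtain ⟨rfl, rfl, rfl⟩ := tyExpr_inj h
  exact h'

theorem IsContext.isType : ∀ {Γ : List (RawExpr X.Sym)}, IsContext Γ → ∀ {i A},
    ctxGet Γ i = some A → IsType Γ A
  | [], _, _, _, h => by simp [ctxGet_nil] at h
  | B :: Γ, hΓ, i, A, h => by
    rcases ctxGet_cons_iff.mp h with h | ⟨rfl, rfl⟩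
    · exact (hΓ.2.isType h).cons B
    · exact hΓ.1.cons B

/-- The type of the last variable is well-formed in `Γ`, which already contains the condition on the
earlier variables. Thus a type amounts to a label and a single parent variable, and contexts become
heaps. -/
theorem Branch.of_last (hΓ : IsContext Γ) {k : ℕ} {x : X.El (.ty (k + 1))}
    {j : Fin (k + 1) → ℕ}
    (h : ctxGet Γ (j (Fin.last k)) =
      some (tyExpr k (X.bd (.next k) x) (j ∘ Fin.castSucc))) : Branch Γ (k + 1) x j :=
  ⟨h, (hΓ.isType h).branch⟩

theorem Branch.lt : ∀ {k : ℕ} {x : X.El (.ty k)} {j : Fin k → ℕ}, Branch Γ k x j →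
    ∀ i, j i < Γ.length
  | k + 1, x, j, h, i => by
    refine Fin.lastCases (lt_of_ctxGet h.1) (fun i => h.2.lt i) i

theorem IsType.scoped {A : RawExpr X.Sym} (h : IsType Γ A) : A.Scoped Γ.length := by
  obtain ⟨k, x, j, rfl, h'⟩ := h
  exact fun i => h'.lt i

theorem IsContext.scoped : ∀ {Γ : List (RawExpr X.Sym)}, IsContext Γ → Judgement.CtxScoped Γ
  | [], _ => trivial
  | _ :: _, h => ⟨h.1.scoped, h.2.scoped⟩

theorem IsType.map {f : ℕ → ℕ}
    (hf : ∀ i a, ctxGet Γ i = some a → ctxGet Γ' (f i) = some (a.rename f))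
    {A : RawExpr X.Sym} (h : IsType Γ A) : IsType Γ' (A.rename f) := by
  obtain ⟨k, x, j, rfl, h'⟩ := h
  exact ⟨k, x, f ∘ j, rfl, h'.map hf⟩

theorem IsTerm.map {f : ℕ → ℕ}
    (hf : ∀ i a, ctxGet Γ i = some a → ctxGet Γ' (f i) = some (a.rename f))
    {t A : RawExpr X.Sym} (h : IsTerm Γ t A) : IsTerm Γ' (t.rename f) (A.rename f) := by
  rcases h with ⟨i, rfl, h⟩ | ⟨k, x, j, rfl, rfl⟩
  · exact .inl ⟨_, rfl, hf _ _ h⟩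
  · exact .inr ⟨k, x, f ∘ j, rfl, rfl⟩

theorem IsBody.map {f : ℕ → ℕ}
    (hf : ∀ i a, ctxGet Γ i = some a → ctxGet Γ' (f i) = some (a.rename f))
    {B : JBody X.Sym} (h : IsBody Γ B) : IsBody Γ' (B.rename f) := by
  cases B with
  | type A => exact IsType.map hf h
  | term t A => exact ⟨h.1.map hf, h.2.map hf⟩
  | typeEq A B => exact ⟨h.1.map hf, congrArg _ h.2⟩
  | termEq t t' A => exact ⟨h.1.map hf, h.2.1.map hf, congrArg _ h.2.2⟩

theorem IsContext.weaken {A : RawExpr X.Sym} (hA : IsType Γ A) :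
    ∀ {Δ : List (RawExpr X.Sym)}, IsContext (Δ ++ Γ) →
      IsContext (Δ.map (RawExpr.rename (shiftAt Γ.length)) ++ A :: Γ)
  | [], h => ⟨hA, h⟩
  | _ :: _, h => ⟨h.1.map fun _ _ hi => ctxGet_weaken h.2.scoped hi, weaken hA h.2⟩

theorem genCtx_wf : ∀ (k : ℕ) (x : X.El (.ty k)),
    IsContext (genCtx k x) ∧ Branch (genCtx k x) k x Fin.val
  | 0, _ => ⟨trivial, trivial⟩
  | k + 1, x => by
    obtain ⟨h1, h2⟩ := genCtx_wf k (X.bd (.next k) x)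
    refine ⟨⟨⟨_, _, _, rfl, h2⟩, h1⟩, ?_, h2.cons _⟩
    have := ctxGet_cons_length (tyExpr k (X.bd (.next k) x) Fin.val)
      (genCtx k (X.bd (.next k) x))
    rw [length_genCtx] at this
    exact this

end Branch

/-- There are no equality axioms, so reflexivity is the only source of equalities; symmetry,
transitivity and conversion then preserve triviality. Expressions arise only from generators,
weakening and projection. -/
theorem free_wf {J : Judgement X.Sym} (h : Derivable X.freeBasic J) :
    IsContext J.ctx ∧ IsBody J.ctx J.body := by
  induction h with
  | basic J hJ _ _ =>
    obtain ⟨v, x, rfl⟩ := hJ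
    cases v with
    | ty k => exact ⟨(genCtx_wf k x).1, ⟨_, _, _, rfl, (genCtx_wf k x).2⟩⟩
    | tm k =>
      have h := genCtx_wf k (X.bd (.term k) x)
      exact ⟨h.1, ⟨_, _, _, rfl, h.2⟩, .inr ⟨_, _, _, rfl, rfl⟩⟩
  | rule r Js J hr _ ih =>
    cases hr with
    | weakening Γ Δ A B =>
      simp only [List.mem_cons, List.not_mem_nil, or_false, forall_eq_or_imp, forall_eq] at ih
      exact ⟨ih.2.1.weaken ih.1.2,
        ih.2.2.map fun _ _ hi => ctxGet_weaken ih.2.1.scoped hi⟩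
    | projection Γ A =>
      simp only [List.mem_cons, List.not_mem_nil, or_false, forall_eq] at ih
      have h := RawExpr.rename_eq_self (f := shiftAt Γ.length) (fun i hi => shiftAt_of_lt hi)
        (IsType.scoped ih.2)
      rw [h]
      exact ⟨⟨ih.2, ih.1⟩, IsType.cons _ ih.2, .inl ⟨_, rfl, ctxGet_cons_length _ _⟩⟩
    | _ =>
      simp only [List.mem_cons, List.not_mem_nil, or_false, forall_eq_or_imp, forall_eq,
        IsBody] at ih ⊢
      grind

/-- Embedding of the variables of the context `genCtx k x`, with a context `Δ` on top of it. -/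
def extend {k : ℕ} (j : Fin k → ℕ) (n i : ℕ) : ℕ :=
  if h : i < k then j ⟨i, h⟩ else i - k + n

theorem extend_of_lt {k : ℕ} (j : Fin k → ℕ) (n : ℕ) (i : Fin k) : extend j n i = j i := by
  simp [extend]

theorem rename_extend {k : ℕ} (x : X.El (.ty k)) (j : Fin k → ℕ) (n : ℕ) :
    (tyExpr k x Fin.val).rename (extend j n) = tyExpr k x j := by
  rw [tyExpr_rename]
  exact congrArg _ (funext fun a => extend_of_lt ..)

/-- A judgement over the generic context of `x` is transported along a branch into `Γ`, by induction
on `Γ`. If the newest variable is not on the branch, weaken. Otherwise it is the last one on the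
branch; the corresponding entry of the generic context is handed over to `Δ`, and the shorter branch
is used. The extra context `Δ` is carried along for this purpose. -/
theorem free_derivable_of_branch : ∀ {Γ : List (RawExpr X.Sym)}, IsContext Γ →
    ∀ {k : ℕ} {x : X.El (.ty k)} {j : Fin k → ℕ}, Branch Γ k x j → ∀ {Δ B},
      Derivable X.freeBasic ⟨Δ ++ genCtx k x, B⟩ →
      Derivable X.freeBasic ⟨Δ.map (RawExpr.rename (extend j Γ.length)) ++ Γ,
        B.rename (extend j Γ.length)⟩
  | [], _, k, x, j, hj, Δ, B, h => by
    cases k with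
    | zero =>
      have h1 : extend j 0 = id := by
        funext i
        simp [extend]
      have h2 : RawExpr.rename (W := X.Sym) id = id := funext RawExpr.rename_id
      have h3 : B.rename id = B :=
        JBody.rename_eq_self (by cases B <;> simp [JBody.All, RawExpr.rename_id])
      simpa [h1, h2, h3, genCtx] using h
    | succ k => simp [Branch, ctxGet_nil] at hj
  | A :: Γ, hΓ, k, x, j, hj, Δ, B, h => by
    have hA : Derivable X.freeBasic ⟨Γ, .type A⟩ := by
      obtain ⟨l, y, i, rfl, hi⟩ := hΓ.1
      have := free_derivable_of_branch hΓ.2 hi (Δ := []) (free_gen (.ty l) y)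
      simpa [JBody.rename, rename_extend] using this
    -- If the branch already lies in `Γ`, the newest type is added by weakening. This is always the
    -- case for an empty branch.
    by_cases hc : Branch Γ k x j
    · have h1 := Derivable.rule₂ (.weakening ..) hA (free_derivable_of_branch hΓ.2 hc h)
      have h2 : shiftAt Γ.length ∘ extend j Γ.length = extend j (A :: Γ).length := by
        funext i
        simp only [Function.comp, extend, List.length_cons]
        split_ifs with hi
        · exact shiftAt_of_lt (hc.lt _)
        · simp [shiftAt]
          omega
      simp only [List.map_map, JBody.rename_rename, h2] at h1
      convert h1 using 4
      funext e
      simp [RawExpr.rename_rename, h2]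
    · cases k with
      | zero => exact absurd trivial hc
      | succ k =>
        rcases ctxGet_cons_iff.mp hj.1 with h1 | ⟨h1, h2⟩
        · exact absurd (Branch.of_last hΓ.2 h1) hc
        · have hb : Branch Γ k (X.bd (.next k) x) (j ∘ Fin.castSucc) := by
            have := hΓ.1
            rw [h2] at this
            exact this.branch
          have h3 := free_derivable_of_branch hΓ.2 hb (Δ := Δ ++ [tyExpr k _ Fin.val])
            (B := B) (by simpa [genCtx] using h)
          -- The two embeddings agree: position `k`, formerly the last argument, is now the first
          -- variable of `Δ`, and it goes to `Γ.length` either way.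
          have h4 : extend (j ∘ Fin.castSucc) Γ.length = extend j (A :: Γ).length := by
            funext i
            simp only [Function.comp, extend, List.length_cons]
            rcases lt_trichotomy i k with hi | rfl | hi
            · rw [dif_pos hi, dif_pos (hi.trans (Nat.lt_succ_self _))]
              rfl
            · rw [dif_neg (lt_irrefl _), dif_pos (Nat.lt_succ_self _)]
              simpa using! h1.symm
            · rw [dif_neg hi.not_gt, dif_neg (by omega)]
              omega
          have h5 : (tyExpr k (X.bd (.next k) x) Fin.val).rename
              (extend (j ∘ Fin.castSucc) Γ.length) = A := by
            rw [h2, rename_extend]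
          rw [h4] at h3 h5
          simp only [List.map_append, List.map_cons, List.map_nil, h5, List.append_assoc,
            List.cons_append, List.nil_append] at h3
          exact h3

/-- A converse to `free_wf` for types, with nothing on top of the generic context. -/
theorem free_derivable_type {Γ : List (RawExpr X.Sym)} {A : RawExpr X.Sym} (hΓ : IsContext Γ)
    (hA : IsType Γ A) : Derivable X.freeBasic ⟨Γ, .type A⟩ := by
  obtain ⟨k, x, j, rfl, hj⟩ := hA
  have := free_derivable_of_branch hΓ hj (Δ := []) (free_gen (.ty k) x)
  simpa [JBody.rename, rename_extend] using this

theorem free_derivable_var : ∀ {Γ : List (RawExpr X.Sym)}, IsContext Γ → ∀ {i A},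
    ctxGet Γ i = some A → Derivable X.freeBasic ⟨Γ, .term (.var i) A⟩
  | [], _, _, _, h => by simp [ctxGet_nil] at h
  | B :: Γ, hΓ, i, A, h => by
    have hB := free_derivable_type hΓ.2 hΓ.1
    have hid : ∀ {C : RawExpr X.Sym}, C.Scoped Γ.length → C.rename (shiftAt Γ.length) = C :=
      fun hC => RawExpr.rename_eq_self (fun i hi => shiftAt_of_lt hi) hC
    rcases ctxGet_cons_iff.mp h with h | ⟨rfl, rfl⟩
    · have := Derivable.rule₂ (.weakening Γ [] B _) hB (free_derivable_var hΓ.2 h)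
      simpa [JBody.rename, RawExpr.rename, hid (hΓ.2.isType h).scoped,
        shiftAt_of_lt (lt_of_ctxGet h)] using this
    · have := Derivable.rule₁ (.projection ..) hB
      rwa [hid hΓ.1.scoped] at this

/-- A term-constant needs no condition beyond well-formedness of its type, since both have the same
arguments. -/
theorem free_derivable_term {Γ : List (RawExpr X.Sym)} {t A : RawExpr X.Sym} (hΓ : IsContext Γ)
    (hA : IsType Γ A) (ht : IsTerm Γ t A) : Derivable X.freeBasic ⟨Γ, .term t A⟩ := by
  rcases ht with ⟨i, rfl, hi⟩ | ⟨k, x, j, rfl, rfl⟩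
  · exact free_derivable_var hΓ hi
  · have := free_derivable_of_branch hΓ hA.branch (Δ := []) (free_gen (.tm k) x)
    have h1 : extend j Γ.length ∘ Fin.val = j := funext fun a => extend_of_lt ..
    simpa [JBody.rename, tyExpr_rename, tmExpr_rename, h1] using this

/-! ### Congruence in the free theory is equality. -/

theorem free_ctxCong {Γ Δ : List (RawExpr X.free.Alphabet)} (h : X.free.CtxCong Γ Δ) : Γ = Δ := by
  induction h with
  | nil => rfl
  | cons Γ Δ A B _ d ih => rw [ih, (free_wf d).2.2]

/-- Elements of `P X` can hence be handled as judgements, without choosing representatives. -/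
theorem free_cong {J K : Judgement X.free.Alphabet} (h : X.free.Cong J K) : J = K := by
  cases h with
  | type Γ Δ A B h =>
    cases free_ctxCong h
    rfl
  | term Γ Δ a b A B h d =>
    cases free_ctxCong h
    rw [(free_wf d).2.2.2]

/-- The unique judgement in a congruence class of the free theory. -/
def rep {v : HVertex} : X.free.ElemClass v → X.free.Elem v :=
  Quotient.lift (s := X.free.elemSetoid v) _root_.id fun _ _ h => Subtype.ext (Subtype.ext (free_cong h))

theorem mk_rep {v : HVertex} (c : X.free.ElemClass v) : Quotient.mk _ (rep c) = c := by
  induction c using Quotient.inductionOn with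
  | h J => rfl

theorem rep_classBoundary {v w : HVertex} (e : HEdge v w) (c : X.free.ElemClass w) :
    rep (X.free.classBoundary e c) = X.free.elemBoundary e (rep c) := by
  induction c using Quotient.inductionOn with
  | h J => rfl

end TTStr

/-! ### The universal property of the free theory -/

namespace TTStr

/-- A coherent choice of judgements of a theory for the elements of a type-and-term structure. -/
structure Realization (X : TTStr.{u}) (T : WPGat.{u}) where
  toFun : ∀ v, X.El v → T.Elem v
  boundary : ∀ {v w} (e : HEdge v w) (x : X.El w),
    T.elemBoundary e (toFun w x) = toFun v (X.bd e x)

section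

variable {X : TTStr.{u}} {T : WPGat.{u}}

/-- A choice of representatives for the type-elements. -/
noncomputable def tyRepresentative (f : X ⟶ WPGat.forgetful.obj T) :
    (k : ℕ) → (x : X.El (.ty k)) →
      {J : T.Elem (.ty k) // (Quotient.mk _ J : T.ElemClass (.ty k)) = onEl f _ x}
  | 0, x => ⟨Quotient.out (s := T.elemSetoid (.ty 0)) (onEl f _ x), Quotient.out_eq _⟩
  | k + 1, x =>
    have h := T.exists_representative (.next k) (tyRepresentative f k (X.bd (.next k) x)).1
      (onEl f _ x) ((tyRepresentative f k (X.bd (.next k) x)).2.trans (onEl_bd f (.next k) x))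
    ⟨h.choose, h.choose_spec.1⟩

/-- Interpretations preserve boundaries strictly, not just up to congruence, so representatives are
chosen by recursion on the degree, each over the one already chosen for its boundary. Nothing lies
over a term-element, so those choices are independent. -/
theorem exists_realization (f : X ⟶ WPGat.forgetful.obj T) :
    ∃ R : Realization X T, ∀ v x,
      (Quotient.mk _ (R.toFun v x) : T.ElemClass v) = onEl f v x := by
  have h (k : ℕ) (x : X.El (.tm k)) := T.exists_representative (.term k)
    (tyRepresentative f k (X.bd (.term k) x)).1
    (onEl f _ x) ((tyRepresentative f k (X.bd (.term k) x)).2.trans (onEl_bd f (.term k) x))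
  choose R hR hR' using h
  refine ⟨⟨fun v => match v with
    | .ty k => fun x => (tyRepresentative f k x).1
    | .tm k => fun x => R k x, ?_⟩, ?_⟩
  · intro v w e x
    cases e with
    | next k =>
      exact (T.exists_representative (.next k) (tyRepresentative f k (X.bd (.next k) x)).1
        (onEl f _ x) ((tyRepresentative f k (X.bd (.next k) x)).2.trans
          (onEl_bd f (.next k) x))).choose_spec.2
    | term k => exact hR' k x
  · intro v x
    cases v with
    | ty k => exact (tyRepresentative f k x).2
    | tm k => exact hR k x

/-- The number of arguments of a symbol of the free theory. -/
def arity : X.Sym → ℕ := Sum.elim Sigma.fst Sigma.fst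

theorem free_hasArity {J : Judgement X.Sym} (h : Derivable X.freeBasic J) :
    J.All (RawExpr.HasArity arity) := by
  refine h.all (fun _ => trivial) (fun e he f => he.rename f) ?_
  have h1 : ∀ (k : ℕ) (x : X.El (.ty k)) j, (tyExpr k x j).HasArity arity :=
    fun k x j => ⟨rfl, fun _ => trivial⟩
  have h2 : ∀ (k : ℕ) (x : X.El (.ty k)), ∀ e ∈ genCtx k x, e.HasArity arity := by
    intro k
    induction k with
    | zero => simp [genCtx]
    | succ k ih =>
      intro x e he
      rcases List.mem_cons.mp he with rfl | he
      · exact h1 _ _ _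
      · exact ih _ e he
  rintro _ ⟨v, x, rfl⟩
  cases v with
  | ty k => exact ⟨h2 k x, h1 _ _ _⟩
  | tm k => exact ⟨h2 k _, ⟨rfl, fun _ => trivial⟩, h1 _ _ _⟩

namespace Realization

variable (R : Realization X T)

/-- The expressions for the symbols of the free theory. -/
def sym : X.Sym → RawExpr T.Alphabet :=
  Sum.elim (fun p => (R.toFun _ p.2).1.1.body.head) (fun p => (R.toFun _ p.2).1.1.body.head)

theorem sym_scoped (w : X.Sym) : (R.sym w).Scoped (arity w) := by
  rcases w with ⟨k, x⟩ | ⟨k, x⟩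
  · have h := (WPGat.scoped (R.toFun (.ty k) x).1.2).2.head
    rwa [(R.toFun (.ty k) x).2.2] at h
  · have h := (WPGat.scoped (R.toFun (.tm k) x).1.2).2.head
    rwa [(R.toFun (.tm k) x).2.2] at h

/-- The arguments are variables, so the substitution is a renaming; by scoping, the values of
`extend j 0` from `k` on are irrelevant. -/
theorem translate_tyExpr {k : ℕ} (x : X.El (.ty k)) (j : Fin k → ℕ) :
    (tyExpr k x j).translate R.sym = (R.toFun _ x).1.1.body.head.rename (extend j 0) := by
  rw [← RawExpr.subst_eq_rename]
  refine RawExpr.subst_congr (fun i hi => ?_) (R.sym_scoped (.inl ⟨k, x⟩))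
  change i < k at hi
  simp [extend, hi, RawExpr.translate]

theorem translate_tmExpr {k : ℕ} (x : X.El (.tm k)) (j : Fin k → ℕ) :
    (tmExpr k x j).translate R.sym = (R.toFun _ x).1.1.body.head.rename (extend j 0) := by
  rw [← RawExpr.subst_eq_rename]
  refine RawExpr.subst_congr (fun i hi => ?_) (R.sym_scoped (.inr ⟨k, x⟩))
  change i < k at hi
  simp [extend, hi, RawExpr.translate]

theorem rename_extend_val {W : Type u} {e : RawExpr W} {k : ℕ} (he : e.Scoped k) :
    e.rename (extend (Fin.val (n := k)) 0) = e :=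
  RawExpr.rename_eq_self (fun i hi => by simp [extend, hi]) he

/-- The head expression agrees by construction. The context agrees by induction on the degree,
because the realization is strictly compatible with boundaries. -/
theorem map_gen_ty : ∀ (k : ℕ) (x : X.El (.ty k)),
    (gen (.ty k) x).map (RawExpr.translate R.sym) = (R.toFun _ x).1.1
  | 0, x => by
    have h := (R.translate_tyExpr x Fin.val).trans
      (rename_extend_val (R.sym_scoped (.inl ⟨0, x⟩)))
    simp only [gen, Judgement.map, genCtx, JBody.map, h]
    generalize R.toFun (.ty 0) x = J
    obtain ⟨⟨⟨Γ, B⟩, hJ⟩, hf, hl⟩ := J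
    cases B <;> cases hf
    cases List.eq_nil_of_length_eq_zero hl
    rfl
  | k + 1, x => by
    have h := (R.translate_tyExpr x Fin.val).trans
      (rename_extend_val (R.sym_scoped (.inl ⟨k + 1, x⟩)))
    have ih := map_gen_ty k (X.bd (.next k) x)
    have hb := T.boundary_val (.next k) (R.toFun _ x)
    rw [R.boundary, ← ih] at hb
    simp only [gen, Judgement.map, genCtx, JBody.map, h, List.map_cons] at hb ⊢
    generalize R.toFun (.ty (k + 1)) x = J at hb ⊢
    obtain ⟨⟨⟨Γ, B⟩, hJ⟩, hf, hl⟩ := J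
    cases B <;> cases hf
    cases Γ with
    | nil => simp at hl
    | cons A Γ =>
      simp only [Judgement.boundary, List.cons.injEq, Judgement.mk.injEq, JBody.type.injEq,
        and_true] at hb
      rw [← hb.1, ← hb.2]
      rfl

theorem map_gen (v : HVertex) (x : X.El v) :
    (gen v x).map (RawExpr.translate R.sym) = (R.toFun _ x).1.1 := by
  cases v with
  | ty k => exact R.map_gen_ty k x
  | tm k =>
    have h := (R.translate_tmExpr x Fin.val).trans
      (rename_extend_val (R.sym_scoped (.inr ⟨k, x⟩)))
    have ih := R.map_gen_ty k (X.bd (.term k) x)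
    have hb := T.boundary_val (.term k) (R.toFun _ x)
    rw [R.boundary, ← ih] at hb
    simp only [gen, Judgement.map, JBody.map, h] at hb ⊢
    generalize R.toFun (.tm k) x = J at hb ⊢
    obtain ⟨⟨⟨Γ, B⟩, hJ⟩, hf, hl⟩ := J
    cases B <;> cases hf
    simp only [Judgement.boundary, List.cons.injEq, Judgement.mk.injEq, JBody.type.injEq,
        and_true] at hb
    rw [← hb.1, ← hb.2]
    rfl

theorem ruleInst_map {r : RuleName} {Js : List (Judgement X.Sym)} {J : Judgement X.Sym}
    (h : RuleInst r Js J) (hJs : ∀ K ∈ Js, Derivable X.freeBasic K) :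
    RuleInst r (Js.map (.map (RawExpr.translate R.sym))) (J.map (RawExpr.translate R.sym)) :=
  h.map (fun _ => rfl) (fun _ he f => RawExpr.translate_rename R.sym_scoped he f)
    fun K hK => free_hasArity (hJs K hK)

theorem derivable_map {J : Judgement X.Sym} (h : Derivable X.freeBasic J) :
    Derivable T.basic (J.map (RawExpr.translate R.sym)) := by
  induction h with
  | basic J hJ _ _ =>
    obtain ⟨v, x, rfl⟩ := hJ
    rw [R.map_gen]
    exact (R.toFun v x).1.2
  | rule r Js J hr hd ih =>
    refine .rule r _ _ (R.ruleInst_map hr hd) fun K hK => ?_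
    obtain ⟨L, hL, rfl⟩ := List.mem_map.mp hK
    exact ih L hL

/-- The interpretation of the free theory given by a realization. -/
def interp : WPGat.Interp X.free T where
  toFun J := ⟨J.1.map (RawExpr.translate R.sym), R.derivable_map J.2⟩
  form_eq _ := JBody.form_map _ _
  boundary_eq J := by
    refine List.map_injective_iff.mpr Subtype.val_injective ?_
    rw [WPGat.map_val_boundary, Judgement.boundary_map, ← WPGat.map_val_boundary, List.map_map,
      List.map_map]
    rfl
  rule_inst r Js J h := by
    have := R.ruleInst_map h (by
      intro K hK
      obtain ⟨K, -, rfl⟩ := List.mem_map.mp hK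
      exact K.2)
    rwa [List.map_map] at this

end Realization

/-! ### Uniqueness of maps out of the free theory. -/

/-- Induction on derivations works for type and term judgements alone: in the free theory the
equality premisses of the conversion rules are trivial, so the hypothesis is not needed for equality
judgements. -/
theorem interp_equiv {φ ψ : WPGat.Interp X.free T}
    (h : ∀ v x, T.Cong (φ.toFun ⟨gen v x, free_gen v x⟩).1 (ψ.toFun ⟨gen v x, free_gen v x⟩).1) :
    φ ≈ ψ := by
  suffices H : ∀ (J : Judgement X.Sym) (hJ : Derivable X.freeBasic J),
      J.body.form = .type ∨ J.body.form = .term →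
      T.Cong (φ.toFun ⟨J, hJ⟩).1 (ψ.toFun ⟨J, hJ⟩).1 by
    intro v J hJ
    exact H J.1 J.2 (by cases v; exacts [.inl hJ.1, .inr hJ.1])
  intro J hJ
  induction hJ with
  | basic J hJ _ _ =>
    obtain ⟨v, x, rfl⟩ := hJ
    exact fun _ => h v x
  | rule r Js J hr hd ih =>
    intro hform
    have h1 := φ.rule_inst r (Js.attachWith _ hd) ⟨J, .rule r Js J hr hd⟩ (by simpa using hr)
    have h2 := ψ.rule_inst r (Js.attachWith _ hd) ⟨J, .rule r Js J hr hd⟩ (by simpa using hr)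
    cases hr with
    | conv Γ t A B =>
      -- With a trivial equality, the conclusion of the conversion rule is its second premiss.
      obtain rfl := (free_wf (hd ⟨Γ, .typeEq A B⟩ (by simp))).2.2
      exact ih ⟨Γ, .term t A⟩ (by simp) (.inr rfl)
    | ctxConv Γ Δ A B C =>
      obtain rfl := (free_wf (hd ⟨Γ, .typeEq A B⟩ (by simp))).2.2
      exact ih ⟨Δ ++ A :: Γ, C⟩ (by simp) hform
    | weakening Γ Δ A B =>
      refine .weakening h1 h2 (Subtype.property _) ?_ ?_
      · exact ih ⟨Γ, .type A⟩ (by simp) (.inl rfl)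
      · exact ih ⟨Δ ++ Γ, B⟩ (by simp) (by cases B <;> exact hform)
    | projection Γ A =>
      exact .projection h1 h2 (Subtype.property _) (ih ⟨Γ, .type A⟩ (by simp) (.inl rfl))
    | _ => simp [JBody.form] at hform

variable (X) in
/-- The insertion of generators. -/
noncomputable def unit : X ⟶ WPGat.forgetful.obj X.free :=
  homMk (Y := WPGat.forgetful.obj X.free)
    (fun v x => (Quotient.mk _ ⟨⟨gen v x, free_gen v x⟩, gen_hasShape v x⟩ : X.free.ElemClass v))
    (fun e x => congrArg (Quotient.mk _) (WPGat.elemBoundary_eq (gen_boundary e x)).symm)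

theorem unit_comp_injective {g g' : X.free ⟶ T}
    (h : X.unit ≫ WPGat.forgetful.map g = X.unit ≫ WPGat.forgetful.map g') : g = g' := by
  induction g using Quotient.inductionOn with
  | h φ =>
    induction g' using Quotient.inductionOn with
    | h ψ =>
      refine Quotient.sound (interp_equiv fun v x => ?_)
      have h1 := congrArg (fun f => onEl f v x) h
      exact Quotient.exact h1

/-- The map of theories given by a realization. -/
def Realization.hom (R : Realization X T) : X.free ⟶ T := Quotient.mk _ R.interp

theorem Realization.unit_comp_hom (R : Realization X T) {f : X ⟶ WPGat.forgetful.obj T}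
    (h : ∀ v x, (Quotient.mk _ (R.toFun v x) : T.ElemClass v) = onEl f v x) :
    X.unit ≫ WPGat.forgetful.map R.hom = f := by
  refine hom_ext fun v x => ?_
  rw [← h]
  exact congrArg (Quotient.mk _) (Subtype.ext (Subtype.ext (R.map_gen v x)))

variable (X T) in
/-- The universal property of the free theory. -/
noncomputable def freeHomEquiv : (X.free ⟶ T) ≃ (X ⟶ WPGat.forgetful.obj T) :=
  Equiv.ofBijective (fun g => X.unit ≫ WPGat.forgetful.map g) ⟨fun _ _ => unit_comp_injective,
    fun f => by
      obtain ⟨R, hR⟩ := exists_realization f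
      exact ⟨R.hom, R.unit_comp_hom hR⟩⟩

end

/-- The functor that sends a type-and-term structure to the free theory. -/
noncomputable def freeFunctor : TTStr.{u} ⥤ WPGat.{u} :=
  Adjunction.leftAdjointOfEquiv (G := WPGat.forgetful) (F_obj := free) freeHomEquiv
    fun X T U g h => by
      change X.unit ≫ WPGat.forgetful.map (h ≫ g) =
        (X.unit ≫ WPGat.forgetful.map h) ≫ WPGat.forgetful.map g
      simp

/-- The free theories are left adjoint to the forgetful functor. -/
noncomputable def freeAdj : freeFunctor.{u} ⊣ WPGat.forgetful.{u} :=
  Adjunction.adjunctionOfEquivLeft freeHomEquiv _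

theorem freeAdj_unit (X : TTStr.{u}) : freeAdj.unit.app X = X.unit := by
  have h : freeAdj.unit.app X = freeHomEquiv X X.free (𝟙 _) :=
    (Adjunction.homEquiv_id freeAdj X).symm
  rw [h]
  change X.unit ≫ WPGat.forgetful.map (𝟙 _) = _
  simp

/-! #### The action of maps and the counit -/

section

variable {X Y : TTStr.{u}} (f : X ⟶ Y)

/-- The action of a map of type-and-term structures on the alphabets. -/
def symMap : X.Sym → Y.Sym :=
  Sum.map (fun p => ⟨p.1, onEl f _ p.2⟩) (fun p => ⟨p.1, onEl f _ p.2⟩)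

theorem mapSym_tyExpr {k : ℕ} (x : X.El (.ty k)) (j : Fin k → ℕ) :
    (tyExpr k x j).mapSym (symMap f) = tyExpr k (onEl f _ x) j := rfl

theorem mapSym_tmExpr {k : ℕ} (x : X.El (.tm k)) (j : Fin k → ℕ) :
    (tmExpr k x j).mapSym (symMap f) = tmExpr k (onEl f _ x) j := rfl

/-- The generators, as a realization. -/
def relabelRealization : Realization X Y.free where
  toFun v x := ⟨⟨gen v (onEl f v x), free_gen _ _⟩, gen_hasShape _ _⟩
  boundary e x := WPGat.elemBoundary_eq (by rw [onEl_bd]; exact gen_boundary e _)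

/-- The expression chosen for a symbol is the relabelled symbol applied to its own variables, so
substitution puts the arguments back in place. -/
theorem translate_relabel {e : RawExpr X.Sym} (he : e.HasArity arity) :
    e.translate (relabelRealization f).sym = e.mapSym (symMap f) := by
  induction e with
  | var i => rfl
  | app w n args ih =>
    obtain ⟨rfl, he⟩ := he
    rcases w with ⟨k, x⟩ | ⟨k, x⟩
    · change RawExpr.app (W := Y.Sym) _ _ _ = RawExpr.app (W := Y.Sym) _ _ _
      refine congrArg (RawExpr.app _ k) (funext fun i => ?_)
      change RawExpr.subst _ (.var i.1) = _
      exact (dif_pos i.2).trans (ih i (he i))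
    · change RawExpr.app (W := Y.Sym) _ _ _ = RawExpr.app (W := Y.Sym) _ _ _
      refine congrArg (RawExpr.app _ k) (funext fun i => ?_)
      change RawExpr.subst _ (.var i.1) = _
      exact (dif_pos i.2).trans (ih i (he i))

/-- Relabelling of judgements. -/
def relabel (J : Judgement X.Sym) : Judgement Y.Sym := J.map (RawExpr.mapSym (symMap f))

theorem translate_relabel_judgement {J : Judgement X.Sym} (h : Derivable X.freeBasic J) :
    J.map (RawExpr.translate (relabelRealization f).sym) = relabel f J :=
  Judgement.map_congr ((free_hasArity h).mono fun _ he => translate_relabel f he)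

theorem derivable_relabel {J : Judgement X.Sym} (h : Derivable X.freeBasic J) :
    Derivable Y.freeBasic (relabel f J) := by
  rw [← translate_relabel_judgement f h]
  exact (relabelRealization f).derivable_map h

/-- Relabelling of type judgements and term judgements. -/
def relabelElem {v : HVertex} (J : X.free.Elem v) : Y.free.Elem v :=
  ⟨⟨relabel f J.1.1, derivable_relabel f J.1.2⟩, J.2.map⟩

/-- `freeFunctor.map f` is known only through its universal property; agreement on generators
identifies it with the explicit relabelling. -/
theorem freeFunctor_map : freeFunctor.map f = (relabelRealization f).hom := by
  have h := freeAdj.unit.naturality f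
  rw [freeAdj_unit, freeAdj_unit] at h
  refine unit_comp_injective (h.symm.trans ?_)
  exact ((relabelRealization f).unit_comp_hom fun v x => rfl).symm

theorem freeFunctor_map_mk {v : HVertex} (J : X.free.Elem v) :
    onEl (WPGat.forgetful.map (freeFunctor.map f)) v
      (Quotient.mk (X.free.elemSetoid v) J) =
      (Quotient.mk (Y.free.elemSetoid v) (relabelElem f J)) := by
  rw [freeFunctor_map]
  exact congrArg (Quotient.mk _)
    (Subtype.ext (Subtype.ext (translate_relabel_judgement f J.1.2)))

variable (X) in
/-- The judgements of a free theory, as a realization. -/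
def flattenRealization : Realization (WPGat.forgetful.obj X.free) X.free where
  toFun _ c := rep c
  boundary e c := (rep_classBoundary e c).symm

variable (X) in
-- By the triangle identity both maps restrict to the identity on generators. This makes the
-- multiplication of the monad an explicit substitution.
theorem freeAdj_counit : freeAdj.counit.app X.free = X.flattenRealization.hom := by
  have h := freeAdj.right_triangle_components X.free
  rw [freeAdj_unit] at h
  refine unit_comp_injective (h.trans ?_)
  exact (X.flattenRealization.unit_comp_hom (f := 𝟙 _) fun v c => mk_rep c).symm

end

end TTStr

/-! ### The unit is cartesian -/

namespace TTStr

section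

variable {X Y : TTStr.{u}} (f : X ⟶ Y)

/-- A branch that runs through all variables in order prescribes every entry of the context. -/
theorem genCtx_unique : ∀ {k : ℕ} {x : X.El (.ty k)} {Γ : List (RawExpr X.Sym)}, IsContext Γ →
    Γ.length = k → Branch Γ k x Fin.val → Γ = genCtx k x
  | 0, x, Γ, _, hl, _ => List.eq_nil_of_length_eq_zero hl
  | k + 1, x, [], _, hl, _ => by simp at hl
  | k + 1, x, A :: Γ, hΓ, hl, hb => by
    have hl' : Γ.length = k := by simpa using hl
    have h0 := ctxGet_cons_length A Γ
    rw [hl'] at h0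
    have h1 : A = tyExpr k (X.bd (.next k) x) Fin.val := Option.some.inj (h0.symm.trans hb.1)
    subst h1
    rw [genCtx, ← genCtx_unique hΓ.2 hl' hΓ.1.branch]

theorem gen_injective {v : HVertex} {x x' : X.El v} (h : gen v x = gen v x') : x = x' := by
  cases v with
  | ty k =>
    simp only [gen, Judgement.mk.injEq, JBody.type.injEq] at h
    obtain ⟨_, h, -⟩ := tyExpr_inj h.2
    exact h
  | tm k =>
    simp only [gen, Judgement.mk.injEq, JBody.term.injEq] at h
    obtain ⟨_, h, -⟩ := tmExpr_inj h.2.1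
    exact h

/-- Relabelling leaves the arguments alone, so the head of `J` is a constant applied to all
variables in order, and well-formedness then forces its context. This gives the existence half of
the pullback property of the unit. -/
theorem exists_gen_of_relabel_eq {v : HVertex} {J : Judgement X.Sym} {y : Y.El v}
    (hJ : Derivable X.freeBasic J) (hs : J.HasShape v) (h : relabel f J = gen v y) :
    ∃ x, gen v x = J ∧ onEl f v x = y := by
  obtain ⟨Γ, B⟩ := J
  have hw := free_wf hJ
  cases v with
  | ty k =>
    obtain ⟨hf, hl⟩ := hs
    cases B <;> cases hf
    obtain ⟨hΓ, l, x, j, rfl, hb⟩ := hw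
    have h1 := congrArg Judgement.body h
    obtain ⟨rfl, h2, h3⟩ := tyExpr_inj (JBody.type.inj h1)
    obtain rfl : j = Fin.val := h3
    exact ⟨x, by rw [gen, ← genCtx_unique hΓ hl hb], h2⟩
  | tm k =>
    obtain ⟨hf, hl⟩ := hs
    cases B <;> cases hf
    obtain ⟨hΓ, hA, ⟨i, rfl, -⟩ | ⟨l, x, j, rfl, rfl⟩⟩ := hw
    · have h1 := congrArg Judgement.body h
      have h2 := (JBody.term.inj h1).1
      simp [RawExpr.mapSym, tmExpr] at h2
    · have h1 := congrArg Judgement.body h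
      obtain ⟨rfl, h2, h3⟩ := tmExpr_inj (JBody.term.inj h1).1
      obtain rfl : j = Fin.val := h3
      exact ⟨x, by rw [gen, ← genCtx_unique hΓ hl hA.branch], h2⟩

/-! ### The multiplication is cartesian -/

/-- The endofunctor of type-and-term structures, on objects. -/
noncomputable abbrev P (X : TTStr.{u}) : TTStr.{u} := WPGat.forgetful.obj X.free

/-- The endofunctor of type-and-term structures, on maps. -/
noncomputable abbrev Pmap : X.P ⟶ Y.P := WPGat.forgetful.map (freeFunctor.map f)

theorem rep_injective {v : HVertex} {c c' : X.P.El v} (h : (rep c).1.1 = (rep c').1.1) :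
    c = c' := by
  rw [← mk_rep c, ← mk_rep c', Subtype.ext (Subtype.ext h)]

theorem rep_onEl {v : HVertex} (c : X.P.El v) :
    (rep (onEl (Pmap f) v c)).1.1 = relabel f (rep c).1.1 := by
  exact (congrArg (fun c : X.P.El v => (rep (onEl (Pmap f) v c)).1.1) (mk_rep c)).symm.trans
    (congrArg (fun c : Y.P.El v => (rep c).1.1) (freeFunctor_map_mk f (rep c)))

theorem exists_rep {v : HVertex} {J : Judgement X.Sym} (h : Derivable X.freeBasic J)
    (hs : J.HasShape v) : ∃ c : X.P.El v, (rep c).1.1 = J :=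
  ⟨Quotient.mk (X.free.elemSetoid v) ⟨⟨J, h⟩, hs⟩, rfl⟩

theorem rep_boundary {v w : HVertex} (e : HEdge v w) (c : X.P.El w) :
    (rep c).1.1.boundary = [(rep (X.P.bd e c)).1.1] := by
  exact (WPGat.boundary_val X.free e (rep (v := w) c)).trans
    (congrArg (fun K => [K.1.1]) (rep_classBoundary e c).symm)

theorem rep_ty {k : ℕ} (c : X.P.El (.ty k)) :
    ∃ Γ A, (rep c).1.1 = ⟨Γ, .type A⟩ ∧ Γ.length = k := by
  generalize rep c = J
  obtain ⟨⟨⟨Γ, B⟩, hJ⟩, hf, hl⟩ := J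
  cases B <;> cases hf
  exact ⟨_, _, rfl, hl⟩

theorem rep_ty_succ {k : ℕ} (c : X.P.El (.ty (k + 1))) : ∃ Γ A B,
    (rep c).1.1 = ⟨A :: Γ, .type B⟩ ∧ (rep (X.P.bd (.next k) c)).1.1 = ⟨Γ, .type A⟩ := by
  obtain ⟨Γ, B, h, hl⟩ := rep_ty c
  have hb := rep_boundary (.next k) c
  rw [h] at hb ⊢
  cases Γ with
  | nil => simp at hl
  | cons A Γ =>
    simp only [Judgement.boundary, List.cons.injEq, and_true] at hb
    exact ⟨_, _, _, rfl, hb.symm⟩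

theorem rep_tm {k : ℕ} (c : X.P.El (.tm k)) : ∃ Γ t A,
    (rep c).1.1 = ⟨Γ, .term t A⟩ ∧ (rep (X.P.bd (.term k) c)).1.1 = ⟨Γ, .type A⟩ := by
  have hb := rep_boundary (.term k) c
  generalize rep c = J at hb ⊢
  obtain ⟨⟨⟨Γ, B⟩, hJ⟩, hf, hl⟩ := J
  cases B <;> cases hf
  simp only [Judgement.boundary, List.cons.injEq, and_true] at hb
  exact ⟨_, _, _, rfl, hb.symm⟩

theorem rep_derivable {v : HVertex} {c : X.P.El v} {J : Judgement X.Sym}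
    (h : (rep c).1.1 = J) : Derivable X.freeBasic J := h ▸ (rep c).1.2

/-- The translation that underlies the multiplication. -/
noncomputable abbrev flat : RawExpr X.P.Sym → RawExpr X.Sym :=
  RawExpr.translate X.flattenRealization.sym

theorem flat_tyExpr {k : ℕ} {c : X.P.El (.ty k)} {Γ A} (h : (rep c).1.1 = ⟨Γ, .type A⟩)
    (j : Fin k → ℕ) : flat (tyExpr k c j) = A.rename (extend j 0) := by
  have h1 := X.flattenRealization.translate_tyExpr c j
  have h2 : (X.flattenRealization.toFun _ c).1.1 = ⟨Γ, .type A⟩ := h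
  rwa [h2] at h1

theorem flat_tmExpr {k : ℕ} {c : X.P.El (.tm k)} {Γ t A} (h : (rep c).1.1 = ⟨Γ, .term t A⟩)
    (j : Fin k → ℕ) : flat (tmExpr k c j) = t.rename (extend j 0) := by
  have h1 := X.flattenRealization.translate_tmExpr c j
  have h2 : (X.flattenRealization.toFun _ c).1.1 = ⟨Γ, .term t A⟩ := h
  rwa [h2] at h1

theorem extend_castSucc {k : ℕ} (j : Fin (k + 1) → ℕ) {i : ℕ} (hi : i < k) :
    extend (j ∘ Fin.castSucc) 0 i = extend j 0 i := by
  simp only [extend, hi, hi.trans (Nat.lt_succ_self k), dite_true]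
  rfl

/-- A symbol `c` is itself a judgement, and its context read from the outside sits inside the
flattened `r` along `j`. Indeed the last variable has type `c`, and its predecessors on the branch
have as types the iterated boundaries of `c`, whose flattenings are the entries of `Γ`. -/
theorem flat_ctxGet_succ {r : List (RawExpr X.P.Sym)} (hr : IsContext r) :
    ∀ {d : ℕ} {c : X.P.El (.ty d)} {j : Fin (d + 1) → ℕ},
      ctxGet r (j (Fin.last d)) = some (tyExpr d c (j ∘ Fin.castSucc)) →
      ∀ {Γ A}, (rep c).1.1 = ⟨Γ, .type A⟩ → ∀ {i T}, ctxGet (A :: Γ) i = some T →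
      ctxGet (r.map flat) (extend j 0 i) = some (T.rename (extend j 0)) := by
  intro d
  induction d with
  | zero =>
    intro c j hj Γ A hc i T hi
    obtain ⟨_, _, hc', hl⟩ := rep_ty c
    rw [hc] at hc'
    cases hc'
    cases List.eq_nil_of_length_eq_zero hl
    rcases ctxGet_cons_iff.mp hi with hi | ⟨rfl, rfl⟩
    · simp [ctxGet_nil] at hi
    · have h0 : extend j 0 0 = j (Fin.last 0) := rfl
      rw [List.length_nil, h0, ctxGet_map, hj, Option.map_some, flat_tyExpr hc]
      exact congrArg some (RawExpr.rename_congr (fun i hi => absurd hi (Nat.not_lt_zero i))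
        (WPGat.scoped (T := X.free) (rep_derivable hc)).2)
  | succ d ih =>
    intro c j hj Γ A hc i T hi
    obtain ⟨Γ', A', B', hc', hb⟩ := rep_ty_succ c
    rw [hc] at hc'
    cases hc'
    have hs := WPGat.scoped (T := X.free) (rep_derivable hc)
    have hl : Γ'.length = d := by
      obtain ⟨_, _, h, hl⟩ := rep_ty (X.P.bd (.next d) c)
      rw [hb] at h
      cases h
      exact hl
    rcases ctxGet_cons_iff.mp hi with hi | ⟨rfl, rfl⟩
    · have hi' : i < d + 1 := by simpa [hl] using lt_of_ctxGet hi
      have h1 := ih (hr.isType hj).branch.1 hb hi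
      rw [extend_castSucc j hi'] at h1
      rw [h1]
      exact congrArg some (RawExpr.rename_congr
        (fun l hl => extend_castSucc j (hl.trans hi')) (ctxGet_scoped hs.1 hi))
    · have h0 : extend j 0 (A' :: Γ').length = j (Fin.last (d + 1)) := by
        rw [List.length_cons, hl]
        exact extend_of_lt j 0 (Fin.last (d + 1))
      rw [h0, ctxGet_map, hj, Option.map_some, flat_tyExpr hc]
      refine congrArg some (RawExpr.rename_congr (fun l hl' => extend_castSucc j ?_) hs.2)
      simpa [hl] using hl'

theorem flat_ctxGet {r : List (RawExpr X.P.Sym)} (hr : IsContext r) {d : ℕ}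
    {c : X.P.El (.ty d)} {j : Fin d → ℕ} (hj : Branch r d c j) {Γ A}
    (hc : (rep c).1.1 = ⟨Γ, .type A⟩) {i T} (hi : ctxGet Γ i = some T) :
    ctxGet (r.map flat) (extend j 0 i) = some (T.rename (extend j 0)) := by
  cases d with
  | zero =>
    obtain ⟨_, _, hc', hl⟩ := rep_ty c
    rw [hc] at hc'
    cases hc'
    cases List.eq_nil_of_length_eq_zero hl
    simp [ctxGet_nil] at hi
  | succ d =>
    obtain ⟨Γ', A', B', hc', hb⟩ := rep_ty_succ c
    rw [hc] at hc'
    cases hc'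
    exact flat_ctxGet_succ hr hj.1 hb hi

/-! ### Lifting well-formedness along relabelling and renaming. -/

theorem eq_tyExpr_of_mapSym {e : RawExpr X.Sym} {k : ℕ} {y : Y.El (.ty k)} {j : Fin k → ℕ}
    (h : e.mapSym (symMap f) = tyExpr k y j) : ∃ x, e = tyExpr k x j ∧ onEl f _ x = y := by
  cases e with
  | var i => simp [RawExpr.mapSym, tyExpr] at h
  | app w n args =>
    rcases w with ⟨l, x⟩ | ⟨l, x⟩
    · simp only [RawExpr.mapSym, symMap, tyExpr, RawExpr.app.injEq, Sum.map_inl, Sum.inl.injEq,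
        Sigma.mk.injEq] at h
      obtain ⟨⟨rfl, h1⟩, rfl, h2⟩ := h
      refine ⟨x, congrArg (RawExpr.app _ n) (funext fun i => ?_), eq_of_heq h1⟩
      have h3 := congrFun (eq_of_heq h2) i
      generalize args i = a at h3 ⊢
      cases a with
      | var => simpa [RawExpr.mapSym] using h3
      | app => simp [RawExpr.mapSym] at h3
    · simp [RawExpr.mapSym, symMap, tyExpr] at h

theorem eq_tmExpr_of_mapSym {e : RawExpr X.Sym} {k : ℕ} {y : Y.El (.tm k)} {j : Fin k → ℕ}
    (h : e.mapSym (symMap f) = tmExpr k y j) : ∃ x, e = tmExpr k x j ∧ onEl f _ x = y := by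
  cases e with
  | var i => simp [RawExpr.mapSym, tmExpr] at h
  | app w n args =>
    rcases w with ⟨l, x⟩ | ⟨l, x⟩
    · simp [RawExpr.mapSym, symMap, tmExpr] at h
    · simp only [RawExpr.mapSym, symMap, tmExpr, RawExpr.app.injEq, Sum.map_inr, Sum.inr.injEq,
        Sigma.mk.injEq] at h
      obtain ⟨⟨rfl, h1⟩, rfl, h2⟩ := h
      refine ⟨x, congrArg (RawExpr.app _ n) (funext fun i => ?_), eq_of_heq h1⟩
      have h3 := congrFun (eq_of_heq h2) i
      generalize args i = a at h3 ⊢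
      cases a with
      | var => simpa [RawExpr.mapSym] using h3
      | app => simp [RawExpr.mapSym] at h3

theorem eq_var_of_mapSym {e : RawExpr X.Sym} {i : ℕ}
    (h : e.mapSym (symMap f) = .var i) : e = .var i := by
  cases e with
  | var => exact congrArg _ (RawExpr.var.inj h)
  | app => simp [RawExpr.mapSym] at h

theorem ctxGet_of_map {α β : Type*} {g : α → β} {Γ : List α} {i : ℕ} {b : β}
    (h : ctxGet (Γ.map g) i = some b) : ∃ a, ctxGet Γ i = some a ∧ g a = b := by
  rw [ctxGet_map] at h
  exact Option.map_eq_some_iff.mp h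

/-- By `Branch.of_last` only the type of the last argument has to be checked. The actual and the
required type agree after relabelling, by `h`, and after renaming, by `h'`; hence they are equal. -/
theorem IsType.lift {Γ p : List (RawExpr X.Sym)} {e : ℕ → ℕ} (hΓ : IsContext Γ)
    (hp : ∀ {i T}, ctxGet Γ i = some T → ctxGet p (e i) = some (T.rename e))
    {A : RawExpr X.Sym} (h : IsType (Γ.map (RawExpr.mapSym (symMap f))) (A.mapSym (symMap f)))
    (h' : IsType p (A.rename e)) : IsType Γ A := by
  obtain ⟨k, y, j, hA, hb⟩ := h
  obtain ⟨x, rfl, rfl⟩ := eq_tyExpr_of_mapSym f hA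
  refine ⟨k, x, j, rfl, ?_⟩
  rw [tyExpr_rename] at h'
  have hb' := h'.branch
  cases k with
  | zero => trivial
  | succ k =>
    obtain ⟨S, hS, hS'⟩ := ctxGet_of_map hb.1
    have h1 := (hp hS).symm.trans hb'.1
    refine .of_last hΓ (hS.trans (congrArg some ?_))
    refine RawExpr.eq_of_mapSym_eq_of_rename_eq (g := symMap f) (f := e) ?_ (Option.some.inj h1)
    rw [hS', mapSym_tyExpr, onEl_bd]

theorem IsTerm.lift {Γ p : List (RawExpr X.Sym)} {e : ℕ → ℕ}
    (hp : ∀ {i T}, ctxGet Γ i = some T → ctxGet p (e i) = some (T.rename e))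
    {t A : RawExpr X.Sym}
    (h : IsTerm (Γ.map (RawExpr.mapSym (symMap f))) (t.mapSym (symMap f)) (A.mapSym (symMap f)))
    (h' : IsTerm p (t.rename e) (A.rename e)) : IsTerm Γ t A := by
  rcases h with ⟨i, ht, hi⟩ | ⟨k, y, j, ht, hA⟩
  · obtain rfl := eq_var_of_mapSym f ht
    obtain ⟨S, hS, hS'⟩ := ctxGet_of_map hi
    refine .inl ⟨i, rfl, hS.trans (congrArg some ?_)⟩
    rcases h' with ⟨i', ht', hi'⟩ | ⟨k, x, j, ht', -⟩
    · cases ht'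
      exact RawExpr.eq_of_mapSym_eq_of_rename_eq hS' (Option.some.inj ((hp hS).symm.trans hi'))
    · simp [RawExpr.rename, tmExpr] at ht'
  · obtain ⟨x, rfl, rfl⟩ := eq_tmExpr_of_mapSym f ht
    refine .inr ⟨k, x, j, rfl, ?_⟩
    rcases h' with ⟨i', ht', hi'⟩ | ⟨k', x', j', ht', hA'⟩
    · simp [RawExpr.rename, tmExpr] at ht'
    · rw [tmExpr_rename] at ht'
      obtain ⟨rfl, rfl, rfl⟩ := tmExpr_inj ht'
      refine RawExpr.eq_of_mapSym_eq_of_rename_eq (g := symMap f) (f := e) ?_ hA'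
      rw [hA, mapSym_tyExpr, onEl_bd]

/-! ### Pullback property of flattening. -/

/-- Relabelling shows the variables and the arity; it remains to compare the symbols, which are
judgements. Their types agree after relabelling and after renaming, and their contexts can be read
off from `r`. -/
theorem eq_of_flat_type {r : List (RawExpr X.P.Sym)} {R R' : RawExpr X.P.Sym}
    (hR : IsType r R) (hR' : IsType r R')
    (h : R.mapSym (symMap (Pmap f)) = R'.mapSym (symMap (Pmap f))) (h' : flat R = flat R') :
    R = R' := by
  obtain ⟨d, c, j, rfl, hb⟩ := hR
  obtain ⟨d', c', j', rfl, hb'⟩ := hR'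
  obtain ⟨rfl, h1, rfl⟩ := tyExpr_inj
    (show tyExpr d (onEl (Pmap f) _ c) j = tyExpr d' (onEl (Pmap f) _ c') j' from h)
  have h1 : onEl (Pmap f) _ c = onEl (Pmap f) _ c' := h1
  suffices h : c = c' by rw [h]
  obtain ⟨Γ, A, hc, hl⟩ := rep_ty c
  obtain ⟨Γ', A', hc', hl'⟩ := rep_ty c'
  have h2 := congrArg (fun c => (rep c).1.1.body) h1
  simp only [rep_onEl, hc, hc', relabel, Judgement.map, JBody.map, JBody.type.injEq] at h2
  simp only [flat_tyExpr hc, flat_tyExpr hc'] at h'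
  obtain rfl := RawExpr.eq_of_mapSym_eq_of_rename_eq h2 h'
  refine rep_injective ?_
  rw [hc, hc']
  congr 1
  cases d with
  | zero =>
    rw [List.eq_nil_of_length_eq_zero hl, List.eq_nil_of_length_eq_zero hl']
  | succ d =>
    -- The boundaries of both symbols are the symbol in the type of one and the same variable of
    -- `r`.
    obtain ⟨_, h3, -⟩ := tyExpr_inj (Option.some.inj (hb.1.symm.trans hb'.1))
    have h3 : X.P.bd (.next d) c = X.P.bd (.next d) c' := h3
    obtain ⟨_, _, _, h4, h5⟩ := rep_ty_succ c
    obtain ⟨_, _, _, h6, h7⟩ := rep_ty_succ c'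
    rw [hc] at h4
    rw [hc'] at h6
    rw [h3, h7] at h5
    cases h4
    cases h6
    cases h5
    rfl

/-- For two constants, the common type `R` fixes the boundary of the symbols, and the terms they
denote agree after relabelling and after renaming. -/
theorem eq_of_flat_term {r : List (RawExpr X.P.Sym)} {R u u' : RawExpr X.P.Sym}
    (hu : IsTerm r u R) (hu' : IsTerm r u' R)
    (h : u.mapSym (symMap (Pmap f)) = u'.mapSym (symMap (Pmap f))) (h' : flat u = flat u') :
    u = u' := by
  rcases hu with ⟨i, rfl, hi⟩ | ⟨d, c, j, rfl, rfl⟩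
  · exact (eq_var_of_mapSym (Pmap f) h.symm).symm
  rcases hu' with ⟨i, rfl, hi⟩ | ⟨d', c', j', rfl, hR⟩
  · exact eq_var_of_mapSym (Pmap f) h
  obtain ⟨rfl, h1, rfl⟩ := tmExpr_inj
    (show tmExpr d (onEl (Pmap f) _ c) j = tmExpr d' (onEl (Pmap f) _ c') j' from h)
  have h1 : onEl (Pmap f) _ c = onEl (Pmap f) _ c' := h1
  suffices h : c = c' by rw [h]
  obtain ⟨Γ, t, A, hc, hb⟩ := rep_tm c
  obtain ⟨Γ', t', A', hc', hb'⟩ := rep_tm c'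
  have h2 := congrArg (fun c => (rep c).1.1.body) h1
  simp only [rep_onEl, hc, hc', relabel, Judgement.map, JBody.map, JBody.term.injEq] at h2
  simp only [flat_tmExpr hc, flat_tmExpr hc'] at h'
  obtain rfl := RawExpr.eq_of_mapSym_eq_of_rename_eq h2.1 h'
  refine rep_injective ?_
  obtain ⟨_, h3, -⟩ := tyExpr_inj hR
  have h3 : X.P.bd (.term d) c = X.P.bd (.term d) c' := h3
  rw [h3, hb'] at hb
  rw [hc, hc']
  cases hb
  rfl

/-- A symbol for `R` has to be built as a judgement over `X`. The pullback of expressions supplies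
its type `B`; its context is already visible in `r` at the last argument of `Q`; and `IsType.lift`
shows that `B` is well-formed there. -/
theorem exists_flat_type {r : List (RawExpr X.P.Sym)} (hr : IsContext r)
    {Q : RawExpr Y.P.Sym} {A : RawExpr X.Sym}
    (hQ : IsType (r.map (RawExpr.mapSym (symMap (Pmap f)))) Q) (hA : IsType (r.map flat) A)
    (h : flat Q = A.mapSym (symMap f)) :
    ∃ R, IsType r R ∧ flat R = A ∧ R.mapSym (symMap (Pmap f)) = Q := by
  obtain ⟨d, c, j, rfl, hb⟩ := hQ
  obtain ⟨Θ, B, hc, hl⟩ := rep_ty c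
  rw [flat_tyExpr hc] at h
  obtain ⟨B, rfl, rfl⟩ := RawExpr.exists_of_mapSym_eq_rename h.symm
  obtain ⟨Θ', h1, h2, h3, h4⟩ : ∃ Θ', IsContext Θ' ∧
      Θ'.map (RawExpr.mapSym (symMap f)) = Θ ∧
      (∀ {i T}, ctxGet Θ' i = some T →
        ctxGet (r.map flat) (extend j 0 i) = some (T.rename (extend j 0))) ∧
      ∀ c' : X.P.El (.ty d), (rep c').1.1 = ⟨Θ', .type B⟩ → Branch r d c' j := by
    cases d with
    | zero =>
      cases List.eq_nil_of_length_eq_zero hl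
      exact ⟨[], trivial, rfl, fun h => by simp [ctxGet_nil] at h, fun _ _ => trivial⟩
    | succ d =>
      -- The last argument has in `r` a type with some symbol `a` over the boundary of `c`. The
      -- judgement denoted by `a`, its type added to its context, is the required context.
      obtain ⟨S, hS, hS'⟩ := ctxGet_of_map hb.1
      obtain ⟨a, rfl, ha⟩ := eq_tyExpr_of_mapSym (Pmap f) hS'
      obtain ⟨Γ, A, ha', -⟩ := rep_ty a
      obtain ⟨Γ', A', B', hc', hd⟩ := rep_ty_succ c
      rw [hc] at hc'
      cases hc'
      rw [← ha, rep_onEl, ha'] at hd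
      cases hd
      have hw := free_wf (rep_derivable ha')
      refine ⟨A :: Γ, ⟨hw.2, hw.1⟩, rfl, flat_ctxGet_succ hr hS ha', fun c' h' => ?_⟩
      refine .of_last hr (hS.trans ?_)
      obtain ⟨_, _, _, h5, h6⟩ := rep_ty_succ c'
      rw [h'] at h5
      cases h5
      rw [rep_injective (ha'.trans h6.symm)]
  have hw := free_wf (rep_derivable hc)
  have hB : IsType Θ' B := .lift f h1 h3 (by rw [h2]; exact hw.2) hA
  obtain ⟨c', hc'⟩ := exists_rep (v := .ty d) (free_derivable_type h1 hB)
    ⟨rfl, by rw [← hl, ← h2]; simp⟩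
  refine ⟨tyExpr d c' j, ⟨_, _, _, rfl, h4 c' hc'⟩, flat_tyExpr hc' j, ?_⟩
  rw [mapSym_tyExpr]
  congr 1
  refine rep_injective ?_
  rw [rep_onEl, hc, hc', ← h2]
  rfl

theorem exists_flat_term {r : List (RawExpr X.P.Sym)} (hr : IsContext r)
    {R : RawExpr X.P.Sym} (hR : IsType r R) {s : RawExpr Y.P.Sym} {t : RawExpr X.Sym}
    (hs : IsTerm (r.map (RawExpr.mapSym (symMap (Pmap f)))) s (R.mapSym (symMap (Pmap f))))
    (ht : IsTerm (r.map flat) t (flat R)) (h : flat s = t.mapSym (symMap f)) :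
    ∃ u, IsTerm r u R ∧ flat u = t ∧ u.mapSym (symMap (Pmap f)) = s := by
  rcases hs with ⟨i, rfl, hi⟩ | ⟨d, c, j, rfl, hA⟩
  · obtain rfl := eq_var_of_mapSym f h.symm
    obtain ⟨S, hS, hS'⟩ := ctxGet_of_map hi
    rcases ht with ⟨i', hi', ht⟩ | ⟨k, x, j, ht', -⟩
    · cases hi'
      rw [ctxGet_map, hS] at ht
      -- The type of the variable in `r` is not known to be `R` beforehand, but both have the same
      -- relabelling and the same flattening.
      obtain rfl := eq_of_flat_type f (hr.isType hS) hR hS' (Option.some.inj ht)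
      exact ⟨.var i, .inl ⟨i, rfl, hS⟩, rfl, rfl⟩
    · simp [tmExpr] at ht'
  · obtain ⟨a, rfl, ha⟩ := eq_tyExpr_of_mapSym (Pmap f) hA
    obtain ⟨Θ, v, B, hc, hb⟩ := rep_tm c
    obtain ⟨Θ', B', ha', hl⟩ := rep_ty a
    rw [← ha, rep_onEl, ha'] at hb
    cases hb
    rw [flat_tmExpr hc] at h
    obtain ⟨v, rfl, rfl⟩ := RawExpr.exists_of_mapSym_eq_rename h.symm
    rw [flat_tyExpr ha'] at ht
    have hw := free_wf (rep_derivable ha')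
    have hw' := free_wf (rep_derivable hc)
    have hv : IsTerm Θ' v B' := .lift f (flat_ctxGet hr hR.branch ha') hw'.2.2 ht
    obtain ⟨c', hc'⟩ := exists_rep (v := .tm d) (free_derivable_term hw.1 hw.2 hv) ⟨rfl, hl⟩
    have hb' : X.P.bd (.term d) c' = a := by
      obtain ⟨_, _, _, h1, h2⟩ := rep_tm c'
      rw [hc'] at h1
      cases h1
      exact rep_injective (h2.trans ha'.symm)
    refine ⟨tmExpr d c' j, .inr ⟨_, _, _, rfl, by rw [hb']⟩, flat_tmExpr hc' j, ?_⟩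
    rw [mapSym_tmExpr]
    congr 1
    refine rep_injective ?_
    rw [rep_onEl, hc, hc']
    rfl

theorem eq_of_flat_ctx : ∀ {r r' : List (RawExpr X.P.Sym)}, IsContext r → IsContext r' →
    r.map (RawExpr.mapSym (symMap (Pmap f))) = r'.map (RawExpr.mapSym (symMap (Pmap f))) →
    r.map flat = r'.map flat → r = r'
  | [], [], _, _, _, _ => rfl
  | [], _ :: _, _, _, h, _ => by simp at h
  | _ :: _, [], _, _, h, _ => by simp at h
  | R :: r, R' :: r', hr, hr', h, h' => by
    simp only [List.map_cons, List.cons.injEq] at h h'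
    obtain rfl := eq_of_flat_ctx hr.2 hr'.2 h.2 h'.2
    rw [eq_of_flat_type f hr.1 hr'.1 h.1 h'.1]

theorem exists_flat_ctx : ∀ {q : List (RawExpr Y.P.Sym)} {p : List (RawExpr X.Sym)},
    IsContext q → IsContext p → q.map flat = p.map (RawExpr.mapSym (symMap f)) →
    ∃ r, IsContext r ∧ r.map flat = p ∧ r.map (RawExpr.mapSym (symMap (Pmap f))) = q
  | [], [], _, _, _ => ⟨[], trivial, rfl, rfl⟩
  | [], _ :: _, _, _, h => by simp at h
  | _ :: _, [], _, _, h => by simp at h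
  | Q :: q, A :: p, hq, hp, h => by
    simp only [List.map_cons, List.cons.injEq] at h
    obtain ⟨r, hr, rfl, rfl⟩ := exists_flat_ctx hq.2 hp.2 h.2
    obtain ⟨R, hR, rfl, rfl⟩ := exists_flat_type f hr hq.1 hp.1 h.1
    exact ⟨R :: r, ⟨hR, hr⟩, rfl, rfl⟩

theorem eq_of_flat {v : HVertex} {J J' : Judgement X.P.Sym} (hJ : Derivable X.P.freeBasic J)
    (hJ' : Derivable X.P.freeBasic J') (hs : J.HasShape v) (hs' : J'.HasShape v)
    (h : relabel (Pmap f) J = relabel (Pmap f) J') (h' : J.map flat = J'.map flat) : J = J' := by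
  have hw := free_wf hJ
  have hw' := free_wf hJ'
  obtain ⟨Γ, B⟩ := J
  obtain ⟨Γ', B'⟩ := J'
  simp only [relabel, Judgement.map, Judgement.mk.injEq] at h h'
  obtain rfl := eq_of_flat_ctx f hw.1 hw'.1 h.1 h'.1
  cases v <;> obtain ⟨hf, hl⟩ := hs <;> obtain ⟨hf', hl'⟩ := hs' <;> cases B <;> cases hf <;>
    cases B' <;> cases hf' <;>
    simp only [JBody.map, JBody.type.injEq, JBody.term.injEq] at h h'
  · rw [eq_of_flat_type f hw.2 hw'.2 h.2 h'.2]
  · obtain rfl := eq_of_flat_type f hw.2.1 hw'.2.1 h.2.2 h'.2.2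
    rw [eq_of_flat_term f hw.2.2 hw'.2.2 h.2.1 h'.2.1]

theorem exists_flat {v : HVertex} {K : Judgement Y.P.Sym} {J : Judgement X.Sym}
    (hK : Derivable Y.P.freeBasic K) (hJ : Derivable X.freeBasic J)
    (hs : K.HasShape v) (hs' : J.HasShape v) (h : K.map flat = relabel f J) :
    ∃ L, Derivable X.P.freeBasic L ∧ L.HasShape v ∧ L.map flat = J ∧
      relabel (Pmap f) L = K := by
  have hw := free_wf hK
  have hw' := free_wf hJ
  obtain ⟨Γ, B⟩ := K
  obtain ⟨Γ', B'⟩ := J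
  simp only [relabel, Judgement.map, Judgement.mk.injEq] at h
  obtain ⟨r, hr, rfl, rfl⟩ := exists_flat_ctx f hw.1 hw'.1 h.1
  cases v <;> obtain ⟨hf, hl⟩ := hs <;> obtain ⟨hf', hl'⟩ := hs' <;> cases B <;> cases hf <;>
    cases B' <;> cases hf' <;>
    simp only [JBody.map, JBody.type.injEq, JBody.term.injEq] at h
  · obtain ⟨R, hR, rfl, rfl⟩ := exists_flat_type f hr hw.2 hw'.2 h.2
    exact ⟨⟨r, .type R⟩, free_derivable_type hr hR, ⟨rfl, by simpa using hl⟩, rfl, rfl⟩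
  · obtain ⟨R, hR, rfl, rfl⟩ := exists_flat_type f hr hw.2.1 hw'.2.1 h.2.2
    obtain ⟨u, hu, rfl, rfl⟩ := exists_flat_term f hr hR hw.2.2 hw'.2.2 h.2.1
    exact ⟨⟨r, .term u R⟩, free_derivable_term hr hR hu, ⟨rfl, by simpa using hl⟩, rfl, rfl⟩

end

end TTStr

/-! ### Min-heaps and contexts of the free theory -/

namespace MinHeap

section Depth

variable {n : ℕ} (φ : MinHeap n)

theorem depth_eq_zero {i : Fin (n + 1)} : φ.depth i = 0 ↔ i = 0 := by
  rw [depth]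
  split_ifs with h <;> simp [h]

theorem depth_of_ne_zero {i : Fin (n + 1)} (hi : i ≠ 0) :
    φ.depth i = φ.depth (φ.parent i) + 1 := by
  rw [depth, dif_neg hi]

theorem ne_zero_of_depth {i : Fin (n + 1)} {k : ℕ} (h : φ.depth i = k + 1) : i ≠ 0 := by
  intro h0
  rw [(φ.depth_eq_zero).mpr h0] at h
  omega

theorem depth_pred {i : Fin (n + 1)} (hi : i ≠ 0) : φ.depth i = φ.depth i - 1 + 1 := by
  rw [φ.depth_of_ne_zero hi]
  rfl

theorem parent_iterate_le (m : ℕ) (i : Fin (n + 1)) : φ.parent^[m] i ≤ i := by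
  induction m generalizing i with
  | zero => exact le_rfl
  | succ m ih =>
    refine (ih (φ.parent i)).trans ?_
    by_cases hi : i = 0
    · rw [hi, φ.parent_zero]
    · exact (φ.parent_lt i hi).le

theorem parent_iterate_lt {m : ℕ} (hm : 0 < m) {i : Fin (n + 1)} (hi : i ≠ 0) :
    φ.parent^[m] i < i := by
  obtain ⟨m, rfl⟩ := Nat.exists_eq_succ_of_ne_zero hm.ne'
  exact (φ.parent_iterate_le m (φ.parent i)).trans_lt (φ.parent_lt i hi)

theorem depth_iterate {m k : ℕ} (hm : m ≤ k) {i : Fin (n + 1)} (h : φ.depth i = k + 1) :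
    φ.depth (φ.parent^[m] i) = k - m + 1 := by
  induction m generalizing i k with
  | zero => exact h
  | succ m ih =>
    obtain ⟨k, rfl⟩ := Nat.exists_eq_succ_of_ne_zero (by omega : k ≠ 0)
    rw [Function.iterate_succ_apply, ih (by omega) (φ.depth_parent h)]
    omega

/-- The variables for the proper ancestors of a node of depth `k + 1`. -/
def ancestors (i : Fin (n + 1)) (k : ℕ) (l : Fin k) : ℕ := (φ.parent^[k - l] i).val - 1

theorem ancestors_last (i : Fin (n + 1)) (k : ℕ) :
    φ.ancestors i (k + 1) (Fin.last k) = (φ.parent i).val - 1 := by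
  simp [ancestors]

theorem ancestors_castSucc (i : Fin (n + 1)) (k : ℕ) :
    φ.ancestors i (k + 1) ∘ Fin.castSucc = φ.ancestors (φ.parent i) k := by
  funext l
  have : k + 1 - l.val = (k - l.val) + 1 := by omega
  simp [ancestors, this]

theorem ancestors_lt {i : Fin (n + 1)} {k : ℕ} (h : φ.depth i = k + 1) (l : Fin k) :
    φ.ancestors i k l < i.val - 1 := by
  have h1 := φ.parent_iterate_lt (m := k - l) (by omega) (φ.ne_zero_of_depth h)
  -- These ancestors still have positive depth, hence differ from the root, and subtracting one does
  -- not truncate.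
  have h2 := φ.ne_zero_of_depth (φ.depth_iterate (m := k - l) (by omega) h)
  rw [Fin.lt_def] at h1
  rw [Ne, Fin.ext_iff, Fin.val_zero] at h2
  unfold ancestors
  omega

end Depth

end MinHeap

namespace TTStr

open MinHeap

section HeapCtx

variable {X Y : TTStr.{u}} {n : ℕ} {φ : MinHeap n} {S : Set (Fin (n + 1))}

theorem Branch.of_cons {A : RawExpr X.Sym} {Γ : List (RawExpr X.Sym)} :
    ∀ {k : ℕ} {x : X.El (.ty k)} {j : Fin k → ℕ}, Branch (A :: Γ) k x j →
      (∀ l, j l < Γ.length) → Branch Γ k x j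
  | 0, _, _, _, _ => trivial
  | _ + 1, _, _, h, hj =>
    ⟨(ctxGet_cons_of_lt (hj _)).symm.trans h.1, h.2.of_cons fun _ => hj _⟩

theorem isContext_of_ctxGet : ∀ {Γ : List (RawExpr X.Sym)},
    (∀ i A, ctxGet Γ i = some A →
      ∃ k x j, A = tyExpr k x j ∧ Branch Γ k x j ∧ ∀ l, j l < i) → IsContext Γ
  | [], _ => trivial
  | A :: Γ, h => by
    refine ⟨?_, isContext_of_ctxGet fun i B hi => ?_⟩
    · obtain ⟨k, x, j, h1, h2, h3⟩ := h _ A (ctxGet_cons_length A Γ)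
      exact ⟨k, x, j, h1, h2.of_cons h3⟩
    · obtain ⟨k, x, j, h1, h2, h3⟩ := h i B (ctxGet_cons hi)
      exact ⟨k, x, j, h1, h2.of_cons fun l => (h3 l).trans (lt_of_ctxGet hi), h3⟩

/-- The presheaf of shape `φ` with one term-element adjoined over each node of `S`. -/
abbrev heapShape (φ : MinHeap n) (S : Set (Fin (n + 1))) : TTStr.{u} :=
  ofEdges (φ.Node S) (φ.nodeBoundary S)

/-- The label of a node. -/
def label (h : heapShape φ S ⟶ X) {k : ℕ} {i : Fin (n + 1)} (hi : φ.depth i = k + 1) :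
    X.El (.ty k) :=
  onEl h (.ty k) (⟨⟨i, hi⟩⟩ : φ.Node S (.ty k))

theorem bd_label (h : heapShape φ S ⟶ X) {k : ℕ} {i : Fin (n + 1)} (hi : φ.depth i = k + 2) :
    X.bd (.next k) (label h hi) = label h (φ.depth_parent hi) :=
  (onEl_bd h (.next k) (⟨⟨i, hi⟩⟩ : φ.Node S (.ty (k + 1)))).symm

/-- The type at a node. -/
def nodeExpr (h : heapShape φ S ⟶ X) {k : ℕ} {i : Fin (n + 1)} (hi : φ.depth i = k + 1) :
    RawExpr X.Sym :=
  tyExpr k (label h hi) (φ.ancestors i k)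

/-- The context of a labelled heap. -/
def heapCtx (h : heapShape φ S ⟶ X) : List (RawExpr X.Sym) :=
  (List.ofFn fun i : Fin n => nodeExpr h (φ.depth_pred i.succ_ne_zero)).reverse

theorem length_heapCtx (h : heapShape φ S ⟶ X) : (heapCtx h).length = n := by simp [heapCtx]

theorem length_tail_heapCtx {φ : MinHeap (n + 1)} {S : Set (Fin (n + 2))}
    (h : heapShape φ S ⟶ X) : (heapCtx h).tail.length = n := by
  simp [length_heapCtx]

/-- Node `i` is the variable `i - 1`, since the root carries no variable. Allowing any `k` with the
right depth avoids casts along depths. -/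
theorem ctxGet_heapCtx (h : heapShape φ S ⟶ X) {k : ℕ} {i : Fin (n + 1)}
    (hi : φ.depth i = k + 1) : ctxGet (heapCtx h) (i.val - 1) = some (nodeExpr h hi) := by
  obtain ⟨i, rfl⟩ := Fin.exists_succ_eq.mpr (φ.ne_zero_of_depth hi)
  have hk : k = φ.depth i.succ - 1 := by omega
  subst hk
  simp [ctxGet, heapCtx]

theorem heapCtx_branch (h : heapShape φ S ⟶ X) {k : ℕ} {i : Fin (n + 1)}
    (hi : φ.depth i = k + 1) : Branch (heapCtx h) k (label h hi) (φ.ancestors i k) := by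
  induction k generalizing i with
  | zero => trivial
  | succ k ih =>
    refine ⟨?_, ?_⟩
    · rw [ancestors_last, ancestors_castSucc, bd_label]
      exact ctxGet_heapCtx h (φ.depth_parent hi)
    · rw [ancestors_castSucc, bd_label]
      exact ih _

theorem heapCtx_isContext (h : heapShape φ S ⟶ X) : IsContext (heapCtx h) := by
  refine isContext_of_ctxGet fun i A hi => ?_
  have hin : i < n := by simpa [length_heapCtx] using lt_of_ctxGet hi
  have hd := φ.depth_pred (Fin.succ_ne_zero ⟨i, hin⟩)
  have h1 := ctxGet_heapCtx h hd
  simp only [Fin.val_succ, Nat.add_sub_cancel] at h1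
  obtain rfl := Option.some.inj (hi.symm.trans h1)
  refine ⟨_, _, _, rfl, heapCtx_branch h hd, fun l => ?_⟩
  simpa using φ.ancestors_lt hd l

/-- The type of a variable recovers the parent of its node: the root if there are no arguments, and
otherwise the node of the last argument. -/
theorem eq_of_heapCtx_eq {ψ : MinHeap n} {S' : Set (Fin (n + 1))} {h : heapShape φ S ⟶ X}
    {h' : heapShape ψ S' ⟶ X} (e : heapCtx h = heapCtx h') : φ = ψ := by
  ext1
  funext i
  by_cases hi : i = 0
  · rw [hi, φ.parent_zero, ψ.parent_zero]
  obtain ⟨k, hk⟩ : ∃ k, φ.depth i = k + 1 := ⟨_, φ.depth_pred hi⟩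
  obtain ⟨k', hk'⟩ : ∃ k, ψ.depth i = k + 1 := ⟨_, ψ.depth_pred hi⟩
  have h1 := ctxGet_heapCtx h hk
  rw [e] at h1
  obtain ⟨rfl, -, h2⟩ := tyExpr_inj (Option.some.inj (h1.symm.trans (ctxGet_heapCtx h' hk')))
  have h3 := φ.depth_parent hk
  have h4 := ψ.depth_parent hk'
  cases k with
  | zero => rw [φ.depth_eq_zero.mp h3, ψ.depth_eq_zero.mp h4]
  | succ k =>
    have h5 := congrFun h2 (Fin.last k)
    change φ.ancestors i (k + 1) _ = _ at h5
    rw [ancestors_last, ancestors_last] at h5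
    have h6 := φ.ne_zero_of_depth h3
    have h7 := ψ.ne_zero_of_depth h4
    rw [Ne, Fin.ext_iff, Fin.val_zero] at h6 h7
    exact Fin.ext (by omega)

theorem label_eq_of_heapCtx_eq {S' : Set (Fin (n + 1))} {h : heapShape φ S ⟶ X}
    {h' : heapShape φ S' ⟶ X} (e : heapCtx h = heapCtx h') {k : ℕ} {i : Fin (n + 1)}
    (hi : φ.depth i = k + 1) : label h hi = label h' hi := by
  have h1 := ctxGet_heapCtx h hi
  rw [e] at h1
  obtain ⟨_, h2, -⟩ := tyExpr_inj (Option.some.inj (h1.symm.trans (ctxGet_heapCtx h' hi)))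
  exact h2

theorem heapCtx_comp (h : heapShape φ S ⟶ X) (f : X ⟶ Y) :
    heapCtx (h ≫ f) = (heapCtx h).map (RawExpr.mapSym (symMap f)) := by
  rw [heapCtx, heapCtx, List.map_reverse, List.map_ofFn]
  rfl

theorem tail_heapCtx_comp (h : heapShape φ S ⟶ X) (f : X ⟶ Y) :
    (heapCtx h).tail.map (RawExpr.mapSym (symMap f)) = (heapCtx (h ≫ f)).tail := by
  rw [heapCtx_comp, List.map_tail]

/-- The parent of a node is read off from the last argument of its type, shifted by one for the
root. The labels are returned as a family and not as a map, so that a term over the last node can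
still be added. -/
theorem exists_heap {Γ : List (RawExpr X.Sym)} (hΓ : IsContext Γ) (hl : Γ.length = n) :
    ∃ (φ : MinHeap n) (a : ∀ (k : ℕ) (i : Fin (n + 1)), φ.depth i = k + 1 → X.El (.ty k)),
      (∀ k i hi, X.bd (.next k) (a (k + 1) i hi) = a k (φ.parent i) (φ.depth_parent hi)) ∧
      ∀ k i hi, ctxGet Γ (i.val - 1) = some (tyExpr k (a k i hi) (φ.ancestors i k)) := by
  have h1 : ∀ i : Fin n, ∃ p : Fin (n + 1), p < i.succ ∧
      ((p = 0 ∧ ∃ x j, ctxGet Γ i = some (tyExpr 0 x j)) ∨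
        ∃ (k : ℕ) (x : X.El (.ty (k + 1))) (j : Fin (k + 1) → ℕ),
          p.val = j (Fin.last k) + 1 ∧ ctxGet Γ i = some (tyExpr (k + 1) x j)) := by
    intro i
    obtain ⟨A, hA⟩ := exists_ctxGet (Γ := Γ) (i := i.val) (hl ▸ i.2)
    obtain ⟨k, x, j, rfl, hb⟩ := hΓ.isType hA
    cases k with
    | zero => exact ⟨0, Fin.succ_pos i, .inl ⟨rfl, x, j, hA⟩⟩
    | succ k =>
      -- A type mentions only older variables; this is the heap condition.
      have hj : j (Fin.last k) < i := ctxGet_scoped hΓ.scoped hA (Fin.last k)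
      exact ⟨⟨j (Fin.last k) + 1, by omega⟩, by simpa [Fin.lt_def] using hj,
        .inr ⟨k, x, j, rfl, hA⟩⟩
  choose p hp hp' using h1
  let φ : MinHeap n :=
    { parent := Fin.cases 0 p
      parent_zero := rfl
      parent_lt := by
        intro i hi
        obtain ⟨i, rfl⟩ := Fin.exists_succ_eq.mpr hi
        exact hp i }
  -- By induction on the depth: the branch condition compares all arguments but the last with those
  -- of the parent, so the arguments of a type are exactly the ancestors of its node.
  have h2 : ∀ (k : ℕ) (i : Fin (n + 1)), φ.depth i = k + 1 →
      ∃ x, ctxGet Γ (i.val - 1) = some (tyExpr k x (φ.ancestors i k)) := by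
    intro k
    induction k with
    | zero =>
      intro i hi
      obtain ⟨i, rfl⟩ := Fin.exists_succ_eq.mpr (φ.ne_zero_of_depth hi)
      have h3 : p i = 0 := φ.depth_eq_zero.mp (φ.depth_parent hi)
      rcases hp' i with ⟨-, x, j, hx⟩ | ⟨k, x, j, hk, -⟩
      · refine ⟨x, hx.trans (congrArg (fun j => some (tyExpr 0 x j)) ?_)⟩
        exact funext fun l => l.elim0
      · simp [h3] at hk
    | succ k ih =>
      intro i hi
      obtain ⟨i, rfl⟩ := Fin.exists_succ_eq.mpr (φ.ne_zero_of_depth hi)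
      have hd : φ.depth (p i) = k + 1 := φ.depth_parent hi
      rcases hp' i with ⟨h0, -⟩ | ⟨k', x, j, hk, hx⟩
      · exact absurd h0 (φ.ne_zero_of_depth hd)
      · obtain ⟨y, hy⟩ := ih (p i) hd
        have hb := (hΓ.isType hx).branch
        rw [hk, Nat.add_sub_cancel] at hy
        obtain ⟨rfl, -, h4⟩ := tyExpr_inj (Option.some.inj (hy.symm.trans hb.1))
        refine ⟨x, hx.trans (congrArg (fun j => some (tyExpr (k + 1) x j)) ?_)⟩
        funext l
        refine Fin.lastCases ?_ (fun l => ?_) l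
        · rw [ancestors_last]
          exact (Nat.sub_eq_of_eq_add hk).symm
        · exact (congrFun h4 l).symm.trans (congrFun (φ.ancestors_castSucc i.succ k) l).symm
  choose a ha using h2
  refine ⟨φ, a, fun k i hi => ?_, ha⟩
  have hb := (hΓ.isType (ha (k + 1) i hi)).branch.1
  rw [ancestors_last, ha k _ (φ.depth_parent hi)] at hb
  obtain ⟨_, h3, -⟩ := tyExpr_inj (Option.some.inj hb)
  exact h3.symm

/-- A map out of the presheaf of a heap, from its values. -/
def heapHom (a : ∀ (k : ℕ) (i : Fin (n + 1)), φ.depth i = k + 1 → X.El (.ty k))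
    (ha : ∀ k i hi, X.bd (.next k) (a (k + 1) i hi) = a k (φ.parent i) (φ.depth_parent hi))
    (b : ∀ (k : ℕ) (i : Fin (n + 1)), φ.depth i = k + 1 → i ∈ S → X.El (.tm k))
    (hb : ∀ k i hi hi', X.bd (.term k) (b k i hi hi') = a k i hi) : heapShape φ S ⟶ X :=
  homMk (X := heapShape φ S) (fun v => match v with
    | .ty k => fun i => a k i.down.1 i.down.2
    | .tm k => fun i => b k i.down.1 i.down.2.1 i.down.2.2)
    (fun e i => by
      cases e with
      | next k => exact (ha k i.down.1 i.down.2).symm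
      | term k => exact (hb k i.down.1 i.down.2.1 i.down.2.2).symm)

theorem heapCtx_eq {Γ : List (RawExpr X.Sym)} (hl : Γ.length = n) {h : heapShape φ S ⟶ X}
    (H : ∀ k i (hi : φ.depth i = k + 1), ctxGet Γ (i.val - 1) = some (nodeExpr h hi)) :
    heapCtx h = Γ := by
  refine ctxGet_ext ((length_heapCtx h).trans hl.symm) fun i hi => ?_
  rw [length_heapCtx] at hi
  have hd := φ.depth_pred (Fin.succ_ne_zero ⟨i, hi⟩)
  have h1 := ctxGet_heapCtx h hd
  rw [← H _ _ hd] at h1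
  simpa using h1

end HeapCtx

/-! ### The elements of the free theory as labelled heaps -/

section Familial

variable {X Y : TTStr.{u}}

/-- The label of an adjoined term. -/
def tmLabel {n : ℕ} {φ : MinHeap n} {S : Set (Fin (n + 1))} (h : heapShape φ S ⟶ X) {k : ℕ}
    {i : Fin (n + 1)} (hi : φ.depth i = k + 1) (hi' : i ∈ S) : X.El (.tm k) :=
  onEl h (.tm k) (⟨⟨i, hi, hi'⟩⟩ : φ.Node S (.tm k))

theorem bd_tmLabel {n : ℕ} {φ : MinHeap n} {S : Set (Fin (n + 1))} (h : heapShape φ S ⟶ X)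
    {k : ℕ} {i : Fin (n + 1)} (hi : φ.depth i = k + 1) (hi' : i ∈ S) :
    X.bd (.term k) (tmLabel h hi hi') = label h hi :=
  (onEl_bd h (.term k) (⟨⟨i, hi, hi'⟩⟩ : φ.Node S (.tm k))).symm

theorem heapHom_ext {n : ℕ} {φ : MinHeap n} {S : Set (Fin (n + 1))} {h h' : heapShape φ S ⟶ X}
    (H : ∀ k i (hi : φ.depth i = k + 1), label h hi = label h' hi)
    (H' : ∀ k i (hi : φ.depth i = k + 1) (hi' : i ∈ S), tmLabel h hi hi' = tmLabel h' hi hi') :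
    h = h' := by
  refine hom_ext fun v i => ?_
  cases v with
  | ty k => exact H k i.down.1 i.down.2
  | tm k => exact H' k i.down.1 i.down.2.1 i.down.2.2

theorem last_depth {k : ℕ} (φ : MinHeap (k + 1)) :
    φ.depth (Fin.last (k + 1)) = φ.depth (Fin.last (k + 1)) - 1 + 1 :=
  φ.depth_pred (Fin.last_pos.ne')

/-- The last node is the type to the right of the turnstile, so a judgement with `k` variables
corresponds to a heap of size `k + 1`. -/
theorem heapCtx_eq_cons {k : ℕ} {φ : MinHeap (k + 1)} {S : Set (Fin (k + 2))}
    (h : heapShape φ S ⟶ X) {d : ℕ} (hd : φ.depth (Fin.last (k + 1)) = d + 1) :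
    heapCtx h = nodeExpr h hd :: (heapCtx h).tail := by
  have hl := length_heapCtx h
  have h1 := ctxGet_heapCtx h hd
  generalize heapCtx h = Γ at hl h1
  cases Γ with
  | nil => simp at hl
  | cons A Γ =>
    have hl' : Γ.length = k := by simpa using hl
    have h2 := ctxGet_cons_length A Γ
    rw [hl'] at h2
    rw [List.tail_cons, Option.some.inj (h2.symm.trans h1)]

theorem exists_heap_type {k : ℕ} {Γ : List (RawExpr X.Sym)} (hΓ : IsContext Γ)
    (hl : Γ.length = k) : ∃ (φ : MinHeap k) (h : φ.shape ⟶ X), heapCtx (S := ∅) h = Γ := by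
  obtain ⟨φ, a, ha, ha'⟩ := exists_heap hΓ hl
  exact ⟨φ, heapHom a ha (fun _ _ _ h => h.elim) (fun _ _ _ h => h.elim), heapCtx_eq hl ha'⟩

/-- The type judgement of a labelled heap. -/
def heapTypeElem {k : ℕ} (a : Σ φ : MinHeap (k + 1), (φ.shape ⟶ X)) : X.free.Elem (.ty k) :=
  ⟨⟨⟨(heapCtx (S := ∅) a.2).tail, .type (nodeExpr (S := ∅) a.2 (last_depth a.1))⟩, by
    have h := heapCtx_isContext (S := ∅) a.2
    rw [heapCtx_eq_cons (S := ∅) a.2 (last_depth a.1)] at h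
    exact free_derivable_type h.2 h.1⟩, rfl, length_tail_heapCtx (S := ∅) a.2⟩

theorem heapTypeElem_bijective (k : ℕ) : Function.Bijective (heapTypeElem (X := X) (k := k)) := by
  refine ⟨?_, fun J => ?_⟩
  · rintro ⟨φ, h⟩ ⟨φ', h'⟩ e
    have e1 := congrArg (fun J => J.1.1) e
    simp only [heapTypeElem, Judgement.mk.injEq, JBody.type.injEq] at e1
    have e2 : heapCtx (S := ∅) h = heapCtx (S := ∅) h' := by
      rw [heapCtx_eq_cons (S := ∅) h (last_depth φ), heapCtx_eq_cons (S := ∅) h' (last_depth φ'),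
        e1.1, e1.2]
    obtain rfl := eq_of_heapCtx_eq e2
    congr 1
    exact heapHom_ext (S := ∅) (fun k i hi => label_eq_of_heapCtx_eq e2 hi)
      (fun _ _ _ h => h.elim)
  · obtain ⟨⟨⟨Γ, B⟩, hJ⟩, hf, hl⟩ := J
    cases B <;> cases hf
    rename_i A
    have hw := free_wf hJ
    obtain ⟨φ, h, e⟩ := exists_heap_type (k := k + 1) (Γ := A :: Γ) ⟨hw.2, hw.1⟩
      (congrArg (· + 1) hl)
    refine ⟨⟨φ, h⟩, Subtype.ext (Subtype.ext ?_)⟩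
    rw [heapCtx_eq_cons (S := ∅) h (last_depth φ), List.cons.injEq] at e
    simp only [heapTypeElem, e]

theorem relabel_heapTypeElem (f : X ⟶ Y) {k : ℕ} (φ : MinHeap (k + 1)) (h : φ.shape ⟶ X) :
    relabelElem f (heapTypeElem ⟨φ, h⟩) = heapTypeElem ⟨φ, h ≫ f⟩ := by
  exact Subtype.ext (Subtype.ext
    (Judgement.ext (tail_heapCtx_comp (S := ∅) h f) rfl))

/-- The term judgement of a labelled heap with an adjoined term. -/
def heapTermElem {k : ℕ} (a : HeapTerms k X) : X.free.Elem (.tm k) :=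
  ⟨⟨⟨(heapCtx (S := {Fin.last _}) a.2).tail,
      .term (tmExpr _ (tmLabel (S := {Fin.last _}) a.2 (last_depth a.1) rfl)
          (a.1.ancestors (Fin.last _) _))
        (nodeExpr (S := {Fin.last _}) a.2 (last_depth a.1))⟩, by
    have h := heapCtx_isContext (S := {Fin.last _}) a.2
    rw [heapCtx_eq_cons (S := {Fin.last _}) a.2 (last_depth a.1)] at h
    exact free_derivable_term h.2 h.1 (.inr ⟨_, _, _, rfl,
      (congrArg (fun x => tyExpr _ x _) (bd_tmLabel (S := {Fin.last _}) a.2 _ _)).symm⟩)⟩,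
    rfl, length_tail_heapCtx (S := {Fin.last _}) a.2⟩

/-- The projection in the context of a labelled heap. -/
def heapProjectionElem {k : ℕ} (a : HeapProjections k X) : X.free.Elem (.tm k) :=
  ⟨⟨⟨heapCtx (S := ∅) a.2, .term (.var a.1.2)
      (nodeExpr (S := ∅) a.2 (a.1.1.depth_pred a.1.2.succ_ne_zero))⟩, by
    have h := heapCtx_isContext (S := ∅) a.2
    have h1 := ctxGet_heapCtx (S := ∅) a.2 (a.1.1.depth_pred a.1.2.succ_ne_zero)
    rw [Fin.val_succ, Nat.add_sub_cancel] at h1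
    exact free_derivable_term h (h.isType h1) (.inl ⟨_, rfl, h1⟩)⟩, rfl,
    length_heapCtx (S := ∅) a.2⟩

/-- A constant term is a term-element over the last node, its arguments being those of its type. A
variable has its type prescribed by the context, so only the heap of the context and an index
remain. -/
theorem heapElem_bijective (k : ℕ) : Function.Bijective
    (Sum.elim (heapTermElem (X := X) (k := k)) (heapProjectionElem (X := X) (k := k))) := by
  refine ⟨?_, fun J => ?_⟩
  · rintro (⟨φ, h⟩ | ⟨⟨φ, i⟩, h⟩) (⟨φ', h'⟩ | ⟨⟨φ', i'⟩, h'⟩) e <;>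
      have e1 := congrArg (fun J => J.1.1) e <;>
      simp only [Sum.elim_inl, Sum.elim_inr, heapTermElem, heapProjectionElem,
        Judgement.mk.injEq, JBody.term.injEq] at e1
    · have e2 : heapCtx (S := {Fin.last _}) h = heapCtx (S := {Fin.last _}) h' := by
        rw [heapCtx_eq_cons (S := {Fin.last _}) h (last_depth φ),
          heapCtx_eq_cons (S := {Fin.last _}) h' (last_depth φ'), e1.1, e1.2.2]
      obtain rfl := eq_of_heapCtx_eq e2
      congr 2
      refine heapHom_ext (S := {Fin.last _}) (fun k i hi => label_eq_of_heapCtx_eq e2 hi)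
        (fun d i hi hi' => ?_)
      cases hi'
      obtain ⟨_, e3, -⟩ := tmExpr_inj e1.2.1
      have hd : d = φ.depth (Fin.last _) - 1 := by omega
      subst hd
      exact e3
    · simp [tmExpr] at e1
    · simp [tmExpr] at e1
    · obtain rfl := eq_of_heapCtx_eq e1.1
      obtain rfl := Fin.ext (RawExpr.var.inj e1.2.1)
      congr 2
      exact heapHom_ext (S := ∅) (fun k i hi => label_eq_of_heapCtx_eq e1.1 hi)
        (fun _ _ _ h => h.elim)
  · obtain ⟨⟨⟨Γ, B⟩, hJ⟩, hf, hl⟩ := J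
    cases B <;> cases hf
    have hw := free_wf hJ
    change Γ.length = k at hl
    obtain ⟨hΓ, hA, ⟨i, rfl, hi⟩ | ⟨l, x, j, rfl, rfl⟩⟩ := hw
    · obtain ⟨φ, h, rfl⟩ := exists_heap_type hΓ hl
      have hik : i < k := hl ▸ lt_of_ctxGet hi
      refine ⟨.inr ⟨⟨φ, ⟨i, hik⟩⟩, h⟩, Subtype.ext (Subtype.ext ?_)⟩
      have h1 := ctxGet_heapCtx (S := ∅) h (φ.depth_pred (Fin.succ_ne_zero ⟨i, hik⟩))
      rw [Fin.val_succ, Nat.add_sub_cancel] at h1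
      simp only [Sum.elim_inr, heapProjectionElem]
      rw [Option.some.inj (h1.symm.trans hi)]
    · have hl' : (tyExpr l (X.bd (.term l) x) j :: Γ).length = k + 1 := congrArg (· + 1) hl
      obtain ⟨φ, a, ha, ha'⟩ := exists_heap
        (show IsContext (tyExpr l (X.bd (.term l) x) j :: Γ) from ⟨hA, hΓ⟩) hl'
      have h1 := ctxGet_cons_length (tyExpr l (X.bd (.term l) x) j) Γ
      rw [hl] at h1
      have h2 : ∀ d, φ.depth (Fin.last (k + 1)) = d + 1 → d = l := by
        intro d hd
        obtain ⟨h, -⟩ := tyExpr_inj (Option.some.inj ((ha' d _ hd).symm.trans h1))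
        exact h
      have h3 := h2 _ (last_depth φ)
      subst h3
      obtain ⟨_, h4, h5⟩ := tyExpr_inj
        (Option.some.inj ((ha' _ _ (last_depth φ)).symm.trans h1))
      -- Membership in the singleton and the depth force the node and `d`, so `x` is the only
      -- candidate. The second property identifies the chosen term after `choose`.
      have h6 : ∀ (d : ℕ) (i : Fin (k + 2)) (hi : φ.depth i = d + 1),
          i ∈ ({Fin.last (k + 1)} : Set _) → ∃ y : X.El (.tm d), X.bd (.term d) y = a d i hi ∧
          tmExpr d y (φ.ancestors i d) = tmExpr _ x j := by
        intro d i hi hi'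
        cases hi'
        have hd := h2 d hi
        subst hd
        exact ⟨x, h4.symm, congrArg _ h5⟩
      choose b hb hb' using h6
      let h : φ.shapeTerm ⟶ X := heapHom a ha b hb
      have e : heapCtx (S := {Fin.last (k + 1)}) h = _ := heapCtx_eq hl' ha'
      refine ⟨.inl ⟨φ, h⟩, Subtype.ext (Subtype.ext ?_)⟩
      rw [heapCtx_eq_cons (S := {Fin.last (k + 1)}) h (last_depth φ), List.cons.injEq] at e
      simp only [Sum.elim_inl, heapTermElem, e]
      rw [← hb' _ _ (last_depth φ) rfl]
      rfl

theorem relabel_heapTermElem (f : X ⟶ Y) {k : ℕ} (φ : MinHeap (k + 1)) (h : φ.shapeTerm ⟶ X) :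
    relabelElem f (heapTermElem ⟨φ, h⟩) = heapTermElem ⟨φ, h ≫ f⟩ := by
  exact Subtype.ext (Subtype.ext
    (Judgement.ext (tail_heapCtx_comp (S := {Fin.last _}) h f) rfl))

theorem relabel_heapProjectionElem (f : X ⟶ Y) {k : ℕ} (p : MinHeap k × Fin k)
    (h : p.1.shape ⟶ X) :
    relabelElem f (heapProjectionElem ⟨p, h⟩) = heapProjectionElem ⟨p, h ≫ f⟩ := by
  exact Subtype.ext (Subtype.ext
    (Judgement.ext (heapCtx_comp (S := ∅) h f).symm rfl))

end Familial

end TTStr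

/-! ### Familially representable endofunctors -/

namespace TTStr

/-- A square of type-and-term structures is a pullback if it is so at each vertex. -/
theorem isPullback_of_el {W X Y Z : TTStr.{u}} {fst : W ⟶ X} {snd : W ⟶ Y} {f : X ⟶ Z}
    {g : Y ⟶ Z} (w : fst ≫ f = snd ≫ g)
    (inj : ∀ v (a b : W.El v), onEl fst v a = onEl fst v b → onEl snd v a = onEl snd v b → a = b)
    (surj : ∀ v (x : X.El v) (y : Y.El v), onEl f v x = onEl g v y →
      ∃ a, onEl fst v a = x ∧ onEl snd v a = y) : IsPullback fst snd f g :=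
  .of_forall_isPullback_app fun v => (Limits.Types.isPullback_iff _ _ _ _).mpr
    ⟨congrArg (fun t => t.app v) w, fun a b h => inj v.unop a b h.1 h.2,
      fun x y h => surj v.unop x y h⟩

/-- A functor whose value at each vertex is a coproduct of representable functors. -/
structure Familial (P : TTStr.{u} ⥤ TTStr.{u}) where
  index : HVertex → Type
  arity : ∀ v, index v → TTStr.{u}
  equiv : ∀ v X, (Σ i, arity v i ⟶ X) ≃ (P.obj X).El v
  equiv_comp : ∀ v {X Y : TTStr.{u}} (f : X ⟶ Y) i (h : arity v i ⟶ X),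
    equiv v Y ⟨i, h ≫ f⟩ = onEl (P.map f) v (equiv v X ⟨i, h⟩)

namespace Familial

variable {P : TTStr.{u} ⥤ TTStr.{u}} (F : Familial P)

include F

/-- The action of a map never changes the index of the summand. -/
theorem exists_of_onEl_eq {v : HVertex} {X Y : TTStr.{u}} (f : X ⟶ Y) {a : (P.obj X).El v}
    {i : F.index v} {h : F.arity v i ⟶ Y} (e : onEl (P.map f) v a = F.equiv v Y ⟨i, h⟩) :
    ∃ g, F.equiv v X ⟨i, g⟩ = a ∧ g ≫ f = h := by
  obtain ⟨⟨j, g⟩, rfl⟩ := (F.equiv v X).surjective a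
  rw [← F.equiv_comp] at e
  cases (F.equiv v Y).injective e
  exact ⟨g, rfl, rfl⟩

/-- Representable functors preserve pullbacks, and a compatible pair of elements lies in a single
summand. -/
theorem preservesPullbacks : Limits.PreservesLimitsOfShape Limits.WalkingCospan P := by
  refine Limits.preservesLimitsOfShape_walkingCospan_of_forall_isPullback
    fun X Y Z f g _ => ?_
  have hp := IsPullback.of_hasPullback f g
  refine ⟨_, _, _, hp, ?_⟩
  refine isPullback_of_el ?_ (fun v a b h1 h2 => ?_) (fun v x y h => ?_)
  · rw [← P.map_comp, hp.w, P.map_comp]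
  · obtain ⟨⟨i, b⟩, rfl⟩ := (F.equiv v _).surjective b
    rw [← F.equiv_comp] at h1 h2
    obtain ⟨a, rfl, h3⟩ := F.exists_of_onEl_eq _ h1
    rw [← F.equiv_comp] at h2
    have h4 := (F.equiv v _).injective h2
    simp only [Sigma.mk.injEq, heq_eq_eq, true_and] at h4
    rw [hp.hom_ext h3 h4]
  · obtain ⟨⟨i, y⟩, rfl⟩ := (F.equiv v _).surjective y
    rw [← F.equiv_comp] at h
    obtain ⟨x, rfl, h3⟩ := F.exists_of_onEl_eq _ h
    refine ⟨F.equiv v _ ⟨i, hp.lift x y h3⟩, ?_, ?_⟩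
    · rw [← F.equiv_comp, hp.lift_fst]
    · rw [← F.equiv_comp, hp.lift_snd]

/-- By Yoneda, `b` is an element of a summand, that is, an index `i` with a map `h` out of the
arity. The left adjoint takes the value `h` there, with the element `(i, 𝟙)` as universal arrow. -/
theorem leftAdjointObjIsDefined_uliftYoneda (X : TTStr.{u}) (v : HVertex)
    (b : uliftYoneda.{u}.obj (vertex v) ⟶ P.obj X) :
    (Over.post (X := X) P).leftAdjointObjIsDefined (Over.mk b) := by
  obtain ⟨⟨i, h⟩, hb⟩ := (F.equiv v X).surjective (uliftYonedaEquiv b)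
  let c : uliftYoneda.{u}.obj (vertex v) ⟶ P.obj (F.arity v i) :=
    uliftYonedaEquiv.symm (F.equiv v _ ⟨i, 𝟙 _⟩)
  have hc : ∀ {Y : TTStr.{u}} (g : F.arity v i ⟶ Y),
      uliftYonedaEquiv (c ≫ P.map g) = F.equiv v Y ⟨i, g⟩ := by
    intro Y g
    rw [uliftYonedaEquiv_comp, Equiv.apply_symm_apply]
    refine (F.equiv_comp v g i (𝟙 _)).symm.trans ?_
    rw [Category.id_comp]
  let e : Over.mk b ⟶ (Over.post (X := X) P).obj (Over.mk h) :=
    Over.homMk c (uliftYonedaEquiv.injective ((hc h).trans hb))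
  refine Functor.CorepresentableBy.isCorepresentable (X := Over.mk h)
    { homEquiv := fun {Y} => Equiv.ofBijective (fun g => e ≫ (Over.post P).map g) ⟨?_, ?_⟩
      homEquiv_comp := fun g f => ?_ }
  · intro g g' hg
    have h1 : c ≫ P.map g.left = c ≫ P.map g'.left := congrArg (fun t => t.left) hg
    have h2 := (hc g.left).symm.trans ((congrArg uliftYonedaEquiv h1).trans (hc g'.left))
    have h3 := (F.equiv v _).injective h2
    simp only [Sigma.mk.injEq, heq_eq_eq, true_and] at h3
    exact Over.OverMorphism.ext h3
  · intro g
    have h1 : g.left ≫ P.map Y.hom = b := Over.w g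
    have h2 := hb.trans ((congrArg uliftYonedaEquiv h1.symm).trans (uliftYonedaEquiv_comp _ _))
    obtain ⟨k, hk, hk'⟩ := F.exists_of_onEl_eq Y.hom h2.symm
    refine ⟨Over.homMk k hk', Over.OverMorphism.ext (uliftYonedaEquiv.injective ?_)⟩
    exact (hc k).trans hk
  · change e ≫ (Over.post P).map (f ≫ g) = (e ≫ (Over.post P).map f) ≫ (Over.post P).map g
    rw [Functor.map_comp, Category.assoc]

/-- Every object over `P.obj X` is a colimit of representables over it, since the forgetful functor
of a slice reflects colimits. The objects at which a left adjoint is defined are closed under these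
colimits. -/
theorem isLocalRightAdjoint : IsLocalRightAdjoint P := by
  intro X
  refine Functor.isRightAdjoint_of_leftAdjointObjIsDefined_eq_top (eq_top_iff.mpr fun B _ => ?_)
  let c : Limits.Cocone (CostructuredArrow.toOver uliftYoneda.{u} B.left ⋙ Over.map B.hom) :=
    { pt := B
      ι := { app := fun j => Over.homMk j.hom
             naturality := fun j j' f => Over.OverMorphism.ext
               ((CostructuredArrow.w f).trans (Category.comp_id _).symm) } }
  have hc : Limits.IsColimit c := Limits.isColimitOfReflects (Over.forget _)
    (Presheaf.isColimitTautologicalCocone'.{u} B.left)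
  exact Functor.leftAdjointObjIsDefined_of_isColimit hc fun j =>
    F.leftAdjointObjIsDefined_uliftYoneda X j.left _

end Familial

end TTStr

/-! ### The weakening-and-projection monad -/

namespace TTStr

section

variable {X Y : TTStr.{u}}

/-- Elements of the free theory, as congruence classes. -/
def elemEquiv (v : HVertex) : X.free.Elem v ≃ X.P.El v where
  toFun J := Quotient.mk (X.free.elemSetoid v) J
  invFun c := rep c
  left_inv _ := rfl
  right_inv c := mk_rep c

theorem elemEquiv_relabelElem (f : X ⟶ Y) {v : HVertex} (J : X.free.Elem v) :
    elemEquiv v (relabelElem f J) = onEl (Pmap f) v (elemEquiv v J) :=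
  (freeFunctor_map_mk f J).symm

theorem freeAdj_unit_equifibered : NatTrans.Equifibered freeAdj.{u}.unit := by
  intro X Y f
  refine isPullback_of_el (freeAdj.unit.naturality f) (fun v a b _ h => ?_) (fun v y c h => ?_)
  · rw [freeAdj_unit] at h
    have h1 := (elemEquiv v).injective
      (a₁ := ⟨⟨gen v a, free_gen v a⟩, gen_hasShape v a⟩)
      (a₂ := ⟨⟨gen v b, free_gen v b⟩, gen_hasShape v b⟩) h
    exact gen_injective (congrArg (fun J => J.1.1) h1)
  · rw [freeAdj_unit] at h
    rw [freeAdj_unit]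
    obtain ⟨J, rfl⟩ := (elemEquiv v).surjective c
    have h1 := (elemEquiv v).injective (a₁ := ⟨⟨gen v y, free_gen v y⟩, gen_hasShape v y⟩)
      (h.trans (elemEquiv_relabelElem f J).symm)
    obtain ⟨x, hx, hy⟩ := exists_gen_of_relabel_eq f J.1.2 J.2
      (congrArg (fun J => J.1.1) h1).symm
    exact ⟨x, hy, congrArg (elemEquiv v) (Subtype.ext (Subtype.ext hx))⟩

/-- The judgement denoted by a judgement of the free theory on the elements of a free theory. -/
noncomputable def flatElem {v : HVertex} (J : X.P.free.Elem v) : X.free.Elem v :=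
  ⟨X.flattenRealization.interp.toFun J.1, X.flattenRealization.interp.hasShape J.1 J.2⟩

theorem elemEquiv_flatElem {v : HVertex} (J : X.P.free.Elem v) :
    elemEquiv v (flatElem J) =
      onEl (WPGat.forgetful.map (freeAdj.counit.app X.free)) v (elemEquiv v J) := by
  rw [freeAdj_counit]
  rfl

theorem freeAdj_mul_equifibered : NatTrans.Equifibered freeAdj.{u}.toMonad.μ := by
  intro X Y f
  refine isPullback_of_el (freeAdj.toMonad.μ.naturality f) (fun v a b h h' => ?_)
    (fun v c d h => ?_)
  · obtain ⟨J, rfl⟩ := (elemEquiv (X := X.P) v).surjective a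
    obtain ⟨K, rfl⟩ := (elemEquiv (X := X.P) v).surjective b
    have h1 := (elemEquiv v).injective ((elemEquiv_relabelElem (Pmap f) J).trans
      (h.trans (elemEquiv_relabelElem (Pmap f) K).symm))
    have h2 := (elemEquiv v).injective ((elemEquiv_flatElem J).trans
      (h'.trans (elemEquiv_flatElem K).symm))
    exact congrArg _ (Subtype.ext (Subtype.ext (eq_of_flat f J.1.2 K.1.2 J.2 K.2
      (congrArg (fun J => J.1.1) h1) (congrArg (fun J => J.1.1) h2))))
  · obtain ⟨K, rfl⟩ := (elemEquiv (X := Y.P) v).surjective c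
    obtain ⟨J, rfl⟩ := (elemEquiv (X := X) v).surjective d
    have h1 := (elemEquiv v).injective ((elemEquiv_flatElem K).trans
      (h.trans (elemEquiv_relabelElem f J).symm))
    obtain ⟨L, hL, hs, hJ, hK⟩ := exists_flat f K.1.2 J.1.2 K.2 J.2
      (congrArg (fun J => J.1.1) h1)
    refine ⟨elemEquiv (X := X.P) v ⟨⟨L, hL⟩, hs⟩, ?_, ?_⟩
    · exact (elemEquiv_relabelElem (Pmap f) _).symm.trans
        (congrArg _ (Subtype.ext (Subtype.ext hK)))
    · exact (elemEquiv_flatElem _).symm.trans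
        (congrArg _ (Subtype.ext (Subtype.ext hJ)))

end

/-! #### Transfer along the uniqueness of left adjoints -/

section Transfer

variable {G : TTStr.{u} ⥤ WPGat.{u}} (adj : G ⊣ WPGat.forgetful.{u})

/-- The comparison of the induced monad with the one of the free theories. -/
noncomputable def freeIso : freeFunctor ≅ G := freeAdj.leftAdjointUniq adj

theorem unit_equifibered : NatTrans.Equifibered adj.unit := by
  rw [← Adjunction.unit_leftAdjointUniq_hom freeAdj adj]
  exact freeAdj_unit_equifibered.comp (.of_isIso _)

/-- The two multiplications are conjugate under the comparison of monads, and transformations with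
cartesian squares compose and include isomorphisms. -/
theorem mul_equifibered : NatTrans.Equifibered adj.toMonad.μ := by
  let γ := Functor.isoWhiskerRight (freeIso adj) WPGat.forgetful
  have h : (NatTrans.hcomp γ.inv γ.inv) ≫ freeAdj.toMonad.μ ≫ γ.hom = adj.toMonad.μ := by
    refine NatTrans.ext (funext fun X => ?_)
    have h1 : (freeIso adj).inv.app _ ≫ freeAdj.counit.app (G.obj X) = adj.counit.app (G.obj X) :=
      Adjunction.leftAdjointUniq_hom_app_counit adj freeAdj (G.obj X)
    have h2 := freeAdj.counit.naturality ((freeIso adj).inv.app X)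
    -- Naturality moves the inner comparison past the counit, where it cancels against the last one.
    have h3 : (freeIso adj).inv.app (WPGat.forgetful.obj (G.obj X)) ≫
        freeFunctor.map (WPGat.forgetful.map ((freeIso adj).inv.app X)) ≫
        freeAdj.counit.app (freeFunctor.obj X) ≫ (freeIso adj).hom.app X =
        adj.counit.app (G.obj X) := by
      rw [← h1, ← Category.assoc (freeFunctor.map _)]
      erw [h2]
      simp
    refine Eq.trans ?_ (congrArg (fun t => WPGat.forgetful.map t) h3)
    simp only [Functor.map_comp]
    exact Category.assoc _ _ _
  have := γ.isIso_hom
  rw [← h]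
  exact (NatTrans.Equifibered.of_isIso (NatIso.hcomp γ γ).inv).comp
    (freeAdj_mul_equifibered.comp (.of_isIso γ.hom))

/-- The elements of the induced monad, as elements of the free theory. -/
noncomputable def freeElemEquiv (v : HVertex) (X : TTStr.{u}) :
    X.free.Elem v ≃ (WPGat.forgetful.obj (G.obj X)).El v :=
  (elemEquiv v).trans
    (((Functor.isoWhiskerRight (freeIso adj) WPGat.forgetful).app X).app _).toEquiv

theorem freeElemEquiv_apply {v : HVertex} {X : TTStr.{u}} (J : X.free.Elem v) :
    freeElemEquiv adj v X J =
      onEl (WPGat.forgetful.map ((freeIso adj).hom.app X)) v (elemEquiv v J) := rfl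

theorem freeElemEquiv_relabelElem {v : HVertex} {X Y : TTStr.{u}} (f : X ⟶ Y)
    (J : X.free.Elem v) : freeElemEquiv adj v Y (relabelElem f J) =
      onEl (WPGat.forgetful.map (G.map f)) v (freeElemEquiv adj v X J) := by
  rw [freeElemEquiv_apply, elemEquiv_relabelElem]
  exact ConcreteCategory.congr_hom (congrArg (fun t => t.app (op (vertex v)))
    ((Functor.isoWhiskerRight (freeIso adj) WPGat.forgetful).hom.naturality f)) _

/-- The term-elements of the induced monad, as labelled heaps. -/
noncomputable def heapEquiv (k : ℕ) (X : TTStr.{u}) :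
    HeapTerms k X ⊕ HeapProjections k X ≃ (WPGat.forgetful.obj (G.obj X)).El (.tm k) :=
  (Equiv.ofBijective _ (heapElem_bijective k)).trans (freeElemEquiv adj (.tm k) X)

theorem heapEquiv_inl_comp {k : ℕ} {X Y : TTStr.{u}} (f : X ⟶ Y) (φ : MinHeap (k + 1))
    (h : φ.shapeTerm ⟶ X) : heapEquiv adj k Y (.inl ⟨φ, h ≫ f⟩) =
      onEl (WPGat.forgetful.map (G.map f)) (.tm k) (heapEquiv adj k X (.inl ⟨φ, h⟩)) :=
  (congrArg (freeElemEquiv adj (.tm k) Y) (relabel_heapTermElem f φ h).symm).trans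
    (freeElemEquiv_relabelElem adj f _)

theorem heapEquiv_inr_comp {k : ℕ} {X Y : TTStr.{u}} (f : X ⟶ Y) (p : MinHeap k × Fin k)
    (h : p.1.shape ⟶ X) : heapEquiv adj k Y (.inr ⟨p, h ≫ f⟩) =
      onEl (WPGat.forgetful.map (G.map f)) (.tm k) (heapEquiv adj k X (.inr ⟨p, h⟩)) :=
  (congrArg (freeElemEquiv adj (.tm k) Y) (relabel_heapProjectionElem f p h).symm).trans
    (freeElemEquiv_relabelElem adj f _)

/-- The induced monad is familially representable. -/
noncomputable def familial : Familial (G ⋙ WPGat.forgetful) where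
  index
    | .ty k => MinHeap (k + 1)
    | .tm k => MinHeap (k + 1) ⊕ MinHeap k × Fin k
  arity
    | .ty _ => fun φ => φ.shape
    | .tm _ => Sum.elim (fun φ => φ.shapeTerm) (fun p => p.1.shape)
  equiv
    | .ty k => fun X =>
      (Equiv.ofBijective _ (heapTypeElem_bijective k)).trans (freeElemEquiv adj (.ty k) X)
    | .tm k => fun X => (Equiv.sumSigmaDistrib _).trans (heapEquiv adj k X)
  equiv_comp
    | .ty k => fun f φ h =>
      (congrArg (freeElemEquiv adj (.ty k) _) (relabel_heapTypeElem f φ h).symm).trans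
        (freeElemEquiv_relabelElem adj f _)
    | .tm _ => fun f i h => by
      rcases i with φ | p
      · exact heapEquiv_inl_comp adj f φ h
      · exact heapEquiv_inr_comp adj f p h

theorem isProjection_map {T U : WPGat.{u}} (g : T ⟶ U) {k : ℕ} {i : Fin k}
    {a : (WPGat.forgetful.obj T).El (.tm k)} (h : T.IsProjection i a) :
    U.IsProjection i (onEl (WPGat.forgetful.map g) (.tm k) a) := by
  induction g using Quotient.inductionOn with
  | h φ =>
    obtain ⟨J, A, hJ, rfl⟩ := h
    obtain ⟨A', hA'⟩ := φ.body_var J.1.2 hJ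
    exact ⟨⟨φ.toFun J.1, φ.hasShape J.1 J.2⟩, A', hA', rfl⟩

/-- The comparison and its inverse both preserve variables, so being a projection can be tested in
the free theory, where each class has a unique representative. -/
theorem isProjection_freeElemEquiv {k : ℕ} {X : TTStr.{u}} {i : Fin k} {J : X.free.Elem (.tm k)} :
    (G.obj X).IsProjection i (freeElemEquiv adj (.tm k) X J) ↔
      ∃ A, J.1.1.body = .term (.var i) A := by
  rw [freeElemEquiv_apply]
  refine ⟨fun h => ?_, fun ⟨A, hA⟩ => isProjection_map _ ⟨J, A, hA, rfl⟩⟩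
  have h1 := isProjection_map ((freeIso adj).inv.app X) h
  have h2 : onEl (WPGat.forgetful.map ((freeIso adj).inv.app X)) (.tm k)
      (onEl (WPGat.forgetful.map ((freeIso adj).hom.app X)) (.tm k) (elemEquiv (.tm k) J)) =
      elemEquiv (.tm k) J :=
    ConcreteCategory.congr_hom
      ((((Functor.isoWhiskerRight (freeIso adj) WPGat.forgetful).app X).app _).hom_inv_id) _
  rw [h2] at h1
  obtain ⟨K, A, hK, e⟩ := h1
  rw [(elemEquiv (.tm k)).injective e]
  exact ⟨A, hK⟩

end Transfer

end TTStr

theorem mainTheorem5 :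
    WPGat.forgetful.{u}.IsRightAdjoint ∧
    ∀ (G : TTStr.{u} ⥤ WPGat.{u}) (adj : G ⊣ WPGat.forgetful.{u}),
      IsStronglyCartesianMonad adj.toMonad ∧
      ∀ k : ℕ, ∃ e : ∀ X : TTStr.{u}, HeapTerms k X ⊕ HeapProjections k X ≃
          (adj.toMonad.toFunctor.obj X).obj (op (TTStr.vertex (.tm k))),
        (∀ (X Y : TTStr.{u}) (f : X ⟶ Y) (φ : MinHeap (k + 1)) (h : φ.shapeTerm ⟶ X),
          e Y (.inl ⟨φ, h ≫ f⟩) =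
            (adj.toMonad.toFunctor.map f).app (op (TTStr.vertex (.tm k))) (e X (.inl ⟨φ, h⟩))) ∧
        (∀ (X Y : TTStr.{u}) (f : X ⟶ Y) (p : MinHeap k × Fin k) (h : p.1.shape ⟶ X),
          e Y (.inr ⟨p, h ≫ f⟩) =
            (adj.toMonad.toFunctor.map f).app (op (TTStr.vertex (.tm k))) (e X (.inr ⟨p, h⟩))) ∧
        (∀ (X : TTStr.{u}) (a : HeapTerms k X) (i : Fin k),
          ¬ (G.obj X).IsProjection i (e X (.inl a))) ∧
        (∀ (X : TTStr.{u}) (p : MinHeap k × Fin k) (h : p.1.shape ⟶ X) (i : Fin k),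
          (G.obj X).IsProjection i (e X (.inr ⟨p, h⟩)) ↔ i = p.2) := by
  refine ⟨TTStr.freeAdj.isRightAdjoint, fun G adj => ⟨⟨⟨(TTStr.familial adj).preservesPullbacks,
    TTStr.unit_equifibered adj, TTStr.mul_equifibered adj⟩,
    (TTStr.familial adj).isLocalRightAdjoint⟩, fun k => ⟨TTStr.heapEquiv adj k,
    fun X Y f φ h => TTStr.heapEquiv_inl_comp adj f φ h,
    fun X Y f p h => TTStr.heapEquiv_inr_comp adj f p h, fun X a i hi => ?_,
    fun X p h i => (TTStr.isProjection_freeElemEquiv adj).trans ⟨?_, ?_⟩⟩⟩⟩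
  · obtain ⟨A, hA⟩ := (TTStr.isProjection_freeElemEquiv adj).mp hi
    -- The term of an element of the first summand is an applied constant, not a variable.
    cases hA
  · rintro ⟨A, hA⟩
    injection hA with hA
    injection hA with hA
    exact Fin.ext hA.symm
  · rintro rfl
    exact ⟨_, rfl⟩
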